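/- **Model.** A network has sources $S_1,\dots,S_N$, a relay $R$ with $L_R\ge1$ antennas, a destination $D$ with $L_D\ge1$ antennas, eavesdroppers $E_1,\dots,E_M$ with $L_{E_k}\ge1$ antennas, and a primary receiver $P$. For each channel $q\in\{S_iR,S_iE_k,S_iP,RD,RE_k,RP\}$ and each antenna of its receiver ($P$ has one), the channel gain is Gamma distributed with shape $m_q>0$ and rate $\lambda_q=m_q/\Omega_q$, where $\Omega_q>0$ is the mean gain; all gains are independent. Let $\mathcal E_q$ be the sum of the gains of $q$ over the antennas of its receiver, $L_q$ the number of these antennas, and $\ell_q=L_qm_q$ (so $\ell_{S_iR}=L_Rm_{S_iR}$, $\ell_{S_iE_k}=L_{E_k}m_{S_iE_k}$, $\ell_{RD}=L_Dm_{RD}$, $\ell_{RE_k}=L_{E_k}m_{RE_k}$); assume that $\ell_{S_iR}$, $\ell_{S_iE_k}$ and $\ell_{RD}$ are integers. Let $\bar\gamma_I>0$ be the interference SNR and let the maximum transmit SNRs be $\bar\gamma_{S_i}=\bar\gamma_I/\sigma_i$ and $\bar\gamma_R=\bar\gamma_I/\delta$ with fixed $\sigma_i,\delta>0$. Put $X_i=\min(\bar\gamma_{S_i},\bar\gamma_I/\mathcal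 E_{S_iP})$, $X_R=\min(\bar\gamma_R,\bar\gamma_I/\mathcal E_{RP})$, and $$\gamma_R^{(i)}=X_i\mathcal E_{S_iR},\quad \gamma_{1E}^{(i,k)}=X_i\mathcal E_{S_iE_k},\quad \gamma_{1E}^{(i,k,J)}=\frac{X_i\mathcal E_{S_iE_k}}{X_J\mathcal E_{S_JE_k}+1},\quad \gamma_D=X_R\mathcal E_{RD},\quad \gamma_{2E}^{(k)}=X_R\mathcal E_{RE_k}.$$ Let $C(a,b)=\log_2\frac{1+a}{1+b}$ if $a>b$ and $C(a,b)=0$ otherwise. For a secrecy rate $R_s>0$ the secrecy outage probabilities, without a jammer and with jammer $S_J$ ($J\ne i$), are $$SOP^{(i)}=1-\prod_{k=1}^M\Pr\big(\min(C(\gamma_R^{(i)},\gamma_{1E}^{(i,k)}),C(\gamma_D,\gamma_{2E}^{(k)}))\ge R_s\big),$$ $$SOP^{(i,J)}=1-\prod_{k=1}^M\Pr\big(\min(C(\gamma_R^{(i)},\gamma_{1E}^{(i,k,J)}),C(\gamma_D,\gamma_{2E}^{(k)}))\ge R_s\big).$$ **Constants.** Let $\gamma=2^{R_s}$, $\xi_q=\lambda_q(\gamma-1)$,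 $\varphi_{S_i}=\lambda_{S_iP}\sigma_i$, $\varphi_J=\varphi_{S_J}$, $\varsigma=\frac{\lambda_{S_JE_k}}{\lambda_{S_JP}\lambda_{S_iE_k}}$, $\varpi=\gamma\lambda_{S_iR}+\lambda_{S_iE_k}$; $\gamma(\cdot,\cdot)$ and $\Gamma(\cdot,\cdot)$ are the lower and upper incomplete Gamma functions and $G$ is the Meijer G-function. For a wiretap channel $e$, a legitimate channel $c$, a transmitter $u$ and its ratio $r$ ($r=\sigma_i$ for $u=S_i$, $r=\delta$ for $u=R$), with $\varphi=\lambda_{uP}r$, $$\mathcal A_{e,c}(y)=\frac{1}{\Gamma(\ell_e)\Gamma(\ell_c)}G^{1,2}_{2,2}\Big(\frac{\lambda_e}{\lambda_c\gamma}\,\Big|\,{-\ell_c+y,\;1\atop \ell_e,\;0}\Big),$$ $$\mathcal A'_{e,c,u}=\frac{\xi_c(\ell_c-1)\mathcal A_{e,c}(2)}{\Gamma(m_{uP})}\Big[r\gamma(m_{uP},\varphi)+\frac{\Gamma(m_{uP}+1,\varphi)}{\lambda_{uP}}\Big]-\frac{\xi_c\mathcal A_{e,c}(1)}{\Gamma(m_{uP})}\Big[r\big(\gamma(m_{uP},\varphi)+\varphi^{m_{uP}-1}e^{-\varphi}\big)+\frac{m_{uP}}{\lambda_{uP}}\Gamma(m_{uP},\varphi)\Big].$$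 Write $A_k=\mathcal A_{RE_k,RD}(1)$, $A'_k=\mathcal A'_{RE_k,RD,R}$, $B_k=\mathcal A_{S_iE_k,S_iR}(1)$, $B'_k=\mathcal A'_{S_iE_k,S_iR,S_i}$. For fixed $i,J,k$ let $a=\ell_{S_iR}$, $b=\ell_{S_iE_k}$, $c=\ell_{S_JE_k}$, $$\alpha=\frac{\lambda_{S_iR}^{a}}{\Gamma(a)\Gamma(b)\Gamma(c)\Gamma(m_{S_JP})},\quad \Upsilon_l=\binom{a-1}{l}\gamma^l(\gamma-1)^{a-1-l},\quad \Omega_h=\binom{b-1}{h}\lambda_{S_iE_k}^{b-h-1},$$ $$U_p=\gamma(m_{S_iP},\varphi_{S_i})\sigma_i^p+\frac{\Gamma(m_{S_iP}+p,\varphi_{S_i})}{\lambda_{S_iP}^p},\quad V_p=\gamma(m_{S_JP},\varphi_J)\Big(\frac{\sigma_J\lambda_{S_JE_k}}{\lambda_{S_iE_k}}\Big)^p+\Gamma(m_{S_JP}+p,\varphi_J)\varsigma^p,$$ $$\mathcal C_1^{(i,k,J)}=\frac1{\Gamma(m_{S_iP})}\Big\{\frac{U_a\,\xi_{S_iR}^a}{a\Gamma(a)}+\gamma\alpha\sum_{l=0}^{a-1}\Upsilon_l\,U_{a-l-1}\frac{\Gamma(c-l-1)\Gamma(b+l+1)}{l+1}V_{l+1}\Big\},$$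 $$\mathcal C_2^{(i,k,J)}=\frac{\gamma^a\alpha}{c}V_c\sum_{h=0}^{b-1}\Omega_h\frac{\Gamma(b+a-c-h-1)\Gamma(c+h+1)}{\varpi^{\,b+a-c-h-1}},\qquad \mathcal C_3^{(i,k,J)}=\gamma^a\alpha V_c\frac{(-1)^{c-a}\,\Gamma(b+c)}{\varpi^{\,a-c}\,c}.$$ Finally $\mathcal P(q)=1-\operatorname{sgn}(\ell_q-1)$. **Theorem 2.** Let $1\le i\le N$. As $\bar\gamma_I\to\infty$: Without a jammer, $$SOP^{(i)}=1-\prod_{k=1}^MA_kB_k-\frac1{\bar\gamma_I}\sum_{k=1}^M\Big(\prod_{j\ne k}A_jB_j\Big)\big(A_kB'_k+B_kA'_k\big)+o\Big(\frac1{\bar\gamma_I}\Big).$$ With jammer $S_J$, $J\ne i$: 1. if $L_Rm_{S_iR}<L_{E_k}m_{S_JE_k}$ for all $k$, then $$SOP^{(i,J)}=1-\prod_kA_k-\frac1{\bar\gamma_I}\sum_k\Big(\prod_{j\ne k}A_j\Big)\big(A'_k-A_k\mathcal P(S_iR)\,\mathcal C_1^{(i,k,J)}\big)+o\Big(\frac1{\bar\gamma_I}\Big);$$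 2. if $L_Rm_{S_iR}>L_{E_k}m_{S_JE_k}$ for all $k$, then $$SOP^{(i,J)}=1-\prod_kA_k-\frac1{\bar\gamma_I}\sum_k\Big(\prod_{j\ne k}A_j\Big)\big(A'_k-A_k\mathcal P(S_JE_k)\,\mathcal C_2^{(i,k,J)}\big)+o\Big(\frac1{\bar\gamma_I}\Big);$$ 3. if $L_Rm_{S_iR}=L_{E_k}m_{S_JE_k}=1$ for all $k$, then $$SOP^{(i,J)}=1-\prod_kA_k+\frac{\log\bar\gamma_I}{\bar\gamma_I}\sum_k\Big(\prod_{j\ne k}A_j\Big)A_k\,\mathcal C_3^{(i,k,J)}+o\Big(\frac{\log\bar\gamma_I}{\bar\gamma_I}\Big);$$ 4. if $L_Rm_{S_iR}=L_{E_k}m_{S_JE_k}>1$ for all $k$, then $$SOP^{(i,J)}=1-\prod_kA_k-\frac1{\bar\gamma_I}\sum_k\Big(\prod_{j\ne k}A_j\Big)A'_k+o\Big(\frac1{\bar\gamma_I}\Big).$$ -/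

import Mathlib

open MeasureTheory ProbabilityTheory Filter Asymptotics

noncomputable section

/-! Special functions -/

/-- The lower incomplete Gamma function `γ(s, x) = ∫₀ˣ t^(s-1) e^(-t) dt`. -/
def lowerGamma (s x : ℝ) : ℝ :=
  ∫ t in Set.Ioc 0 x, t ^ (s - 1) * Real.exp (-t)

/-- The upper incomplete Gamma function `Γ(s, x) = ∫ₓ^∞ t^(s-1) e^(-t) dt`. -/
def upperGamma (s x : ℝ) : ℝ :=
  ∫ t in Set.Ioi x, t ^ (s - 1) * Real.exp (-t)

/-- The Mellin-Barnes kernel of the Meijer G-function with upper parameters `aN` (the first `n`)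
and `aP` (the others), and lower parameters `bM` (the first `m`) and `bQ` (the others):
`∏ Γ(b_j + s) ∏ Γ(1 - a_j - s) / (∏ Γ(1 - b_j - s) ∏ Γ(a_j + s))`. -/
def meijerKernel (aN aP bM bQ : List ℂ) (s : ℂ) : ℂ :=
  (bM.map fun b => Complex.Gamma (b + s)).prod * (aN.map fun a => Complex.Gamma (1 - a - s)).prod /
    ((bQ.map fun b => Complex.Gamma (1 - b - s)).prod * (aP.map fun a => Complex.Gamma (a + s)).prod)

/-- The vertical line `Re s = c` has all poles of the `Γ(b_j + s)` on its left and all poles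
of the `Γ(1 - a_j - s)` on its right. -/
def MeijerSeparates (aN bM : List ℂ) (c : ℝ) : Prop :=
  (∀ b ∈ bM, -b.re < c) ∧ (∀ a ∈ aN, c < 1 - a.re)

open Classical in
/-- The Meijer G-function `G_{p,q}^{m,n}(z | aN; aP, bM; bQ)` for `z > 0`, as the Mellin-Barnes
integral `(1 / 2πi) ∫ kernel(s) z^(-s) ds` along a vertical line that separates the two
families of poles. -/
def meijerG (aN aP bM bQ : List ℂ) (z : ℝ) : ℂ :=
  if h : ∃ c : ℝ, MeijerSeparates aN bM c then
    mellinInv h.choose (meijerKernel aN aP bM bQ) z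
  else 0

/-! The network -/

/-- The channels of a network with sources `S_i` (`i : Fin N`), relay `R`, destination `D`,
eavesdroppers `E_k` (`k : Fin M`) and primary receiver `P`. -/
inductive Channel (N M : ℕ) : Type
  | SR (i : Fin N)
  | SE (i : Fin N) (k : Fin M)
  | SP (i : Fin N)
  | RD
  | RE (k : Fin M)
  | RP

open Channel

/-- The parameters of the network. -/
structure Network (N M : ℕ) where
  /-- number of antennas of the relay -/
  LR : ℕ
  /-- number of antennas of the destination -/
  LD : ℕ
  /-- numbers of antennas of the eavesdroppers -/
  LE : Fin M → ℕ
  /-- fading severities -/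
  m : Channel N M → ℝ
  /-- average channel power gains -/
  pow : Channel N M → ℝ
  /-- the ratios of the interference SNR to the maximum transmit SNRs of the sources -/
  σ : Fin N → ℝ
  /-- the ratio of the interference SNR to the maximum transmit SNR of the relay -/
  δ : ℝ
  /-- the secrecy rate -/
  Rs : ℝ
  LR_pos : 0 < LR
  LD_pos : 0 < LD
  LE_pos : ∀ k, 0 < LE k
  m_pos : ∀ q, 0 < m q
  pow_pos : ∀ q, 0 < pow q
  σ_pos : ∀ i, 0 < σ i
  δ_pos : 0 < δ
  Rs_pos : 0 < Rs

namespace Network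

variable {N M : ℕ} (S : Network N M)

/-- The number of antennas at the receiving end of a channel. -/
def antennas : Channel N M → ℕ
  | SR _ => S.LR
  | SE _ k => S.LE k
  | SP _ => 1
  | RD => S.LD
  | RE k => S.LE k
  | RP => 1

/-- A branch: a channel together with an antenna of its receiver. -/
abbrev Branch : Type := (q : Channel N M) × Fin (S.antennas q)

/-- The rate `λ_q = m_q / Ω_q`. -/
def lam (q : Channel N M) : ℝ := S.m q / S.pow q

/-- Nakagami-`m` fading: the channel gains are independent, and the gain of each branch of the
channel `q` is Gamma distributed with shape `m_q` and rate `λ_q`. -/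
structure IsNakagami {Ω : Type*} [MeasurableSpace Ω] (μ : Measure Ω)
    (g : S.Branch → Ω → ℝ) : Prop where
  measurable : ∀ b, Measurable (g b)
  law : ∀ b, μ.map (g b) = gammaMeasure (S.m b.1) (S.lam b.1)
  indep : iIndepFun g μ

/-- The product `L_v m_q` of the number of branches and the fading severity of a channel. -/
def shape (q : Channel N M) : ℝ := S.antennas q * S.m q

/-- The products `L_v m_q` of the channels `S_i R`, `S_i E_k` and `R D` are integers. -/
def IntegerShapes : Prop :=
  (∀ i, ∃ n : ℕ, S.shape (SR i) = n) ∧ (∀ i k, ∃ n : ℕ, S.shape (SE i k) = n) ∧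
    ∃ n : ℕ, S.shape RD = n

/-- `L_v m_q` as a natural number, where it is one. -/
def shapeNat (q : Channel N M) : ℕ := ⌊S.shape q⌋₊

section Model

variable {Ω : Type*} (g : S.Branch → Ω → ℝ)

/-- The total gain of a channel over the branches of its receiver (maximum-ratio combining). -/
def gain (q : Channel N M) (ω : Ω) : ℝ := ∑ u : Fin (S.antennas q), g ⟨q, u⟩ ω

/-- The transmit SNR of the source `S_i` at interference SNR `x`. -/
def snrS (i : Fin N) (x : ℝ) (ω : Ω) : ℝ := min (x / S.σ i) (x / S.gain g (SP i) ω)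

/-- The transmit SNR of the relay at interference SNR `x`. -/
def snrR (x : ℝ) (ω : Ω) : ℝ := min (x / S.δ) (x / S.gain g RP ω)

/-- The SNR at the relay. -/
def γR (i : Fin N) (x : ℝ) (ω : Ω) : ℝ := S.snrS g i x ω * S.gain g (SR i) ω

/-- The SNR at the eavesdropper `E_k` in the first hop without a jammer. -/
def γE1 (i : Fin N) (k : Fin M) (x : ℝ) (ω : Ω) : ℝ := S.snrS g i x ω * S.gain g (SE i k) ω

/-- The SNR at the eavesdropper `E_k` in the first hop with the jammer `S_J`. -/
def γE1J (i : Fin N) (k : Fin M) (J : Fin N) (x : ℝ) (ω : Ω) : ℝ :=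
  S.snrS g i x ω * S.gain g (SE i k) ω / (S.snrS g J x ω * S.gain g (SE J k) ω + 1)

/-- The SNR at the destination. -/
def γD (x : ℝ) (ω : Ω) : ℝ := S.snrR g x ω * S.gain g RD ω

/-- The SNR at the eavesdropper `E_k` in the second hop. -/
def γE2 (k : Fin M) (x : ℝ) (ω : Ω) : ℝ := S.snrR g x ω * S.gain g (RE k) ω

/-- The secrecy capacity of a link with SNR `a` against a wiretap link with SNR `b`. -/
def secrecyCapacity (a b : ℝ) : ℝ := if b < a then Real.logb 2 ((1 + a) / (1 + b)) else 0

variable [MeasurableSpace Ω] (μ : Measure Ω)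

/-- The secrecy outage probability `SOP^(i)` without a jammer at interference SNR `x`. -/
def sop (i : Fin N) (x : ℝ) : ℝ :=
  1 - ∏ k : Fin M, μ.real {ω | S.Rs ≤ min
    (secrecyCapacity (S.γR g i x ω) (S.γE1 g i k x ω))
    (secrecyCapacity (S.γD g x ω) (S.γE2 g k x ω))}

/-- The secrecy outage probability `SOP^(i,J)` with the jammer `S_J` at interference SNR `x`. -/
def sopJ (i J : Fin N) (x : ℝ) : ℝ :=
  1 - ∏ k : Fin M, μ.real {ω | S.Rs ≤ min
    (secrecyCapacity (S.γR g i x ω) (S.γE1J g i k J x ω))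
    (secrecyCapacity (S.γD g x ω) (S.γE2 g k x ω))}

end Model

/-! The constants of the expansions -/

/-- `γ = 2^(R_s)` -/
def γ : ℝ := 2 ^ S.Rs

/-- `ξ_q = λ_q (γ - 1)` -/
def ξ (q : Channel N M) : ℝ := S.lam q * (S.γ - 1)

/-- `φ_{S_i} = λ_{S_i P} σ_i` -/
def φ (i : Fin N) : ℝ := S.lam (SP i) * S.σ i

/-- `𝒜_{e,c,v}(y)` for a wiretap channel `e` and a legitimate channel `c`; the number of antennas
of the receiver `v` of `c` enters through `shape c`. -/
def A (e c : Channel N M) (y : ℝ) : ℝ :=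
  1 / (Real.Gamma (S.shape e) * Real.Gamma (S.shape c)) *
    (meijerG [((-S.shape c + y : ℝ) : ℂ), 1] [] [((S.shape e : ℝ) : ℂ)] [0]
      (S.lam e / (S.lam c * S.γ))).re

/-- `𝒜_{e,c,u,v}`, where `uP` is the channel from the transmitter `u` to the primary receiver and
`r` is the ratio of the interference SNR to the maximum transmit SNR of `u`. -/
def A' (e c uP : Channel N M) (r : ℝ) : ℝ :=
  S.ξ c * (S.shape c - 1) * S.A e c 2 / Real.Gamma (S.m uP) *
      (r * lowerGamma (S.m uP) (S.lam uP * r)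
        + upperGamma (S.m uP + 1) (S.lam uP * r) / S.lam uP)
    - S.ξ c * S.A e c 1 / Real.Gamma (S.m uP) *
      (r * (lowerGamma (S.m uP) (S.lam uP * r)
          + (S.lam uP * r) ^ (S.m uP - 1) * Real.exp (-(S.lam uP * r)))
        + S.m uP / S.lam uP * upperGamma (S.m uP) (S.lam uP * r))

/-- `𝒜_{RE_k,RD,D}(1)` -/
def A2nd (k : Fin M) : ℝ := S.A (RE k) RD 1

/-- `𝒜_{RE_k,RD,R,D}` -/
def A2nd' (k : Fin M) : ℝ := S.A' (RE k) RD RP S.δ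

/-- `𝒜_{S_iE_k,S_iR,R}(1)` -/
def A1st (i : Fin N) (k : Fin M) : ℝ := S.A (SE i k) (SR i) 1

/-- `𝒜_{S_iE_k,S_iR,S_i,R}` -/
def A1st' (i : Fin N) (k : Fin M) : ℝ := S.A' (SE i k) (SR i) (SP i) (S.σ i)

/-- `𝒫(q) = 1 - sgn(L_v m_q - 1)` -/
def P (q : Channel N M) : ℝ := 1 - Real.sign (S.shape q - 1)

/-- `α_i^(k,J)` -/
def α (i : Fin N) (k : Fin M) (J : Fin N) : ℝ :=
  1 / (Real.Gamma (S.shape (SE J k)) * Real.Gamma (S.m (SP J))) *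
    S.lam (SR i) ^ S.shapeNat (SR i) /
      (Real.Gamma (S.shape (SE i k)) * Real.Gamma (S.shape (SR i)))

/-- `ς_i^(k,J) = λ_{S_JE_k} / (λ_{S_JP} λ_{S_iE_k})` -/
def ς (i : Fin N) (k : Fin M) (J : Fin N) : ℝ :=
  S.lam (SE J k) / (S.lam (SP J) * S.lam (SE i k))

/-- `ϖ_i^(k) = γ λ_{S_iR} + λ_{S_iE_k}` -/
def ϖ (i : Fin N) (k : Fin M) : ℝ := S.γ * S.lam (SR i) + S.lam (SE i k)

/-- `Υ_l^(i)` -/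
def Υ (i : Fin N) (l : ℕ) : ℝ :=
  (S.shapeNat (SR i) - 1).choose l * S.γ ^ l * (S.γ - 1) ^ (S.shapeNat (SR i) - 1 - l)

/-- `Ω_h^(i,k)` -/
def Ωc (i : Fin N) (k : Fin M) (h : ℕ) : ℝ :=
  (S.shapeNat (SE i k) - 1).choose h * S.lam (SE i k) ^ (S.shapeNat (SE i k) - h - 1)

/-- The factor
`γ(m_{S_JP}, φ_J) (σ_J λ_{S_JE_k} / λ_{S_iE_k})^p + Γ(m_{S_JP} + p, φ_J) (ς_i^(k,J))^p`. -/
def jamFactor (i : Fin N) (k : Fin M) (J : Fin N) (p : ℕ) : ℝ :=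
  lowerGamma (S.m (SP J)) (S.φ J) * (S.σ J * S.lam (SE J k) / S.lam (SE i k)) ^ p
    + upperGamma (S.m (SP J) + p) (S.φ J) * S.ς i k J ^ p

/-- The factor
`γ(m_{S_iP}, φ_{S_i}) σ_i^p + Γ(m_{S_iP} + p, φ_{S_i}) / λ_{S_iP}^p`. -/
def srcFactor (i : Fin N) (p : ℕ) : ℝ :=
  lowerGamma (S.m (SP i)) (S.φ i) * S.σ i ^ p
    + upperGamma (S.m (SP i) + p) (S.φ i) / S.lam (SP i) ^ p

/-- `𝒞₁^(i,k,J)` -/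
def C₁ (i : Fin N) (k : Fin M) (J : Fin N) : ℝ :=
  1 / Real.Gamma (S.m (SP i)) *
    (S.srcFactor i (S.shapeNat (SR i)) *
        (S.ξ (SR i) ^ S.shapeNat (SR i) / (S.shape (SR i) * Real.Gamma (S.shape (SR i))))
      + S.γ * S.α i k J * ∑ l ∈ Finset.range (S.shapeNat (SR i)),
          S.Υ i l * S.srcFactor i (S.shapeNat (SR i) - l - 1) *
            (Real.Gamma (S.shape (SE J k) - l - 1) * Real.Gamma (S.shape (SE i k) + l + 1)
              / (l + 1)) *
            S.jamFactor i k J (l + 1))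

/-- `𝒞₂^(i,k,J)` -/
def C₂ (i : Fin N) (k : Fin M) (J : Fin N) : ℝ :=
  S.γ ^ S.shapeNat (SR i) * S.α i k J / S.shape (SE J k) *
    S.jamFactor i k J (S.shapeNat (SE J k)) *
    ∑ h ∈ Finset.range (S.shapeNat (SE i k)),
      S.Ωc i k h *
        Real.Gamma (S.shape (SE i k) + S.shape (SR i) - S.shape (SE J k) - h - 1) *
        Real.Gamma (S.shape (SE J k) + h + 1) /
        S.ϖ i k ^ (S.shape (SE i k) + S.shape (SR i) - S.shape (SE J k) - h - 1)

/-- `𝒞₃^(i,k,J)` -/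
def C₃ (i : Fin N) (k : Fin M) (J : Fin N) : ℝ :=
  S.γ ^ S.shapeNat (SR i) * S.α i k J / S.ϖ i k ^ (S.shape (SR i) - S.shape (SE J k)) *
    S.jamFactor i k J (S.shapeNat (SE J k)) *
    ((-1) ^ ((S.shapeNat (SE J k) : ℤ) - S.shapeNat (SR i)) *
      Real.Gamma (S.shape (SE i k) + S.shape (SE J k)) / S.shape (SE J k))

end Network

end

open scoped Topology

/-! The antenna sums are independent Gamma variables of shape ℓ_q (`map_gain`), and the transmit SNR
is x / max(s, P), where x is the interference SNR, s the ratio and P the gain to the primary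
receiver. Let V and U be the gains of the legitimate and the wiretap link. A hop without jamming is
secure iff V ≥ γU + (γ-1) max(s, P) / x. Conditioning on (U, P) and differentiating the distribution
function F_V at γU gives the limit E[1 - F_V(γU)] and the 1/x-coefficient -(γ-1) E f_V(γU) · E
max(s, P) (`tendsto_hop`).

These are 𝒜(1) and 𝒜′. The Mellin transform of the distribution function of a ratio of two Gamma
variables is -E[ratio^s] / s, a product of Gamma functions, and Mellin inversion turns it into the
Meijer G-function (`meijerG_eq_integral_gammaTail`). The recurrence f_a = λ (F_{a-1} - F_a) then
writes the mean density through 𝒜(1) and 𝒜(2) (`A'_eq`).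

Under jamming, let W be the jamming gain, Q the gain from the jammer to the primary receiver, t its
ratio and Z = max(t, Q). Outage means V < ((γ-1) max(s, P) + γUZ / (W + Z/x)) / x. This threshold
tends to 0, so the hop succeeds with probability tending to 1, and the shapes a of V and c of W
decide the rate: - c > 1: 1/W has a finite mean and x · Pr(outage) tends to f_V(0) times the mean of
the limiting numerator. It vanishes unless a = 1 (`tendsto_outage_of_one_lt`). - c = 1 and a ≥ 2: as
f_V(0) = 0, outage needs a small W. Solved for W, the event is W < Z (γU/V - 1) / x, of probability
about f_W(0) E Z · E max(0, γU/V - 1) / x (`tendsto_outage_of_exponential_jammer`). - a = c = 1: the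
mean of 1/(W + Z/x) grows like a multiple of log x (`tendsto_outage_of_exponential`).

The two hops use disjoint sets of channels, so each factor of the outage formula is a product of two
hop probabilities. The product rule for first order expansions (`HasExpansion.prod`) assembles the
result. -/

/-! ### Gamma laws -/

/-- The expression `r ^ a / Γ(a) * x ^ (a - 1) * exp (-r x)`, which is the density of the Gamma law
with shape `a` and rate `r` at the nonnegative reals. -/
noncomputable def gammaDensity (a r x : ℝ) : ℝ :=
  r ^ a / Real.Gamma a * x ^ (a - 1) * Real.exp (-(r * x))

lemma gammaDensity_nonneg {a r x : ℝ} (ha : 0 < a) (hr : 0 < r) (hx : 0 ≤ x) :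
    0 ≤ gammaDensity a r x := by
  have := Real.Gamma_pos_of_pos ha
  unfold gammaDensity
  positivity

lemma measurable_gammaDensity (a r : ℝ) : Measurable (gammaDensity a r) := by
  unfold gammaDensity
  fun_prop

lemma gammaPDF_ae_eq_indicator (a r : ℝ) :
    gammaPDF a r =ᵐ[volume]
      (Set.Ioi (0 : ℝ)).indicator fun x => ENNReal.ofReal (gammaDensity a r x) := by
  filter_upwards [compl_mem_ae_iff.2 (measure_singleton (0 : ℝ))] with x hx
  rcases lt_trichotomy x 0 with h | h | h
  · rw [gammaPDF_of_neg h, Set.indicator_of_notMem (by simpa using h.le)]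
  · exact absurd h hx
  · rw [gammaPDF_of_nonneg h.le, Set.indicator_of_mem (by simpa using h)]
    rfl

lemma gammaMeasure_eq_withDensity (a r : ℝ) :
    gammaMeasure a r = (volume.restrict (Set.Ioi 0)).withDensity
      fun x => ENNReal.ofReal (gammaDensity a r x) := by
  rw [gammaMeasure, withDensity_congr_ae (gammaPDF_ae_eq_indicator a r),
    withDensity_indicator measurableSet_Ioi]

lemma integral_gammaMeasure {E : Type*} [NormedAddCommGroup E] [NormedSpace ℝ E] {a r : ℝ}
    (ha : 0 < a) (hr : 0 < r) (f : ℝ → E) :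
    ∫ x, f x ∂gammaMeasure a r = ∫ x in Set.Ioi 0, gammaDensity a r x • f x := by
  rw [gammaMeasure_eq_withDensity, integral_withDensity_eq_integral_toReal_smul
    (measurable_gammaDensity a r).ennreal_ofReal (by simp)]
  refine setIntegral_congr_fun measurableSet_Ioi fun x hx => ?_
  simp only [ENNReal.toReal_ofReal (gammaDensity_nonneg ha hr (le_of_lt hx))]

lemma integrable_gammaMeasure_iff {E : Type*} [NormedAddCommGroup E] [NormedSpace ℝ E] {a r : ℝ}
    (ha : 0 < a) (hr : 0 < r) (f : ℝ → E) :
    Integrable f (gammaMeasure a r) ↔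
      IntegrableOn (fun x => gammaDensity a r x • f x) (Set.Ioi 0) := by
  rw [gammaMeasure_eq_withDensity, integrable_withDensity_iff_integrable_smul'
    (measurable_gammaDensity a r).ennreal_ofReal (by simp)]
  refine integrableOn_congr_fun (fun x hx => ?_) measurableSet_Ioi
  simp only [ENNReal.toReal_ofReal (gammaDensity_nonneg ha hr (le_of_lt hx))]

lemma ae_pos_gammaMeasure (a r : ℝ) : ∀ᵐ x ∂gammaMeasure a r, 0 < x := by
  rw [gammaMeasure_eq_withDensity]
  exact (withDensity_absolutelyContinuous _ _).ae_le (ae_restrict_mem measurableSet_Ioi)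

instance nullSingletonClass_gammaMeasure (a r : ℝ) : NullSingletonClass (gammaMeasure a r) := by
  unfold gammaMeasure; infer_instance

lemma integral_rpow_gammaMeasure {a r s : ℝ} (ha : 0 < a) (hr : 0 < r) (hs : 0 < a + s) :
    ∫ x, x ^ s ∂gammaMeasure a r = Real.Gamma (a + s) / (Real.Gamma a * r ^ s) := by
  rw [integral_gammaMeasure ha hr]
  have : ∀ x ∈ Set.Ioi (0 : ℝ), gammaDensity a r x • x ^ s =
      r ^ a / Real.Gamma a * (x ^ (a + s - 1) * Real.exp (-(r * x))) := fun x hx => by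
    have : x ^ (a + s - 1) = x ^ (a - 1) * x ^ s := by
      rw [← Real.rpow_add hx]; ring_nf
    rw [gammaDensity, smul_eq_mul, this]; ring
  rw [setIntegral_congr_fun measurableSet_Ioi this, integral_const_mul,
    Real.integral_rpow_mul_exp_neg_mul_Ioi hs hr, Real.div_rpow zero_le_one hr.le, Real.one_rpow,
    Real.rpow_add hr]
  have := (Real.Gamma_pos_of_pos ha).ne'
  field_simp

lemma integrableOn_rpow_mul_exp_neg_mul {a r : ℝ} (ha : 0 < a) (hr : 0 < r) :
    IntegrableOn (fun x => x ^ (a - 1) * Real.exp (-(r * x))) (Set.Ioi 0) := by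
  -- A non-integrable function would have integral 0, whereas this integral is positive.
  by_contra h
  have := integral_undef h
  rw [Real.integral_rpow_mul_exp_neg_mul_Ioi ha hr] at this
  have h2 := Real.Gamma_pos_of_pos ha
  have h3 : 0 < (1 / r) ^ a * Real.Gamma a := by positivity
  exact h3.ne' this

lemma integrable_rpow_gammaMeasure {a r s : ℝ} (ha : 0 < a) (hr : 0 < r) (hs : 0 < a + s) :
    Integrable (fun x => x ^ s) (gammaMeasure a r) := by
  rw [integrable_gammaMeasure_iff ha hr]
  have h : IntegrableOn (fun x => r ^ a / Real.Gamma a * (x ^ (a + s - 1) * Real.exp (-(r * x))))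
      (Set.Ioi 0) := (integrableOn_rpow_mul_exp_neg_mul hs hr).const_mul _
  refine h.congr_fun (fun x hx => ?_) measurableSet_Ioi
  have : x ^ (a + s - 1) = x ^ (a - 1) * x ^ s := by
    rw [← Real.rpow_add hx]; ring_nf
  simp only [gammaDensity, smul_eq_mul, this]; ring

lemma integral_cpow_gammaMeasure {a : ℝ} {s : ℂ} (ha : 0 < a) (hs : 0 < a + s.re) :
    ∫ x, (x : ℂ) ^ s ∂gammaMeasure a 1 = Complex.Gamma (a + s) / Complex.Gamma a := by
  rw [integral_gammaMeasure ha one_pos]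
  have : ∀ x ∈ Set.Ioi (0 : ℝ), gammaDensity a 1 x • (x : ℂ) ^ s =
      1 / Complex.Gamma a * ((x : ℂ) ^ (a + s - 1) * Complex.exp (-((1 : ℝ) * x))) := fun x hx => by
    have hx0 : (x : ℂ) ≠ 0 := by exact_mod_cast (ne_of_gt hx)
    have : (x : ℂ) ^ (a + s - 1) = (x : ℂ) ^ ((a : ℂ) - 1) * (x : ℂ) ^ s := by
      rw [← Complex.cpow_add _ _ hx0]; ring_nf
    rw [gammaDensity, this, Complex.real_smul]
    push_cast [Complex.ofReal_cpow (le_of_lt hx), Complex.Gamma_ofReal]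
    simp
    ring
  rw [setIntegral_congr_fun measurableSet_Ioi this, integral_const_mul,
    Complex.integral_cpow_mul_exp_neg_mul_Ioi (by simpa using hs) one_pos]
  simp
  ring

lemma mgf_gammaMeasure_of_lt {a r t : ℝ} (ha : 0 < a) (hr : 0 < r) (ht : t < r) :
    mgf id (gammaMeasure a r) t = (r / (r - t)) ^ a := by
  have h : 0 < r - t := sub_pos.2 ht
  rw [mgf, integral_gammaMeasure ha hr]
  have : ∀ x ∈ Set.Ioi (0 : ℝ), gammaDensity a r x • Real.exp (t * id x) =
      r ^ a / Real.Gamma a * (x ^ (a - 1) * Real.exp (-((r - t) * x))) := fun x hx => by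
    have : Real.exp (-((r - t) * x)) = Real.exp (-(r * x)) * Real.exp (t * x) := by
      rw [← Real.exp_add]; ring_nf
    rw [gammaDensity, smul_eq_mul, this, id]; ring
  rw [setIntegral_congr_fun measurableSet_Ioi this, integral_const_mul,
    Real.integral_rpow_mul_exp_neg_mul_Ioi ha h, Real.div_rpow zero_le_one h.le, Real.one_rpow,
    Real.div_rpow hr.le h.le]
  have := (Real.Gamma_pos_of_pos ha).ne'
  field_simp

lemma integrable_exp_gammaMeasure_of_lt {a r t : ℝ} (ha : 0 < a) (hr : 0 < r) (ht : t < r) :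
    Integrable (fun x => Real.exp (t * x)) (gammaMeasure a r) := by
  by_contra h
  have h1 := mgf_undef (X := id) h
  rw [mgf_gammaMeasure_of_lt ha hr ht] at h1
  have : 0 < (r / (r - t)) ^ a := by
    have : 0 < r - t := sub_pos.2 ht
    positivity
  exact this.ne' h1

/-- Here the integrand dominates x^(a-1), which is integrable on (0, ∞) for no exponent, so the
default value 0 applies. Knowing it lets moment generating functions be compared on the whole line,
as `ext_of_mgf_id_eq` demands. -/
lemma mgf_gammaMeasure_of_le {a r t : ℝ} (ha : 0 < a) (hr : 0 < r) (ht : r ≤ t) :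
    mgf id (gammaMeasure a r) t = 0 := by
  refine mgf_undef fun h => ?_
  rw [integrable_gammaMeasure_iff ha hr] at h
  have hG := Real.Gamma_pos_of_pos ha
  have hc : r ^ a / Real.Gamma a ≠ 0 := by positivity
  refine not_integrableOn_Ioi_rpow (a - 1) ?_
  refine Integrable.mono' (h.const_mul (r ^ a / Real.Gamma a)⁻¹) (by fun_prop) ?_
  filter_upwards [ae_restrict_mem measurableSet_Ioi] with x hx
  have hx' : 0 < x := hx
  rw [Real.norm_of_nonneg (by positivity), gammaDensity, smul_eq_mul, id]
  have : Real.exp (-(r * x)) * Real.exp (t * x) = Real.exp ((t - r) * x) := by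
    rw [← Real.exp_add]; ring_nf
  have h1 : 1 ≤ Real.exp ((t - r) * x) := Real.one_le_exp (mul_nonneg (by linarith) hx'.le)
  calc x ^ (a - 1) ≤ x ^ (a - 1) * Real.exp ((t - r) * x) :=
        le_mul_of_one_le_right (by positivity) h1
    _ = _ := by rw [← this]; field_simp

/-- Laws on the line with the same moment generating function, finite near `0`, are equal. -/
lemma ext_of_mgf_id_eq {ν ν' : Measure ℝ} [IsProbabilityMeasure ν] [IsProbabilityMeasure ν']
    (h0 : 0 ∈ interior (integrableExpSet id ν)) (h : mgf id ν = mgf id ν') : ν = ν' := by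
  refine Measure.ext_of_charFun (funext fun t => ?_)
  -- The characteristic function is the complex moment generating function on the imaginary axis,
  -- which lies in the strip of analyticity because 0 is interior.
  rw [← complexMGF_id_mul_I, ← complexMGF_id_mul_I]
  exact eqOn_complexMGF_of_mgf h (by simpa using h0)

/-- A sum of independent Gamma variables of the same law is Gamma distributed. -/
lemma map_sum_eq_gammaMeasure {Ω : Type*} [MeasurableSpace Ω] {μ : Measure Ω}
    [IsProbabilityMeasure μ] {n : ℕ} (hn : 0 < n) {X : Fin n → Ω → ℝ} {a r : ℝ} (ha : 0 < a)
    (hr : 0 < r) (hX : ∀ i, Measurable (X i)) (hlaw : ∀ i, μ.map (X i) = gammaMeasure a r)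
    (hind : iIndepFun X μ) :
    μ.map (fun ω => ∑ i, X i ω) = gammaMeasure (n * a) r := by
  have hna : 0 < n * a := by positivity
  have := isProbabilityMeasure_gammaMeasure hna hr
  have hm : Measurable fun ω => ∑ i, X i ω := by fun_prop
  have : IsProbabilityMeasure (μ.map fun ω => ∑ i, X i ω) :=
    Measure.isProbabilityMeasure_map hm.aemeasurable
  symm
  refine ext_of_mgf_id_eq ?_ (funext fun t => ?_)
  · refine mem_interior.2 ⟨Set.Iio r, fun t ht => ?_, isOpen_Iio, hr⟩
    exact integrable_exp_gammaMeasure_of_lt hna hr ht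
  · rw [mgf_id_map hm.aemeasurable]
    have h1 : (fun ω => ∑ i, X i ω) = ∑ i, X i := by ext; simp
    rw [h1, iIndepFun.mgf_sum hind hX]
    have h2 : ∀ i, mgf (X i) μ t = mgf id (gammaMeasure a r) t := fun i => by
      rw [← hlaw i, mgf_id_map (hX i).aemeasurable]
    simp only [h2, Finset.prod_const, Finset.card_univ, Fintype.card_fin]
    rcases lt_or_ge t r with ht | ht
    · have : 0 < r - t := sub_pos.2 ht
      rw [mgf_gammaMeasure_of_lt hna hr ht, mgf_gammaMeasure_of_lt ha hr ht, ← Real.rpow_natCast,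
        ← Real.rpow_mul (by positivity), mul_comm]
    · rw [mgf_gammaMeasure_of_le hna hr ht, mgf_gammaMeasure_of_le ha hr ht, zero_pow hn.ne']

/-! ### Distribution functions of Gamma laws -/

lemma continuous_gammaDensity {a : ℝ} (r : ℝ) (ha : 1 ≤ a) : Continuous (gammaDensity a r) := by
  unfold gammaDensity
  have : Continuous fun x : ℝ => x ^ (a - 1) :=
    Real.continuous_rpow_const (sub_nonneg.2 ha)
  fun_prop

/-- The primitive of the Gamma density that vanishes at `0`. -/
noncomputable def gammaHead (a r w : ℝ) : ℝ := ∫ x in (0 : ℝ)..w, gammaDensity a r x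

/-- The probability that a Gamma variable is at least `w`. -/
noncomputable def gammaTail (a r w : ℝ) : ℝ := (gammaMeasure a r).real (Set.Ici w)

/-- As an interval integral of a function continuous on all of ℝ, `gammaHead` is differentiable from
both sides at 0, where the true distribution function has a kink if a = 1. The jammed hop is
expanded at this very point. -/
lemma hasStrictDerivAt_gammaHead {a : ℝ} (r : ℝ) (ha : 1 ≤ a) (w : ℝ) :
    HasStrictDerivAt (gammaHead a r) (gammaDensity a r w) w := by
  have hc := continuous_gammaDensity r ha
  exact intervalIntegral.integral_hasStrictDerivAt_right (hc.intervalIntegrable _ _)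
    (hc.stronglyMeasurableAtFilter _ _) hc.continuousAt

lemma continuous_gammaHead {a : ℝ} (r : ℝ) (ha : 1 ≤ a) : Continuous (gammaHead a r) :=
  continuous_iff_continuousAt.2 fun w => (hasStrictDerivAt_gammaHead r ha w).hasDerivAt.continuousAt

lemma gammaHead_zero (a r : ℝ) : gammaHead a r 0 = 0 := by simp [gammaHead]

lemma gammaMeasure_real_Iio {a r w : ℝ} (ha : 1 ≤ a) (hr : 0 < r) (hw : 0 ≤ w) :
    (gammaMeasure a r).real (Set.Iio w) = gammaHead a r w := by
  have ha0 : 0 < a := by linarith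
  have := isProbabilityMeasure_gammaMeasure ha0 hr
  have h := integral_gammaMeasure ha0 hr ((Set.Iio w).indicator fun _ => (1 : ℝ))
  rw [integral_indicator measurableSet_Iio] at h
  simp only [integral_const, smul_eq_mul, mul_one, measureReal_restrict_apply_univ] at h
  rw [h, gammaHead, intervalIntegral.integral_of_le hw]
  have : ∀ x, gammaDensity a r x * (Set.Iio w).indicator (fun _ => (1 : ℝ)) x =
      (Set.Iio w).indicator (gammaDensity a r) x := fun x => by
    by_cases hx : x ∈ Set.Iio w <;> simp [hx]
  simp only [this]
  rw [integral_indicator measurableSet_Iio, Measure.restrict_restrict measurableSet_Iio,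
    Set.Iio_inter_Ioi, integral_Ioc_eq_integral_Ioo]

lemma gammaTail_eq_one_sub {a r w : ℝ} (ha : 1 ≤ a) (hr : 0 < r) (hw : 0 ≤ w) :
    gammaTail a r w = 1 - gammaHead a r w := by
  have := isProbabilityMeasure_gammaMeasure (show 0 < a by linarith) hr
  rw [← gammaMeasure_real_Iio ha hr hw, gammaTail, ← Set.compl_Iio,
    probReal_compl_eq_one_sub measurableSet_Iio]

lemma gammaTail_nonneg (a r w : ℝ) : 0 ≤ gammaTail a r w := measureReal_nonneg

lemma gammaTail_le_one {a r : ℝ} (ha : 0 < a) (hr : 0 < r) (w : ℝ) : gammaTail a r w ≤ 1 := by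
  have := isProbabilityMeasure_gammaMeasure ha hr
  exact measureReal_le_one

lemma measurable_gammaTail {a r : ℝ} (ha : 0 < a) (hr : 0 < r) : Measurable (gammaTail a r) := by
  have := isProbabilityMeasure_gammaMeasure ha hr
  refine Antitone.measurable fun x y hxy => measureReal_mono (Set.Ici_subset_Ici.2 hxy)

lemma gammaHead_nonneg {a r w : ℝ} (ha : 0 < a) (hr : 0 < r) (hw : 0 ≤ w) :
    0 ≤ gammaHead a r w :=
  intervalIntegral.integral_nonneg hw fun _ hx => gammaDensity_nonneg ha hr hx.1

lemma gammaHead_le_one {a r w : ℝ} (ha : 1 ≤ a) (hr : 0 < r) (hw : 0 ≤ w) :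
    gammaHead a r w ≤ 1 := by
  linarith [gammaTail_eq_one_sub ha hr hw, gammaTail_nonneg a r w]

lemma gammaDensity_one (r x : ℝ) : gammaDensity 1 r x = r * Real.exp (-(r * x)) := by
  simp [gammaDensity]

lemma gammaDensity_zero {a : ℝ} (r : ℝ) (ha : 1 < a) : gammaDensity a r 0 = 0 := by
  simp [gammaDensity, Real.zero_rpow (sub_ne_zero.2 ha.ne')]

lemma gammaHead_one (r w : ℝ) : gammaHead 1 r w = 1 - Real.exp (-(r * w)) := by
  have : ∀ x ∈ Set.uIcc 0 w, HasDerivAt (fun x => -Real.exp (-(r * x))) (gammaDensity 1 r x) x :=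
    fun x _ => by
      have := ((hasDerivAt_id x).const_mul r).neg.exp.neg
      refine this.congr_deriv ?_
      simp [gammaDensity_one]
      ring
  rw [gammaHead, intervalIntegral.integral_eq_sub_of_hasDerivAt this
    ((continuous_gammaDensity r le_rfl).intervalIntegrable _ _)]
  simp
  ring

/-- The recurrence for the distribution functions of the Gamma laws. -/
lemma gammaDensity_eq_mul_sub {a r : ℝ} (ha : 2 ≤ a) (hr : 0 < r) (w : ℝ) :
    gammaDensity a r w = r * (gammaHead (a - 1) r w - gammaHead a r w) := by
  have h1 : (1 : ℝ) ≤ a - 1 := by linarith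
  -- The density satisfies f_a' = r (f_{a-1} - f_a). It is integrated from 0, where f_a vanishes.
  have hd : ∀ x, HasDerivAt (gammaDensity a r)
      (r * gammaDensity (a - 1) r x - r * gammaDensity a r x) x := fun x => by
    have h2 : HasDerivAt (fun x : ℝ => x ^ (a - 1)) ((a - 1) * x ^ (a - 1 - 1)) x :=
      Real.hasDerivAt_rpow_const (Or.inr h1)
    have h3 := ((hasDerivAt_id x).const_mul r).neg.exp
    have h4 := (h2.const_mul (r ^ a / Real.Gamma a)).mul h3
    refine h4.congr_deriv ?_
    have h5 : Real.Gamma a = (a - 1) * Real.Gamma (a - 1) := by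
      rw [← Real.Gamma_add_one (by linarith)]; ring_nf
    have h6 : r ^ a = r * r ^ (a - 1) := by
      rw [← Real.rpow_one_add' hr.le (by linarith)]; ring_nf
    have := (Real.Gamma_pos_of_pos (show 0 < a - 1 by linarith)).ne'
    have h7 : a - 1 ≠ 0 := by linarith
    simp only [gammaDensity, h5, h6, id, Pi.neg_apply]
    field_simp
    ring
  have hc1 := continuous_gammaDensity r h1
  have hc2 := continuous_gammaDensity r (show 1 ≤ a by linarith)
  have := intervalIntegral.integral_eq_sub_of_hasDerivAt (a := 0) (b := w) (fun x _ => hd x)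
    (((hc1.const_mul r).sub (hc2.const_mul r)).intervalIntegrable _ _)
  rw [gammaDensity_zero r (by linarith), sub_zero, intervalIntegral.integral_sub
    ((hc1.const_mul r).intervalIntegrable _ _) ((hc2.const_mul r).intervalIntegrable _ _),
    intervalIntegral.integral_const_mul, intervalIntegral.integral_const_mul] at this
  rw [← this, gammaHead, gammaHead]
  ring

/-- For a ≥ 2 the recurrence shows the density as r times a difference of two numbers in [0, 1]. The
bound makes `gammaHead` Lipschitz on the half line, which is the domination behind the first order
limits. -/
lemma gammaDensity_le {a r w : ℝ} (ha : a = 1 ∨ 2 ≤ a) (hr : 0 < r) (hw : 0 ≤ w) :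
    gammaDensity a r w ≤ r := by
  rcases ha with rfl | ha
  · rw [gammaDensity_one]
    exact mul_le_of_le_one_right hr.le (Real.exp_le_one_iff.2 (by nlinarith))
  · rw [gammaDensity_eq_mul_sub ha hr]
    have := gammaHead_nonneg (show 0 < a by linarith) hr hw
    have := gammaHead_le_one (show 1 ≤ a - 1 by linarith) hr hw
    exact mul_le_of_le_one_right hr.le (by linarith)

lemma gammaHead_sub_le {a r u h : ℝ} (ha : a = 1 ∨ 2 ≤ a) (hr : 0 < r) (hu : 0 ≤ u) (hh : 0 ≤ h) :
    gammaHead a r (u + h) - gammaHead a r u ≤ r * h := by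
  have ha1 : 1 ≤ a := by rcases ha with rfl | ha <;> linarith
  have hi := fun x y => (continuous_gammaDensity r ha1).intervalIntegrable (μ := volume) x y
  rw [gammaHead, gammaHead, intervalIntegral.integral_interval_sub_left (hi _ _) (hi _ _)]
  have := intervalIntegral.integral_mono_on (show u ≤ u + h by linarith) (hi _ _)
    (intervalIntegrable_const (c := r)) fun x hx => gammaDensity_le ha hr (hu.trans hx.1)
  simpa [mul_comm] using this

lemma gammaHead_mono {a r u v : ℝ} (ha : 1 ≤ a) (hr : 0 < r) (hu : 0 ≤ u) (huv : u ≤ v) :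
    gammaHead a r u ≤ gammaHead a r v := by
  have hi := fun x y => (continuous_gammaDensity r ha).intervalIntegrable (μ := volume) x y
  rw [← sub_nonneg, gammaHead, gammaHead, intervalIntegral.integral_interval_sub_left (hi _ _)
    (hi _ _)]
  exact intervalIntegral.integral_nonneg huv fun x hx =>
    gammaDensity_nonneg (by linarith) hr (hu.trans hx.1)

/-! ### The Mellin transform of a distribution function and the Meijer G-function -/

section Mellin

variable {α : Type*} [MeasurableSpace α] {ν : Measure α} [IsProbabilityMeasure ν] {W : α → ℝ}

/-- The Fubini hypothesis for the Mellin transform of a distribution function: for Re s < 0 the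
integral of z^(s-1) over (W, ∞) converges to -W^s / s. -/
lemma integrable_prod_cpow_indicator (hW : Measurable W) (hpos : ∀ᵐ p ∂ν, 0 < W p) {s : ℂ}
    (hs : s.re < 0) (hint : Integrable (fun p => W p ^ s.re) ν) :
    Integrable (fun q : ℝ × α => {q : ℝ × α | W q.2 < q.1}.indicator
      (fun q => (q.1 : ℂ) ^ (s - 1)) q) ((volume.restrict (Set.Ioi 0)).prod ν) := by
  have hset : MeasurableSet {q : ℝ × α | W q.2 < q.1} :=
    measurableSet_lt (hW.comp measurable_snd) measurable_fst
  have hm : Measurable fun q : ℝ × α => {q : ℝ × α | W q.2 < q.1}.indicator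
      (fun q => (q.1 : ℂ) ^ (s - 1)) q :=
    ((Complex.measurable_ofReal.comp measurable_fst).pow_const _).indicator hset
  have hre : (s - 1).re < -1 := by simp; linarith
  have key : ∀ p, (fun z : ℝ => {q : ℝ × α | W q.2 < q.1}.indicator
      (fun q => (q.1 : ℂ) ^ (s - 1)) (z, p)) =
        (Set.Ioi (W p)).indicator fun z : ℝ => (z : ℂ) ^ (s - 1) := fun p => by
    ext z
    by_cases h : W p < z <;> simp [h]
  rw [integrable_prod_iff' hm.aestronglyMeasurable]
  constructor
  · filter_upwards [hpos] with p hp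
    rw [key, integrable_indicator_iff measurableSet_Ioi, IntegrableOn,
      Measure.restrict_restrict measurableSet_Ioi, Set.inter_eq_left.2 (Set.Ioi_subset_Ioi hp.le)]
    exact integrableOn_Ioi_cpow_of_lt hre hp
  · refine (hint.const_mul (-(1 / s.re))).congr ?_
    filter_upwards [hpos] with p hp
    have : ∀ z : ℝ, ‖{q : ℝ × α | W q.2 < q.1}.indicator (fun q => (q.1 : ℂ) ^ (s - 1)) (z, p)‖ =
        (Set.Ioi (W p)).indicator (fun z : ℝ => z ^ (s.re - 1)) z := fun z => by
      rw [congrFun (key p) z]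
      by_cases h : W p < z
      · rw [Set.indicator_of_mem (Set.mem_Ioi.2 h), Set.indicator_of_mem (Set.mem_Ioi.2 h),
          Complex.norm_cpow_eq_rpow_re_of_pos (hp.trans h)]
        simp
      · simp [h]
    simp only [this]
    rw [integral_indicator measurableSet_Ioi, Measure.restrict_restrict measurableSet_Ioi,
      Set.inter_eq_left.2 (Set.Ioi_subset_Ioi hp.le),
      integral_Ioi_rpow_of_lt (by linarith) hp, sub_add_cancel]
    ring

lemma hasMellin_distribution (hW : Measurable W) (hpos : ∀ᵐ p ∂ν, 0 < W p) {s : ℂ}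
    (hs : s.re < 0) (hint : Integrable (fun p => W p ^ s.re) ν) :
    HasMellin (fun z => ((ν.real {p | W p < z} : ℝ) : ℂ)) s (-(1 / s) * ∫ p, (W p : ℂ) ^ s ∂ν) := by
  have hI := integrable_prod_cpow_indicator hW hpos hs hint
  have hre : (s - 1).re < -1 := by simp; linarith
  have hfun : ∀ z : ℝ, ∫ p, {q : ℝ × α | W q.2 < q.1}.indicator
      (fun q => (q.1 : ℂ) ^ (s - 1)) (z, p) ∂ν =
        (z : ℂ) ^ (s - 1) • ((ν.real {p | W p < z} : ℝ) : ℂ) := fun z => by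
    have : ∀ p, {q : ℝ × α | W q.2 < q.1}.indicator (fun q => (q.1 : ℂ) ^ (s - 1)) (z, p) =
        {p | W p < z}.indicator (fun _ => (z : ℂ) ^ (s - 1)) p := fun p => by
      by_cases h : W p < z <;> simp [h]
    simp only [this]
    rw [integral_indicator (measurableSet_lt hW measurable_const), integral_const,
      measureReal_restrict_apply_univ, Complex.real_smul, smul_eq_mul, mul_comm]
  constructor
  · have := hI.integral_prod_left
    simp only [hfun] at this
    exact this
  · rw [mellin]
    simp only [← hfun]
    rw [integral_integral_swap (f := fun z p => {q : ℝ × α | W q.2 < q.1}.indicator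
      (fun q => (q.1 : ℂ) ^ (s - 1)) (z, p)) hI, ← integral_const_mul]
    refine integral_congr_ae ?_
    filter_upwards [hpos] with p hp
    have : ∀ z : ℝ, {q : ℝ × α | W q.2 < q.1}.indicator (fun q => (q.1 : ℂ) ^ (s - 1)) (z, p) =
        (Set.Ioi (W p)).indicator (fun z : ℝ => (z : ℂ) ^ (s - 1)) z := fun z => by
      by_cases h : W p < z <;> simp [h]
    simp only [this]
    rw [integral_indicator measurableSet_Ioi, Measure.restrict_restrict measurableSet_Ioi,
      Set.inter_eq_left.2 (Set.Ioi_subset_Ioi hp.le),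
      integral_Ioi_cpow_of_lt hre hp, sub_add_cancel]
    ring

end Mellin

/-! ### Mellin-Barnes integrals of Gamma functions -/

lemma norm_Gamma_le {s : ℂ} (hs : 0 < s.re) : ‖Complex.Gamma s‖ ≤ Real.Gamma s.re := by
  rw [Complex.Gamma_eq_integral hs, Real.Gamma_eq_integral hs, Complex.GammaIntegral]
  refine (norm_integral_le_integral_norm _).trans_eq (setIntegral_congr_fun measurableSet_Ioi ?_)
  intro x hx
  simp only [norm_mul, Complex.norm_cpow_eq_rpow_re_of_pos hx, Complex.norm_real,
    Real.norm_of_nonneg (Real.exp_pos _).le]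
  simp

lemma continuous_Gamma_vertical {c : ℝ} (hc : 0 < c) (e : ℝ) :
    Continuous fun y : ℝ => Complex.Gamma (c + e * (y * Complex.I)) := by
  refine continuous_iff_continuousAt.2 fun y => ?_
  refine ContinuousAt.comp (g := Complex.Gamma) ?_ (by fun_prop)
  refine (Complex.differentiableAt_Gamma _ fun m h => ?_).continuousAt
  have := congrArg Complex.re h
  simp at this
  have h2 : (0 : ℝ) ≤ m := m.cast_nonneg
  linarith

/-- No Stirling estimate is needed: on a vertical line |Γ| is at most its value at the real part,
and Γ(a + s) = Γ(a + s + 1) / (a + s) supplies one factor of decay. With the factor 1/s the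
integrand is O(1 / (1 + y²)). -/
lemma verticalIntegrable_Gamma_mul_Gamma_div {a b c : ℝ} (ha : 0 < a + c) (hb : 0 < b - c)
    (hc : c < 0) :
    Complex.VerticalIntegrable (fun s => Complex.Gamma (a + s) * Complex.Gamma (b - s) / (-s)) c := by
  -- The distance d bounds the real parts of both a + s and s away from 0; D below is chosen so that
  -- D (1 + y²) ≤ |a + s| |s|.
  set d := min (a + c) (-c) with hd
  have hd0 : 0 < d := lt_min ha (by linarith)
  set K := Real.Gamma (a + c + 1) * Real.Gamma (b - c)
  have hK : 0 ≤ K := by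
    have := Real.Gamma_pos_of_pos (show 0 < a + c + 1 by linarith)
    have := Real.Gamma_pos_of_pos hb
    positivity
  set D := min (d ^ 2) 1 with hD
  have hD0 : 0 < D := lt_min (by positivity) one_pos
  have hbound : Integrable fun y : ℝ => K / D * (1 + y ^ 2)⁻¹ := integrable_inv_one_add_sq.const_mul _
  refine hbound.mono' ?_ (Eventually.of_forall fun y => ?_)
  · refine Continuous.aestronglyMeasurable ?_
    have h1 := continuous_Gamma_vertical ha 1
    have h2 := continuous_Gamma_vertical hb (-1)
    refine Continuous.div ?_ (by fun_prop) fun y h => ?_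
    · refine (h1.mul h2).congr fun y => ?_
      push_cast
      ring_nf
      simp only [Pi.mul_apply, mul_comm Complex.I]
    · have := congrArg Complex.re h
      simp at this
      linarith
  · set s : ℂ := c + y * Complex.I with hs
    have hsre : s.re = c := by simp [hs]
    have hsim : s.im = y := by simp [hs]
    have has : (a : ℂ) + s ≠ 0 := fun h => by
      have := congrArg Complex.re h
      simp [hsre] at this
      linarith
    have h1 : ‖Complex.Gamma (a + s)‖ ≤ Real.Gamma (a + c + 1) / ‖(a : ℂ) + s‖ := by
      rw [le_div_iff₀ (norm_pos_iff.2 has), mul_comm, ← norm_mul, ← Complex.Gamma_add_one _ has]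
      refine (norm_Gamma_le ?_).trans_eq ?_ <;> simp [hsre]
      linarith
    have h2 : ‖Complex.Gamma (b - s)‖ ≤ Real.Gamma (b - c) := by
      refine (norm_Gamma_le ?_).trans_eq ?_ <;> simp [hsre]
      linarith
    have hsq : ∀ w : ℂ, d ≤ |w.re| → w.im = y → Real.sqrt (D * (1 + y ^ 2)) ≤ ‖w‖ :=
      fun w hw hy => by
        refine Real.sqrt_le_iff.2 ⟨norm_nonneg _, ?_⟩
        rw [← Complex.normSq_eq_norm_sq, Complex.normSq_apply, hy]
        have h3 : d ^ 2 ≤ w.re ^ 2 := sq_le_sq.2 (by rwa [abs_of_pos hd0])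
        have h4 : D ≤ d ^ 2 := min_le_left _ _
        have h5 : D ≤ 1 := min_le_right _ _
        nlinarith [sq_nonneg y]
    have h3 := hsq (a + s) (by
      rw [Complex.add_re, Complex.ofReal_re, hsre, abs_of_pos ha]; exact min_le_left _ _)
      (by simp [hsim])
    have h4 := hsq s (by rw [hsre, abs_of_neg hc]; exact min_le_right _ _) hsim
    have h5 : 0 < D * (1 + y ^ 2) := by positivity
    have h6 : D * (1 + y ^ 2) ≤ ‖(a : ℂ) + s‖ * ‖s‖ := by
      have := mul_le_mul h3 h4 (Real.sqrt_nonneg _) (norm_nonneg _)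
      rwa [Real.mul_self_sqrt h5.le] at this
    rw [norm_div, norm_mul, norm_neg]
    calc ‖Complex.Gamma (a + s)‖ * ‖Complex.Gamma (b - s)‖ / ‖s‖
        ≤ (Real.Gamma (a + c + 1) / ‖(a : ℂ) + s‖ * Real.Gamma (b - c)) / ‖s‖ := by
          gcongr
      _ = K / (‖(a : ℂ) + s‖ * ‖s‖) := by
          simp only [K]; field_simp
      _ ≤ K / (D * (1 + y ^ 2)) := by gcongr
      _ = K / D * (1 + y ^ 2)⁻¹ := by field_simp

/-- The parameters 1 and 0 contribute Γ(-s) / Γ(1 - s) = -1/s, exactly the factor that the Mellin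
transform of a distribution function carries. -/
lemma meijerKernel_eq (a b : ℝ) {s : ℂ} (hs : s.re < 0) :
    meijerKernel [((1 - b : ℝ) : ℂ), 1] [] [(a : ℂ)] [0] s =
      Complex.Gamma (a + s) * Complex.Gamma (b - s) / (-s) := by
  have h0 : -s ≠ 0 := fun h => by
    have := congrArg Complex.re h
    simp at this
    linarith
  have h1 : Complex.Gamma (-s) ≠ 0 := Complex.Gamma_ne_zero_of_re_pos (by simpa using hs)
  have h2 : Complex.Gamma (1 - s) = -s * Complex.Gamma (-s) := by
    rw [← Complex.Gamma_add_one _ h0]; ring_nf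
  simp only [meijerKernel, List.map_cons, List.map_nil, List.prod_cons, List.prod_nil, mul_one]
  rw [show (1 : ℂ) - ((1 - b : ℝ) : ℂ) - s = b - s by push_cast; ring,
    show (1 : ℂ) - 1 - s = -s by ring, show (1 : ℂ) - 0 - s = 1 - s by ring, h2]
  field_simp

/-- The distribution function of the ratio of two independent Gamma variables of rate `1`. -/
lemma prod_real_ratio_lt {a b z : ℝ} (hb : 0 < b) (ha : 0 < a) (hz : 0 < z) :
    ((gammaMeasure a 1).prod (gammaMeasure b 1)).real {p | p.1 / p.2 < z} =
      ∫ u, gammaTail b 1 (u / z) ∂gammaMeasure a 1 := by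
  have := isProbabilityMeasure_gammaMeasure ha one_pos
  have := isProbabilityMeasure_gammaMeasure hb one_pos
  have hm : MeasurableSet {p : ℝ × ℝ | p.1 / p.2 < z} :=
    measurableSet_lt (measurable_fst.div measurable_snd) measurable_const
  rw [measureReal_def, Measure.prod_apply hm, integral_eq_lintegral_of_nonneg_ae
    (Eventually.of_forall fun u => gammaTail_nonneg _ _ _)
    ((measurable_gammaTail hb one_pos).comp
      (measurable_id'.div_const z)).aestronglyMeasurable]
  congr 1
  refine lintegral_congr fun u => ?_
  rw [gammaTail, measureReal_def, ENNReal.ofReal_toReal (measure_ne_top _ _)]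
  rw [measure_congr (Ioi_ae_eq_Ici (a := u / z)).symm]
  refine measure_congr ?_
  filter_upwards [ae_pos_gammaMeasure b 1] with v hv
  refine propext ?_
  change u / v < z ↔ u / z < v
  rw [div_lt_iff₀ hv, div_lt_iff₀ hz, mul_comm]

/-- Mellin inversion recovers a function only at its points of continuity. -/
lemma continuousAt_integral_gammaTail {a b z : ℝ} (ha : 0 < a) (hb : 1 ≤ b) (hz : 0 < z) :
    ContinuousAt (fun z => ∫ u, gammaTail b 1 (u / z) ∂gammaMeasure a 1) z := by
  have hb0 : 0 < b := by linarith
  have := isProbabilityMeasure_gammaMeasure ha one_pos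
  refine continuousAt_of_dominated (bound := fun _ => 1)
    (Eventually.of_forall fun z => ((measurable_gammaTail hb0 one_pos).comp
      (measurable_id.div_const z)).aestronglyMeasurable)
    (Eventually.of_forall fun z => Eventually.of_forall fun u => ?_) (integrable_const _) ?_
  · rw [Real.norm_of_nonneg (gammaTail_nonneg _ _ _)]
    exact gammaTail_le_one hb0 one_pos _
  · filter_upwards [ae_pos_gammaMeasure a 1] with u hu
    have h1 : ContinuousAt (fun z => 1 - gammaHead b 1 (u / z)) z := by
      refine continuousAt_const.sub
        (ContinuousAt.comp (g := gammaHead b 1) (continuous_gammaHead 1 hb).continuousAt ?_)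
      exact continuousAt_const.div continuousAt_id hz.ne'
    refine h1.congr ?_
    filter_upwards [lt_mem_nhds hz] with w hw
    rw [gammaTail_eq_one_sub hb one_pos (by positivity)]

/-- The Meijer G-function with upper parameters `1 - b; 1` and lower parameters `a; 0` in terms of
the ratio of two Gamma variables. -/
theorem meijerG_eq_integral_gammaTail {a b z : ℝ} (ha : 0 < a) (hb : 1 ≤ b) (hz : 0 < z) :
    meijerG [((1 - b : ℝ) : ℂ), 1] [] [(a : ℂ)] [0] z =
      ((Real.Gamma a * Real.Gamma b * ∫ u, gammaTail b 1 (u / z) ∂gammaMeasure a 1 : ℝ) : ℂ) := by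
  have hb0 : 0 < b := by linarith
  have := isProbabilityMeasure_gammaMeasure ha one_pos
  have := isProbabilityMeasure_gammaMeasure hb0 one_pos
  have hsep : ∀ c, MeijerSeparates [((1 - b : ℝ) : ℂ), 1] [(a : ℂ)] c ↔ -a < c ∧ c < b ∧ c < 0 := by
    intro c
    simp [MeijerSeparates]
  have hex : ∃ c, MeijerSeparates [((1 - b : ℝ) : ℂ), 1] [(a : ℂ)] c :=
    ⟨-(a / 2), (hsep _).2 ⟨by linarith, by linarith, by linarith⟩⟩
  rw [meijerG, dif_pos hex]
  -- Only these inequalities on the abscissa are used, so it does not matter which separating line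
  -- the definition picks.
  obtain ⟨h1, h2, h3⟩ := (hsep _).1 hex.choose_spec
  set c := hex.choose
  set H : ℝ → ℂ := fun z => ((((gammaMeasure a 1).prod (gammaMeasure b 1)).real
    {p | p.1 / p.2 < z} : ℝ) : ℂ) with hH
  have hGa := (Real.Gamma_pos_of_pos ha).ne'
  have hGb := (Real.Gamma_pos_of_pos hb0).ne'
  have hpos : ∀ᵐ p ∂(gammaMeasure a 1).prod (gammaMeasure b 1), 0 < p.1 ∧ 0 < p.2 := by
    have e1 := Measure.quasiMeasurePreserving_fst (μ := gammaMeasure a 1) (ν := gammaMeasure b 1)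
      |>.ae (ae_pos_gammaMeasure a 1)
    have e2 := Measure.quasiMeasurePreserving_snd (μ := gammaMeasure a 1) (ν := gammaMeasure b 1)
      |>.ae (ae_pos_gammaMeasure b 1)
    exact e1.and e2
  -- By independence the s-th moment of the ratio is Γ(a + s) Γ(b - s) / (Γ(a) Γ(b)).
  have hmel : ∀ s : ℂ, s.re = c → HasMellin H s
      (((1 / (Real.Gamma a * Real.Gamma b) : ℝ) : ℂ) *
        (Complex.Gamma (a + s) * Complex.Gamma (b - s) / (-s))) := by
    intro s hs
    have hm := hasMellin_distribution (ν := (gammaMeasure a 1).prod (gammaMeasure b 1))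
      (W := fun p => p.1 / p.2) (measurable_fst.div measurable_snd)
      (hpos.mono fun p hp => div_pos hp.1 hp.2) (s := s) (by linarith) (by
        have i1 : Integrable (fun u : ℝ => u ^ s.re) (gammaMeasure a 1) :=
          integrable_rpow_gammaMeasure ha one_pos (by linarith)
        have i2 : Integrable (fun u : ℝ => u ^ (-s.re)) (gammaMeasure b 1) :=
          integrable_rpow_gammaMeasure hb0 one_pos (by linarith)
        refine (i1.mul_prod i2).congr (hpos.mono fun p hp => ?_)
        simp only [Real.div_rpow hp.1.le hp.2.le, Real.rpow_neg hp.2.le]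
        rw [div_eq_mul_inv])
    have hval : ∫ p, ((p.1 / p.2 : ℝ) : ℂ) ^ s ∂(gammaMeasure a 1).prod (gammaMeasure b 1) =
        Complex.Gamma (a + s) / Complex.Gamma a * (Complex.Gamma (b - s) / Complex.Gamma b) := by
      rw [← integral_cpow_gammaMeasure ha (by linarith), sub_eq_add_neg,
        ← integral_cpow_gammaMeasure hb0 (by simp; linarith), ← integral_prod_mul]
      refine integral_congr_ae (hpos.mono fun p hp => ?_)
      simp only
      rw [div_eq_mul_inv, Complex.ofReal_mul, Complex.mul_cpow_ofReal_nonneg hp.1.le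
        (inv_nonneg.2 hp.2.le), Complex.ofReal_inv, Complex.inv_cpow, Complex.cpow_neg]
      rw [Complex.arg_ofReal_of_nonneg hp.2.le]
      exact Real.pi_pos.ne
    rw [hval] at hm
    convert hm using 1
    push_cast [← Complex.Gamma_ofReal]
    have hGa' : Complex.Gamma (a : ℂ) ≠ 0 := by rw [Complex.Gamma_ofReal]; exact_mod_cast hGa
    have hGb' : Complex.Gamma (b : ℂ) ≠ 0 := by rw [Complex.Gamma_ofReal]; exact_mod_cast hGb
    have hs0 : s ≠ 0 := fun h => by rw [h] at hs; simp at hs; linarith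
    field_simp
  have hline : ∀ s : ℂ, s.re = c → meijerKernel [((1 - b : ℝ) : ℂ), 1] [] [(a : ℂ)] [0] s =
      ((Real.Gamma a * Real.Gamma b : ℝ) : ℂ) * mellin H s := by
    intro s hs
    rw [(hmel s hs).2, meijerKernel_eq a b (by linarith), ← mul_assoc, ← Complex.ofReal_mul,
      mul_one_div_cancel (by positivity), Complex.ofReal_one, one_mul]
  have hre : ∀ y : ℝ, ((c : ℂ) + y * Complex.I).re = c := fun y => by simp
  have hinv : mellinInv c (mellin H) z = H z := by
    refine mellinInv_mellin_eq c H hz (hmel c (Complex.ofReal_re c)).1 ?_ ?_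
    · refine ((verticalIntegrable_Gamma_mul_Gamma_div (a := a) (b := b) (c := c) (by linarith)
        (by linarith) h3).const_mul (((1 / (Real.Gamma a * Real.Gamma b) : ℝ) : ℂ))).congr
        (Eventually.of_forall fun y => ?_)
      exact ((hmel _ (hre y)).2).symm
    · refine Complex.continuous_ofReal.continuousAt.comp ?_
      refine (continuousAt_integral_gammaTail ha hb hz).congr ?_
      filter_upwards [lt_mem_nhds hz] with w hw
      exact (prod_real_ratio_lt hb0 ha hw).symm
  have : mellinInv c (meijerKernel [((1 - b : ℝ) : ℂ), 1] [] [(a : ℂ)] [0]) z =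
      ((Real.Gamma a * Real.Gamma b : ℝ) : ℂ) * mellinInv c (mellin H) z := by
    simp only [mellinInv, hline _ (hre _), smul_eq_mul, Complex.real_smul]
    simp_rw [mul_left_comm _ ((Real.Gamma a * Real.Gamma b : ℝ) : ℂ)]
    rw [integral_const_mul]
    ring
  rw [this, hinv, hH]
  simp only [prod_real_ratio_lt hb0 ha hz]
  push_cast
  ring

/-! ### Scaling and truncated moments of Gamma laws -/

lemma map_div_gammaMeasure {a r : ℝ} (ha : 0 < a) (hr : 0 < r) :
    (gammaMeasure a 1).map (fun x => x / r) = gammaMeasure a r := by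
  have := isProbabilityMeasure_gammaMeasure ha one_pos
  have := isProbabilityMeasure_gammaMeasure ha hr
  have hm : Measurable fun x : ℝ => x / r := by fun_prop
  have : IsProbabilityMeasure ((gammaMeasure a 1).map fun x => x / r) :=
    Measure.isProbabilityMeasure_map hm.aemeasurable
  symm
  refine ext_of_mgf_id_eq ?_ (funext fun t => ?_)
  · exact mem_interior.2 ⟨Set.Iio r, fun t ht => integrable_exp_gammaMeasure_of_lt ha hr ht,
      isOpen_Iio, hr⟩
  · have h1 : mgf (fun x => x / r) (gammaMeasure a 1) t = mgf id (gammaMeasure a 1) (t / r) := by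
      simp only [mgf, id]
      refine integral_congr_ae (Eventually.of_forall fun x => ?_)
      simp only
      congr 1
      ring
    rw [mgf_id_map hm.aemeasurable, h1]
    rcases lt_or_ge t r with ht | ht
    · rw [mgf_gammaMeasure_of_lt ha hr ht, mgf_gammaMeasure_of_lt ha one_pos
        ((div_lt_one hr).2 ht)]
      congr 1
      field_simp
    · rw [mgf_gammaMeasure_of_le ha hr ht, mgf_gammaMeasure_of_le ha one_pos
        ((one_le_div hr).2 ht)]

lemma gammaTail_eq_rate_one {a r : ℝ} (ha : 0 < a) (hr : 0 < r) (w : ℝ) :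
    gammaTail a r w = gammaTail a 1 (r * w) := by
  rw [gammaTail, gammaTail, ← map_div_gammaMeasure ha hr,
    map_measureReal_apply (by fun_prop) measurableSet_Ici]
  congr 1
  ext x
  simp [le_div_iff₀ hr, mul_comm]

lemma integral_gammaMeasure_eq_rate_one {a r : ℝ} (ha : 0 < a) (hr : 0 < r) {f : ℝ → ℝ}
    (hf : Measurable f) :
    ∫ x, f x ∂gammaMeasure a r = ∫ x, f (x / r) ∂gammaMeasure a 1 := by
  rw [← map_div_gammaMeasure ha hr, integral_map (by fun_prop) hf.aestronglyMeasurable]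

lemma integrableOn_rpow_mul_exp_neg {m : ℝ} (hm : 0 < m) :
    IntegrableOn (fun x => x ^ (m - 1) * Real.exp (-x)) (Set.Ioi 0) := by
  simpa using integrableOn_rpow_mul_exp_neg_mul hm one_pos

lemma lowerGamma_add_upperGamma {m p : ℝ} (hm : 0 < m) (hp : 0 ≤ p) :
    lowerGamma m p + upperGamma m p = Real.Gamma m := by
  have h := integrableOn_rpow_mul_exp_neg hm
  rw [lowerGamma, upperGamma, ← setIntegral_union Set.Ioc_disjoint_Ioi_same measurableSet_Ioi
    (h.mono_set Set.Ioc_subset_Ioi_self) (h.mono_set (Set.Ioi_subset_Ioi hp)),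
    Set.Ioc_union_Ioi_eq_Ioi hp, Real.Gamma_eq_integral hm]
  simp only [mul_comm]

/-- Integration by parts. It shows that the two differently written brackets in 𝒜′ are equal. -/
lemma upperGamma_add_one {m p : ℝ} (hm : 0 < m) (hp : 0 < p) :
    upperGamma (m + 1) p = m * upperGamma m p + p ^ m * Real.exp (-p) := by
  have i1 := (integrableOn_rpow_mul_exp_neg (show 0 < m + 1 by linarith)).mono_set
    (Set.Ioi_subset_Ioi hp.le)
  have i2 := (integrableOn_rpow_mul_exp_neg hm).mono_set (Set.Ioi_subset_Ioi hp.le)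
  have hd : ∀ x ∈ Set.Ici p, HasDerivAt (fun x => -(x ^ m * Real.exp (-x)))
      (x ^ (m + 1 - 1) * Real.exp (-x) - m * (x ^ (m - 1) * Real.exp (-x))) x := fun x hx => by
    have hx0 : x ≠ 0 := (hp.trans_le hx).ne'
    have h := ((Real.hasDerivAt_rpow_const (p := m) (Or.inl hx0)).mul
      (hasDerivAt_neg x).exp).neg
    refine h.congr_deriv ?_
    rw [add_sub_cancel_right]
    ring
  have hlim : Tendsto (fun x : ℝ => -(x ^ m * Real.exp (-x))) atTop (nhds (-0)) := by
    refine Tendsto.neg ?_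
    simpa using tendsto_rpow_mul_exp_neg_mul_atTop_nhds_zero m 1 one_pos
  have h := integral_Ioi_of_hasDerivAt_of_tendsto' hd (i1.sub (i2.const_mul m)) hlim
  rw [integral_sub i1 (i2.const_mul m), integral_const_mul] at h
  rw [upperGamma, upperGamma]
  linarith

/-- The mean of the maximum of a Gamma variable and a constant. -/
lemma integral_max_gammaMeasure {m l r : ℝ} (hm : 0 < m) (hl : 0 < l) (hr : 0 < r) :
    ∫ x, max r x ∂gammaMeasure m l =
      (r * lowerGamma m (l * r) + upperGamma (m + 1) (l * r) / l) / Real.Gamma m := by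
  have hG := Real.Gamma_pos_of_pos hm
  rw [integral_gammaMeasure_eq_rate_one hm hl (by fun_prop), integral_gammaMeasure hm one_pos]
  have hlr : 0 < l * r := by positivity
  have h1 : Set.EqOn (fun x => gammaDensity m 1 x • max r (x / l))
      (fun x => r / Real.Gamma m * (x ^ (m - 1) * Real.exp (-x))) (Set.Ioc 0 (l * r)) :=
    fun x hx => by
      have : x / l ≤ r := by rw [div_le_iff₀ hl, mul_comm]; exact hx.2
      simp only [gammaDensity, max_eq_left this, smul_eq_mul, Real.one_rpow, one_mul]
      ring
  have h2 : Set.EqOn (fun x => gammaDensity m 1 x • max r (x / l))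
      (fun x => 1 / (l * Real.Gamma m) * (x ^ (m + 1 - 1) * Real.exp (-x))) (Set.Ioi (l * r)) :=
    fun x hx => by
      have hx' : l * r < x := hx
      have : r ≤ x / l := by rw [le_div_iff₀ hl, mul_comm]; exact hx'.le
      have h3 : x ^ (m + 1 - 1) = x ^ (m - 1) * x := by
        rw [← Real.rpow_add_one (hlr.trans hx').ne']; ring_nf
      simp only [gammaDensity, max_eq_right this, smul_eq_mul, Real.one_rpow, one_mul, h3]
      field_simp
  have i1 : IntegrableOn (fun x => gammaDensity m 1 x • max r (x / l)) (Set.Ioc 0 (l * r)) :=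
    IntegrableOn.congr_fun (((integrableOn_rpow_mul_exp_neg hm).mono_set
      Set.Ioc_subset_Ioi_self).const_mul (r / Real.Gamma m)) h1.symm measurableSet_Ioc
  have i2 : IntegrableOn (fun x => gammaDensity m 1 x • max r (x / l)) (Set.Ioi (l * r)) :=
    IntegrableOn.congr_fun (((integrableOn_rpow_mul_exp_neg (show 0 < m + 1 by linarith)).mono_set
      (Set.Ioi_subset_Ioi hlr.le)).const_mul (1 / (l * Real.Gamma m))) h2.symm measurableSet_Ioi
  rw [← Set.Ioc_union_Ioi_eq_Ioi hlr.le, setIntegral_union Set.Ioc_disjoint_Ioi_same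
    measurableSet_Ioi i1 i2, setIntegral_congr_fun measurableSet_Ioc h1,
    setIntegral_congr_fun measurableSet_Ioi h2, integral_const_mul, integral_const_mul,
    lowerGamma, upperGamma]
  field_simp

lemma integrable_id_gammaMeasure {a r : ℝ} (ha : 0 < a) (hr : 0 < r) :
    Integrable (fun x => x) (gammaMeasure a r) := by
  simpa using integrable_rpow_gammaMeasure (s := 1) ha hr (by linarith)

lemma integral_id_gammaMeasure {a r : ℝ} (ha : 0 < a) (hr : 0 < r) :
    ∫ x, x ∂gammaMeasure a r = a / r := by
  have := integral_rpow_gammaMeasure (s := 1) ha hr (by linarith)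
  simp only [Real.rpow_one] at this
  rw [this, Real.Gamma_add_one ha.ne']
  have := (Real.Gamma_pos_of_pos ha).ne'
  field_simp

lemma integrable_inv_gammaMeasure {a r : ℝ} (ha : 1 < a) (hr : 0 < r) :
    Integrable (fun x => x⁻¹) (gammaMeasure a r) := by
  simpa [Real.rpow_neg_one] using
    integrable_rpow_gammaMeasure (s := -1) (a := a) (by linarith) hr (by linarith)

lemma integral_inv_gammaMeasure {a r : ℝ} (ha : 1 < a) (hr : 0 < r) :
    ∫ x, x⁻¹ ∂gammaMeasure a r = r * Real.Gamma (a - 1) / Real.Gamma a := by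
  have := integral_rpow_gammaMeasure (s := -1) (a := a) (by linarith) hr (by linarith)
  simp only [Real.rpow_neg_one] at this
  rw [this, ← sub_eq_add_neg]
  field_simp

/-! ### The constants 𝒜 and 𝒜′ as means of Gamma tails and densities -/

namespace Network

open Channel

variable {N M : ℕ} (S : Network N M)

lemma lam_pos (q : Channel N M) : 0 < S.lam q := div_pos (S.m_pos q) (S.pow_pos q)

lemma antennas_pos (q : Channel N M) : 0 < S.antennas q := by
  cases q
  exacts [S.LR_pos, S.LE_pos _, one_pos, S.LD_pos, S.LE_pos _, one_pos]

lemma shape_pos (q : Channel N M) : 0 < S.shape q :=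
  mul_pos (Nat.cast_pos.2 (S.antennas_pos q)) (S.m_pos q)

lemma one_lt_γ : 1 < S.γ := Real.one_lt_rpow one_lt_two S.Rs_pos

lemma shape_eq_one_or_two_le {q : Channel N M} (h : ∃ n : ℕ, S.shape q = n) :
    S.shape q = 1 ∨ 2 ≤ S.shape q := by
  obtain ⟨n, hn⟩ := h
  have := S.shape_pos q
  rw [hn] at this ⊢
  have h0 : 0 < n := by exact_mod_cast this
  rcases (show n = 1 ∨ 2 ≤ n by omega) with h | h
  · exact Or.inl (by exact_mod_cast h)
  · exact Or.inr (by exact_mod_cast h)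

/-- The argument y = ℓ_c - b + 1 makes the first Meijer parameter 1 - b, so the legitimate gain
appears with shape b: b = ℓ_c gives 𝒜(1), and b = ℓ_c - 1 gives 𝒜(2). The normalization by Γ(ℓ_c)
instead of Γ(b) leaves the prefactor. -/
lemma A_eq_integral (e c : Channel N M) {b : ℝ} (hb : 1 ≤ b) :
    S.A e c (S.shape c - b + 1) = Real.Gamma b / Real.Gamma (S.shape c) *
      ∫ u, gammaTail b (S.lam c) (S.γ * u) ∂gammaMeasure (S.shape e) (S.lam e) := by
  have hγ : 0 < S.γ := by linarith [S.one_lt_γ]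
  have hz : 0 < S.lam e / (S.lam c * S.γ) := div_pos (S.lam_pos e) (mul_pos (S.lam_pos c) hγ)
  have hb0 : 0 < b := by linarith
  have hm := measurable_gammaTail hb0 (S.lam_pos c)
  rw [A, show (-S.shape c + (S.shape c - b + 1) : ℝ) = 1 - b by ring,
    meijerG_eq_integral_gammaTail (S.shape_pos e) hb hz, Complex.ofReal_re,
    integral_gammaMeasure_eq_rate_one (S.shape_pos e) (S.lam_pos e)
      (f := fun u => gammaTail b (S.lam c) (S.γ * u)) (by fun_prop)]
  have : ∀ u, gammaTail b (S.lam c) (S.γ * (u / S.lam e)) =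
      gammaTail b 1 (u / (S.lam e / (S.lam c * S.γ))) := fun u => by
    rw [gammaTail_eq_rate_one hb0 (S.lam_pos c)]
    have := (S.lam_pos e).ne'
    have := (S.lam_pos c).ne'
    congr 1
    field_simp
  simp only [this]
  have := (Real.Gamma_pos_of_pos (S.shape_pos e)).ne'
  have := (Real.Gamma_pos_of_pos (S.shape_pos c)).ne'
  generalize ∫ u, gammaTail b 1 (u / (S.lam e / (S.lam c * S.γ))) ∂gammaMeasure (S.shape e) 1 = I
  field_simp

lemma A_one (e c : Channel N M) (hc : 1 ≤ S.shape c) :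
    S.A e c 1 =
      ∫ u, gammaTail (S.shape c) (S.lam c) (S.γ * u) ∂gammaMeasure (S.shape e) (S.lam e) := by
  have h := S.A_eq_integral e c hc
  have := (Real.Gamma_pos_of_pos (S.shape_pos c)).ne'
  rwa [sub_self, zero_add, div_self this, one_mul] at h

lemma A_two (e c : Channel N M) (hc : 2 ≤ S.shape c) :
    (S.shape c - 1) * S.A e c 2 =
      ∫ u, gammaTail (S.shape c - 1) (S.lam c) (S.γ * u)
        ∂gammaMeasure (S.shape e) (S.lam e) := by
  have h := S.A_eq_integral e c (b := S.shape c - 1) (by linarith)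
  have h1 := (Real.Gamma_pos_of_pos (show 0 < S.shape c - 1 by linarith)).ne'
  have h2 : Real.Gamma (S.shape c) = (S.shape c - 1) * Real.Gamma (S.shape c - 1) := by
    rw [← Real.Gamma_add_one (by linarith)]; ring_nf
  have h3 : S.shape c - 1 ≠ 0 := by linarith
  rw [show S.shape c - (S.shape c - 1) + 1 = 2 by ring, h2] at h
  rw [h]
  field_simp

lemma integrable_gammaTail_comp {a r b l k : ℝ} (ha : 0 < a) (hr : 0 < r) (hb : 0 < b)
    (hl : 0 < l) :
    Integrable (fun u => gammaTail b l (k * u)) (gammaMeasure a r) := by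
  have := isProbabilityMeasure_gammaMeasure ha hr
  have hm := measurable_gammaTail hb hl
  refine Integrable.mono' (integrable_const (1 : ℝ))
    (show Measurable fun u => gammaTail b l (k * u) by fun_prop).aestronglyMeasurable (Eventually.of_forall fun u => ?_)
  rw [Real.norm_of_nonneg (gammaTail_nonneg _ _ _)]
  exact gammaTail_le_one hb hl _

/-- The recurrence for Gamma densities, averaged over the wiretap gain. For shape 1 the factor ℓ_c -
1 removes 𝒜(2), and the exponential density is λ times its tail. -/
lemma lam_mul_A_sub (e c : Channel N M) (hc : S.shape c = 1 ∨ 2 ≤ S.shape c) :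
    S.lam c * ((S.shape c - 1) * S.A e c 2 - S.A e c 1) =
      -∫ u, gammaDensity (S.shape c) (S.lam c) (S.γ * u)
        ∂gammaMeasure (S.shape e) (S.lam e) := by
  have hγ : 0 < S.γ := by linarith [S.one_lt_γ]
  have hl := S.lam_pos c
  have he := S.shape_pos e
  have hle := S.lam_pos e
  have hpos := ae_pos_gammaMeasure (S.shape e) (S.lam e)
  rcases hc with hc | hc
  · rw [S.A_one e c hc.ge, hc, sub_self, zero_mul, zero_sub, mul_neg, ← integral_const_mul]
    congr 1
    refine integral_congr_ae (hpos.mono fun u hu => ?_)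
    simp only
    rw [gammaTail_eq_one_sub le_rfl hl (by positivity), gammaHead_one, gammaDensity_one]
    ring
  · rw [S.A_one e c (by linarith), S.A_two e c hc, ← integral_sub
      (integrable_gammaTail_comp he hle (by linarith) hl)
      (integrable_gammaTail_comp he hle (by linarith) hl), ← integral_const_mul, ← integral_neg]
    refine integral_congr_ae (hpos.mono fun u hu => ?_)
    simp only
    rw [gammaTail_eq_one_sub (by linarith) hl (by positivity),
      gammaTail_eq_one_sub (by linarith) hl (by positivity), gammaDensity_eq_mul_sub hc hl]
    ring

lemma A'_eq (e c uP : Channel N M) {r : ℝ} (hr : 0 < r) (hc : S.shape c = 1 ∨ 2 ≤ S.shape c) :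
    S.A' e c uP r = -((S.γ - 1) * (∫ u, gammaDensity (S.shape c) (S.lam c) (S.γ * u)
        ∂gammaMeasure (S.shape e) (S.lam e)) * ∫ x, max r x ∂gammaMeasure (S.m uP) (S.lam uP)) := by
  have hm := S.m_pos uP
  have hl := S.lam_pos uP
  have h1 := S.lam_mul_A_sub e c hc
  have h2 := upperGamma_add_one hm (mul_pos hl hr)
  have hG := (Real.Gamma_pos_of_pos hm).ne'
  have h3 : (S.lam uP * r) ^ S.m uP = S.lam uP * r * (S.lam uP * r) ^ (S.m uP - 1) := by
    rw [← Real.rpow_one_add' (by positivity) (by linarith)]; ring_nf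
  -- Both brackets of 𝒜′ are Γ(m) times the mean of max(r, E_{uP}), so this common factor can be
  -- pulled out.
  have h4 : r * (lowerGamma (S.m uP) (S.lam uP * r)
          + (S.lam uP * r) ^ (S.m uP - 1) * Real.exp (-(S.lam uP * r)))
        + S.m uP / S.lam uP * upperGamma (S.m uP) (S.lam uP * r) =
      r * lowerGamma (S.m uP) (S.lam uP * r)
        + upperGamma (S.m uP + 1) (S.lam uP * r) / S.lam uP := by
    rw [h2, h3]
    field_simp
    ring
  rw [A', h4, integral_max_gammaMeasure hm hl hr, ξ, ← neg_mul, ← mul_neg, ← h1]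
  field_simp

end Network

/-! ### Outage probabilities of Gamma variables -/

section Outage

variable {Ω : Type*} [MeasurableSpace Ω] {μ : Measure Ω}

lemma integral_comp_of_map_eq {X : Ω → ℝ} {ν : Measure ℝ} (hX : Measurable X) (hl : μ.map X = ν)
    {f : ℝ → ℝ} (hf : Measurable f) : ∫ ω, f (X ω) ∂μ = ∫ x, f x ∂ν := by
  rw [← hl, integral_map hX.aemeasurable hf.aestronglyMeasurable]

lemma integrable_comp_of_map_eq {X : Ω → ℝ} {ν : Measure ℝ} (hX : Measurable X)
    (hl : μ.map X = ν) {f : ℝ → ℝ} (hf : Integrable f ν) : Integrable (fun ω => f (X ω)) μ := by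
  rw [← hl] at hf
  exact hf.comp_measurable hX

lemma ae_pos_of_map_eq {X : Ω → ℝ} {a r : ℝ} (hX : Measurable X)
    (hl : μ.map X = gammaMeasure a r) : ∀ᵐ ω ∂μ, 0 < X ω := by
  have := ae_pos_gammaMeasure a r
  rw [← hl] at this
  exact ae_of_ae_map hX.aemeasurable this

/-- Differentiation of the outage probability at a moving point. -/
lemma tendsto_mul_gammaHead_sub {a : ℝ} (r : ℝ) (ha : 1 ≤ a) {b d : ℝ → ℝ} {b₀ d₀ : ℝ}
    (hb : Tendsto b atTop (𝓝 b₀)) (hd : Tendsto d atTop (𝓝 d₀)) :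
    Tendsto (fun x => x * (gammaHead a r (b x + d x / x) - gammaHead a r (b x))) atTop
      (𝓝 (gammaDensity a r b₀ * d₀)) := by
  have hdx : Tendsto (fun x => d x / x) atTop (𝓝 0) := hd.div_atTop tendsto_id
  have h1 : Tendsto (fun x => (b x + d x / x, b x)) atTop (𝓝 (b₀, b₀)) := by
    refine Tendsto.prodMk_nhds ?_ hb
    simpa using hb.add hdx
  -- Strict differentiability is essential, since the base point b(x) moves together with the
  -- increment.
  have h2 := (hasStrictDerivAt_gammaHead r ha b₀).hasStrictFDerivAt.isLittleO.comp_tendsto h1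
  have h3 : (fun x => d x / x) =O[atTop] fun x => x⁻¹ := by
    have := (hd.isBigO_one ℝ).mul (isBigO_refl (fun x : ℝ => x⁻¹) atTop)
    simpa [div_eq_mul_inv] using this
  have h4 : (fun x => gammaHead a r (b x + d x / x) - gammaHead a r (b x)
      - d x / x * gammaDensity a r b₀) =o[atTop] fun x => x⁻¹ := by
    refine IsLittleO.trans_isBigO (g := fun x => d x / x) ?_ h3
    refine (h2.congr (fun x => ?_) fun x => ?_)
    · simp
    · simp
  have h5 := (isLittleO_iff_tendsto' (by
    filter_upwards [eventually_gt_atTop 0] with x hx h0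
    exact absurd h0 (inv_ne_zero hx.ne'))).1 h4
  have h6 : Tendsto (fun x => (gammaHead a r (b x + d x / x) - gammaHead a r (b x)
      - d x / x * gammaDensity a r b₀) / x⁻¹ + d x * gammaDensity a r b₀) atTop
      (𝓝 (0 + d₀ * gammaDensity a r b₀)) := h5.add (hd.mul_const _)
  rw [zero_add, mul_comm] at h6
  refine h6.congr' ?_
  filter_upwards [eventually_gt_atTop 0] with x hx
  field_simp
  ring

/-- The first order expansion of the mean of `gammaHead` at a random point, under domination. -/
lemma tendsto_integral_gammaHead_sub {a r : ℝ} (ha : a = 1 ∨ 2 ≤ a) (hr : 0 < r)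
    {B D : ℝ → Ω → ℝ} {B₀ D₀ K : Ω → ℝ} (hBm : ∀ x, Measurable (B x)) (hDm : ∀ x, Measurable (D x))
    (hB : ∀ x, 0 < x → ∀ᵐ ω ∂μ, 0 ≤ B x ω)
    (hD : ∀ x, 0 < x → ∀ᵐ ω ∂μ, 0 ≤ D x ω ∧ D x ω ≤ K ω) (hK : Integrable K μ)
    (hBt : ∀ᵐ ω ∂μ, Tendsto (fun x => B x ω) atTop (𝓝 (B₀ ω)))
    (hDt : ∀ᵐ ω ∂μ, Tendsto (fun x => D x ω) atTop (𝓝 (D₀ ω))) :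
    Tendsto (fun x => x * ∫ ω, (gammaHead a r (B x ω + D x ω / x) - gammaHead a r (B x ω)) ∂μ)
      atTop (𝓝 (∫ ω, gammaDensity a r (B₀ ω) * D₀ ω ∂μ)) := by
  have ha1 : 1 ≤ a := by rcases ha with rfl | ha <;> linarith
  have hm := (continuous_gammaHead r ha1).measurable
  simp only [← integral_const_mul]
  refine tendsto_integral_filter_of_dominated_convergence (fun ω => r * K ω) ?_ ?_
    (hK.const_mul r) ?_
  · refine Eventually.of_forall fun x => Measurable.aestronglyMeasurable ?_
    have := hBm x
    have := hDm x
    fun_prop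
  · filter_upwards [eventually_gt_atTop 0] with x hx
    filter_upwards [hB x hx, hD x hx] with ω h1 h2
    have h3 : 0 ≤ D x ω / x := div_nonneg h2.1 hx.le
    -- The factor x cancels against the Lipschitz bound r D/x, which leaves the integrable majorant
    -- r K.
    have h4 := gammaHead_sub_le ha hr h1 h3
    have h5 := gammaHead_mono ha1 hr h1 (show B x ω ≤ B x ω + D x ω / x by linarith)
    rw [Real.norm_of_nonneg (mul_nonneg hx.le (by linarith))]
    calc x * (gammaHead a r (B x ω + D x ω / x) - gammaHead a r (B x ω))
        ≤ x * (r * (D x ω / x)) := by gcongr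
      _ = r * D x ω := by field_simp
      _ ≤ r * K ω := by gcongr; exact h2.2
  · filter_upwards [hBt, hDt] with ω h1 h2
    exact tendsto_mul_gammaHead_sub r ha1 h1 h2

variable [IsProbabilityMeasure μ]

lemma measureReal_lt_eq_integral {V T : Ω → ℝ} (hV : Measurable V) (hT : Measurable T)
    (h : IndepFun V T μ) : μ.real {ω | V ω < T ω} = ∫ ω, (μ.map V).real (Set.Iio (T ω)) ∂μ := by
  have hVp := Measure.isProbabilityMeasure_map (μ := μ) hV.aemeasurable
  have hTp := Measure.isProbabilityMeasure_map (μ := μ) hT.aemeasurable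
  have hset : MeasurableSet {p : ℝ × ℝ | p.2 < p.1} := measurableSet_lt measurable_snd measurable_fst
  have hmono : Measurable fun t => (μ.map V).real (Set.Iio t) :=
    Monotone.measurable fun x y hxy => measureReal_mono (Set.Iio_subset_Iio hxy)
  have h1 : μ.real {ω | V ω < T ω} = (μ.map fun ω => (T ω, V ω)).real {p : ℝ × ℝ | p.2 < p.1} := by
    rw [map_measureReal_apply (hT.prodMk hV) hset]; rfl
  rw [h1, (indepFun_iff_map_prod_eq_prod_map_map hT.aemeasurable hV.aemeasurable).1 h.symm,
    measureReal_def, Measure.prod_apply hset,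
    ← integral_map (f := fun t => (μ.map V).real (Set.Iio t)) hT.aemeasurable
      hmono.aestronglyMeasurable,
    integral_eq_lintegral_of_nonneg_ae (Eventually.of_forall fun _ => measureReal_nonneg)
      hmono.aestronglyMeasurable]
  congr 1
  refine lintegral_congr fun t => ?_
  rw [measureReal_def, ENNReal.ofReal_toReal (measure_ne_top _ _)]
  rfl

lemma measureReal_lt_eq_integral_gammaHead {V T : Ω → ℝ} {a r : ℝ} (ha : 1 ≤ a) (hr : 0 < r)
    (hV : Measurable V) (hl : μ.map V = gammaMeasure a r) (hT : Measurable T)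
    (hT0 : ∀ᵐ ω ∂μ, 0 ≤ T ω) (h : IndepFun V T μ) :
    μ.real {ω | V ω < T ω} = ∫ ω, gammaHead a r (T ω) ∂μ := by
  rw [measureReal_lt_eq_integral hV hT h, hl]
  exact integral_congr_ae (hT0.mono fun ω hω => gammaMeasure_real_Iio ha hr hω)

lemma integrable_gammaHead_comp {T : Ω → ℝ} {a r : ℝ} (ha : 1 ≤ a) (hr : 0 < r)
    (hT : Measurable T) (hT0 : ∀ᵐ ω ∂μ, 0 ≤ T ω) : Integrable (fun ω => gammaHead a r (T ω)) μ := by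
  refine Integrable.mono' (integrable_const (1 : ℝ))
    ((continuous_gammaHead r ha).measurable.comp hT).aestronglyMeasurable (hT0.mono fun ω hω => ?_)
  rw [Real.norm_of_nonneg (gammaHead_nonneg (by linarith) hr hω)]
  exact gammaHead_le_one ha hr hω

lemma integrable_max_const {P : Ω → ℝ} (hP : Integrable P μ) (s : ℝ) :
    Integrable (fun ω => max s (P ω)) μ :=
  (integrable_const s).sup hP

/-- The success probability of a hop without a jammer. -/
lemma tendsto_hop {V U P : Ω → ℝ} {a r b l m k s γ κ : ℝ} (ha : a = 1 ∨ 2 ≤ a) (hr : 0 < r)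
    (hm : 0 < m) (hk : 0 < k) (hγ : 0 < γ) (hκ : 0 ≤ κ) (hs : 0 < s)
    (hVm : Measurable V) (hUm : Measurable U) (hPm : Measurable P)
    (hVl : μ.map V = gammaMeasure a r) (hUl : μ.map U = gammaMeasure b l)
    (hPl : μ.map P = gammaMeasure m k)
    (hV : IndepFun V (fun ω => (U ω, P ω)) μ) (hU : IndepFun U P μ) :
    Tendsto (fun x => x * (μ.real {ω | κ * max s (P ω) / x + γ * U ω ≤ V ω} -
        ∫ u, gammaTail a r (γ * u) ∂gammaMeasure b l)) atTop
      (𝓝 (-(κ * (∫ u, gammaDensity a r (γ * u) ∂gammaMeasure b l) *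
        ∫ x, max s x ∂gammaMeasure m k))) := by
  have ha1 : 1 ≤ a := by rcases ha with rfl | ha <;> linarith
  have hU0 := ae_pos_of_map_eq hUm hUl
  have hPi : Integrable P μ := integrable_comp_of_map_eq hPm hPl (integrable_id_gammaMeasure hm hk)
  have hZ : ∀ ω, 0 ≤ κ * max s (P ω) := fun ω => mul_nonneg hκ (le_max_of_le_left hs.le)
  have htail := measurable_gammaTail (show 0 < a by linarith) hr
  have hdens := measurable_gammaDensity a r
  have hhead := (continuous_gammaHead r ha1).measurable
  -- The base point γU does not depend on x, and the increment is κ max(s, P) / x.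
  have h := tendsto_integral_gammaHead_sub (μ := μ) ha hr (B := fun _ ω => γ * U ω)
    (D := fun _ ω => κ * max s (P ω)) (B₀ := fun ω => γ * U ω) (D₀ := fun ω => κ * max s (P ω))
    (K := fun ω => κ * max s (P ω)) (fun _ => by fun_prop) (fun _ => by fun_prop)
    (fun x hx => hU0.mono fun ω hω => by positivity)
    (fun x hx => Eventually.of_forall fun ω => ⟨hZ ω, le_rfl⟩)
    ((integrable_max_const hPi s).const_mul κ)
    (Eventually.of_forall fun _ => tendsto_const_nhds)
    (Eventually.of_forall fun _ => tendsto_const_nhds)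
  have hlim : ∫ ω, gammaDensity a r (γ * U ω) * (κ * max s (P ω)) ∂μ =
      κ * (∫ u, gammaDensity a r (γ * u) ∂gammaMeasure b l) *
        ∫ x, max s x ∂gammaMeasure m k := by
    rw [IndepFun.integral_fun_mul_eq_mul_integral (X := fun ω => gammaDensity a r (γ * U ω))
      (Y := fun ω => κ * max s (P ω))
      (hU.comp (φ := fun u => gammaDensity a r (γ * u)) (ψ := fun p => κ * max s p)
        (by fun_prop) (by fun_prop))
      (Measurable.aestronglyMeasurable (by fun_prop))
      (Measurable.aestronglyMeasurable (by fun_prop)), integral_const_mul,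
      integral_comp_of_map_eq hUm hUl (f := fun u => gammaDensity a r (γ * u)) (by fun_prop),
      integral_comp_of_map_eq hPm hPl (f := fun p => max s p) (by fun_prop)]
    ring
  rw [hlim] at h
  refine h.neg.congr' ?_
  filter_upwards [eventually_gt_atTop 0] with x hx
  have hT0 : ∀ᵐ ω ∂μ, 0 ≤ γ * U ω + κ * max s (P ω) / x := hU0.mono fun ω hω => by
    have := div_nonneg (hZ ω) hx.le
    positivity
  have hTm : Measurable fun ω => γ * U ω + κ * max s (P ω) / x := by fun_prop
  have hB0 : ∀ᵐ ω ∂μ, 0 ≤ γ * U ω := hU0.mono fun ω hω => by positivity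
  have h1 := measureReal_lt_eq_integral_gammaHead ha1 hr hVm hVl hTm hT0
    (hV.comp (φ := id) (ψ := fun p : ℝ × ℝ => γ * p.1 + κ * max s p.2 / x)
      measurable_id (by fun_prop))
  have h2 : μ.real {ω | κ * max s (P ω) / x + γ * U ω ≤ V ω} =
      1 - μ.real {ω | V ω < γ * U ω + κ * max s (P ω) / x} := by
    rw [← probReal_compl_eq_one_sub (measurableSet_lt hVm hTm)]
    congr 1
    ext ω
    simp [add_comm]
  have h3 : ∫ u, gammaTail a r (γ * u) ∂gammaMeasure b l = 1 - ∫ ω, gammaHead a r (γ * U ω) ∂μ := by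
    rw [← integral_comp_of_map_eq hUm hUl (f := fun u => gammaTail a r (γ * u)) (by fun_prop)]
    have : (1 : ℝ) = ∫ _, (1 : ℝ) ∂μ := by simp
    rw [this, ← integral_sub (integrable_const _) (integrable_gammaHead_comp ha1 hr (by fun_prop) hB0)]
    exact integral_congr_ae (hB0.mono fun ω hω => gammaTail_eq_one_sub ha1 hr hω)
  rw [h2, h1, h3, integral_sub (integrable_gammaHead_comp ha1 hr hTm hT0)
    (integrable_gammaHead_comp ha1 hr (by fun_prop) hB0)]
  ring

end Outage

/-! ### The mean of the reciprocal of a shifted exponential variable -/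

/-- The mean of `1 / (W + η)` for an exponential variable `W` of rate `w`. -/
noncomputable def shiftedInvMean (w η : ℝ) : ℝ := ∫ y, 1 / (y + η) ∂gammaMeasure 1 w

lemma integrable_shifted_inv {w η : ℝ} (hw : 0 < w) (hη : 0 < η) :
    Integrable (fun y => 1 / (y + η)) (gammaMeasure 1 w) := by
  have := isProbabilityMeasure_gammaMeasure one_pos hw
  refine Integrable.mono' (integrable_const (1 / η)) (Measurable.aestronglyMeasurable (by fun_prop))
    ((ae_pos_gammaMeasure 1 w).mono fun y hy => ?_)
  rw [Real.norm_of_nonneg (by positivity)]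
  gcongr
  linarith

lemma shiftedInvMean_nonneg (w : ℝ) {η : ℝ} (hη : 0 < η) : 0 ≤ shiftedInvMean w η :=
  integral_nonneg_of_ae ((ae_pos_gammaMeasure 1 w).mono fun y hy => by
    simp only [Pi.zero_apply]; positivity)

lemma shiftedInvMean_anti {w η₁ η₂ : ℝ} (hw : 0 < w) (h1 : 0 < η₁) (h : η₁ ≤ η₂) :
    shiftedInvMean w η₂ ≤ shiftedInvMean w η₁ :=
  integral_mono_ae (integrable_shifted_inv hw (h1.trans_le h)) (integrable_shifted_inv hw h1)
    ((ae_pos_gammaMeasure 1 w).mono fun y hy => by simp only; gcongr)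

lemma measurable_shiftedInvMean {w : ℝ} (hw : 0 < w) : Measurable (shiftedInvMean w) := by
  have := isProbabilityMeasure_gammaMeasure one_pos hw
  have h : StronglyMeasurable fun p : ℝ × ℝ => 1 / (p.2 + p.1) :=
    Measurable.stronglyMeasurable (by fun_prop)
  exact (h.integral_prod_right' (ν := gammaMeasure 1 w)).measurable

lemma integral_inv_add {η : ℝ} (hη : 0 < η) :
    ∫ y in Set.Ioc (0 : ℝ) 1, 1 / (y + η) = Real.log (1 / η + 1) := by
  rw [← intervalIntegral.integral_of_le zero_le_one,
    intervalIntegral.integral_comp_add_right (fun y => 1 / y), zero_add,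
    integral_one_div_of_pos hη (by linarith)]
  congr 1
  field_simp

/-- On (0, 1] the exponential density lies between w (1 - w y) and w, and 1/(y + η) integrates to
the logarithm; the loss w² comes from y/(y + η) ≤ 1. Beyond 1 the integrand is at most the density,
which adds at most 1. Only the boundedness of the error matters. -/
lemma shiftedInvMean_bounds {w η : ℝ} (hw : 0 < w) (hη : 0 < η) :
    w * Real.log (1 / η + 1) - w ^ 2 ≤ shiftedInvMean w η ∧
      shiftedInvMean w η ≤ w * Real.log (1 / η + 1) + 1 := by
  have hint := (integrable_gammaMeasure_iff one_pos hw _).1 (integrable_shifted_inv hw hη)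
  have i1 := hint.mono_set (Set.Ioc_subset_Ioi_self (b := (0 : ℝ)) (a := 1))
  have i2 := hint.mono_set (Set.Ioi_subset_Ioi (zero_le_one (α := ℝ)))
  have hsplit : shiftedInvMean w η =
      (∫ y in Set.Ioc (0 : ℝ) 1, gammaDensity 1 w y • (1 / (y + η))) +
        ∫ y in Set.Ioi (1 : ℝ), gammaDensity 1 w y • (1 / (y + η)) := by
    rw [shiftedInvMean, integral_gammaMeasure one_pos hw,
      ← Set.Ioc_union_Ioi_eq_Ioi (zero_le_one (α := ℝ)),
      setIntegral_union Set.Ioc_disjoint_Ioi_same measurableSet_Ioi i1 i2]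
  have hc : IntegrableOn (fun y : ℝ => 1 / (y + η)) (Set.Ioc 0 1) := by
    refine (ContinuousOn.integrableOn_Icc (ContinuousOn.div continuousOn_const (by fun_prop)
      fun y hy => ?_)).mono_set Set.Ioc_subset_Icc_self
    have := hy.1
    positivity
  constructor
  · have h1 : ∫ y in Set.Ioc (0 : ℝ) 1, (w * (1 / (y + η)) - w ^ 2) ≤
        ∫ y in Set.Ioc (0 : ℝ) 1, gammaDensity 1 w y • (1 / (y + η)) := by
      refine setIntegral_mono_on ((hc.const_mul w).sub (by simp)) i1 measurableSet_Ioc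
        fun y hy => ?_
      have hy0 := hy.1
      have h2 : 1 - w * y ≤ Real.exp (-(w * y)) := by
        linarith [Real.add_one_le_exp (-(w * y))]
      have h3 : y / (y + η) ≤ 1 := (div_le_one (by positivity)).2 (by linarith)
      calc w * (1 / (y + η)) - w ^ 2 ≤ w * (1 / (y + η)) - w ^ 2 * (y / (y + η)) := by
            nlinarith [sq_nonneg w]
        _ = w * (1 - w * y) * (1 / (y + η)) := by field_simp
        _ ≤ w * Real.exp (-(w * y)) * (1 / (y + η)) := by gcongr
        _ = _ := by rw [gammaDensity_one, smul_eq_mul]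
    have h4 : 0 ≤ ∫ y in Set.Ioi (1 : ℝ), gammaDensity 1 w y • (1 / (y + η)) :=
      setIntegral_nonneg measurableSet_Ioi fun y hy => by
        have hy' : (1 : ℝ) < y := hy
        have : 0 < y := by linarith
        rw [gammaDensity_one, smul_eq_mul]
        positivity
    rw [integral_sub (hc.const_mul w) (by simp), integral_const_mul, integral_inv_add hη] at h1
    simp at h1
    rw [hsplit]
    simp only [one_div, smul_eq_mul] at *
    linarith
  · have h1 : ∫ y in Set.Ioc (0 : ℝ) 1, gammaDensity 1 w y • (1 / (y + η)) ≤
        ∫ y in Set.Ioc (0 : ℝ) 1, w * (1 / (y + η)) := by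
      refine setIntegral_mono_on i1 (hc.const_mul w) measurableSet_Ioc fun y hy => ?_
      have hy0 := hy.1
      rw [gammaDensity_one, smul_eq_mul]
      gcongr
      exact mul_le_of_le_one_right hw.le (Real.exp_le_one_iff.2 (by nlinarith))
    have hd := (integrable_gammaMeasure_iff (E := ℝ) one_pos hw fun _ => 1).1 (by
      have := isProbabilityMeasure_gammaMeasure one_pos hw
      exact integrable_const _)
    have hd1 := integral_gammaMeasure (E := ℝ) one_pos hw fun _ => 1
    have hP := isProbabilityMeasure_gammaMeasure one_pos hw
    simp only [integral_const, probReal_univ, smul_eq_mul, mul_one] at hd hd1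
    have h2 : ∫ y in Set.Ioi (1 : ℝ), gammaDensity 1 w y • (1 / (y + η)) ≤ 1 := by
      calc ∫ y in Set.Ioi (1 : ℝ), gammaDensity 1 w y • (1 / (y + η))
          ≤ ∫ y in Set.Ioi (1 : ℝ), gammaDensity 1 w y := by
            refine setIntegral_mono_on i2 (hd.mono_set (Set.Ioi_subset_Ioi zero_le_one))
              measurableSet_Ioi fun y hy => ?_
            have hy' : (1 : ℝ) < y := hy
            rw [smul_eq_mul]
            refine mul_le_of_le_one_right (gammaDensity_nonneg one_pos hw (by linarith)) ?_
            rw [div_le_one (by linarith)]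
            linarith
        _ ≤ ∫ y in Set.Ioi (0 : ℝ), gammaDensity 1 w y := by
            refine setIntegral_mono_set hd ?_
              (Eventually.of_forall (Set.Ioi_subset_Ioi zero_le_one))
            filter_upwards [ae_restrict_mem measurableSet_Ioi] with y hy
            exact gammaDensity_nonneg one_pos hw (le_of_lt hy)
        _ = 1 := hd1.symm
    rw [integral_const_mul, integral_inv_add hη] at h1
    rw [hsplit]
    linarith

lemma tendsto_shiftedInvMean_div_log {w z : ℝ} (hw : 0 < w) (hz : 0 < z) :
    Tendsto (fun x => shiftedInvMean w (z / x) / Real.log x) atTop (𝓝 w) := by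
  have hlog : Tendsto (fun x => (Real.log x)⁻¹) atTop (𝓝 0) :=
    Real.tendsto_log_atTop.inv_tendsto_atTop
  have h1 : Tendsto (fun x => Real.log (1 / (z / x) + 1) / Real.log x) atTop (𝓝 1) := by
    have h2 : Tendsto (fun x : ℝ => Real.log (1 / z + 1 / x)) atTop (𝓝 (Real.log (1 / z + 0))) := by
      refine Tendsto.log (tendsto_const_nhds.add ?_) (by positivity)
      exact tendsto_const_nhds.div_atTop tendsto_id
    have h3 := (h2.mul hlog).const_add 1
    rw [mul_zero, add_zero] at h3
    refine h3.congr' ?_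
    filter_upwards [eventually_gt_atTop 1] with x hx
    have hx0 : 0 < x := by linarith
    have hl := (Real.log_pos hx).ne'
    have : 1 / (z / x) + 1 = x * (1 / z + 1 / x) := by field_simp
    rw [this, Real.log_mul hx0.ne' (by positivity)]
    field_simp
  have hlow : Tendsto (fun x => (w * Real.log (1 / (z / x) + 1) - w ^ 2) / Real.log x) atTop
      (𝓝 w) := by
    have := (h1.const_mul w).sub (hlog.const_mul (w ^ 2))
    simp only [mul_one, mul_zero, sub_zero] at this
    refine this.congr fun x => ?_
    ring
  have hup : Tendsto (fun x => (w * Real.log (1 / (z / x) + 1) + 1) / Real.log x) atTop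
      (𝓝 w) := by
    have := (h1.const_mul w).add hlog
    simp only [mul_one, add_zero] at this
    refine this.congr fun x => ?_
    ring
  refine tendsto_of_tendsto_of_tendsto_of_le_of_le' hlow hup ?_ ?_
  all_goals
    filter_upwards [eventually_gt_atTop 1] with x hx
    have hl := Real.log_pos hx
    have hb := shiftedInvMean_bounds hw (show 0 < z / x from div_pos hz (by linarith))
    gcongr
  exacts [hb.1, hb.2]

section

variable {Ω : Type*} [MeasurableSpace Ω] {μ : Measure Ω}

/-- Dominated convergence: `shiftedInvMean` decreases in the shift, so G may be replaced by its
lower bound s, and there the quotient by log x is eventually at most w + 1. -/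
lemma tendsto_integral_mul_shiftedInvMean {w s : ℝ} (hw : 0 < w) (hs : 0 < s) {F G : Ω → ℝ}
    (hF : Integrable F μ) (hG : Measurable G) (hGs : ∀ᵐ ω ∂μ, s ≤ G ω) :
    Tendsto (fun x => (∫ ω, F ω * shiftedInvMean w (G ω / x) ∂μ) / Real.log x) atTop
      (𝓝 (w * ∫ ω, F ω ∂μ)) := by
  have hm := measurable_shiftedInvMean hw
  simp only [← integral_div, ← integral_const_mul]
  refine tendsto_integral_filter_of_dominated_convergence (fun ω => |F ω| * (w + 1)) ?_ ?_
    (hF.abs.mul_const _) ?_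
  · refine Eventually.of_forall fun x => ?_
    simp only [div_eq_mul_inv _ (Real.log x)]
    exact AEStronglyMeasurable.mul_const
      (hF.1.mul (hm.comp (hG.div_const x)).aestronglyMeasurable) _
  · filter_upwards [eventually_gt_atTop 1,
      (tendsto_shiftedInvMean_div_log hw hs).eventually_le_const (lt_add_one w)] with x hx hx2
    filter_upwards [hGs] with ω hω
    have hx0 : 0 < x := by linarith
    have hl := Real.log_pos hx
    have h1 : 0 < s / x := div_pos hs hx0
    have h2 : s / x ≤ G ω / x := by gcongr
    rw [norm_div, norm_mul, Real.norm_of_nonneg hl.le, mul_div_assoc, Real.norm_eq_abs,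
      Real.norm_of_nonneg (shiftedInvMean_nonneg w (h1.trans_le h2))]
    gcongr
    refine le_trans ?_ hx2
    gcongr
    exact shiftedInvMean_anti hw h1 h2
  · filter_upwards [hGs] with ω hω
    have := (tendsto_shiftedInvMean_div_log hw (hs.trans_le hω)).const_mul (F ω)
    rw [mul_comm (F ω)] at this
    exact this.congr fun x => by ring

/-- The exponential gain W is integrated out first, conditionally on (F, G); the positive shift G/x
keeps the quotient integrable. -/
lemma integral_div_shifted_eq [IsProbabilityMeasure μ] {w s x : ℝ} (hw : 0 < w) (hs : 0 < s)
    (hx : 0 < x) {W F G : Ω → ℝ} (hW : Measurable W) (hWl : μ.map W = gammaMeasure 1 w)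
    (hFm : Measurable F) (hF : Integrable F μ) (hG : Measurable G) (hGs : ∀ᵐ ω ∂μ, s ≤ G ω)
    (h : IndepFun W (fun ω => (F ω, G ω)) μ) :
    Integrable (fun ω => F ω / (W ω + G ω / x)) μ ∧
    ∫ ω, F ω / (W ω + G ω / x) ∂μ = ∫ ω, F ω * shiftedInvMean w (G ω / x) ∂μ := by
  have hP := isProbabilityMeasure_gammaMeasure one_pos hw
  have hFG : Measurable fun ω => (F ω, G ω) := hFm.prodMk hG
  have hPm := Measure.isProbabilityMeasure_map (μ := μ) hFG.aemeasurable
  have hW0 := ae_pos_of_map_eq hW hWl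
  have hint : Integrable (fun ω => F ω / (W ω + G ω / x)) μ := by
    refine Integrable.mono' (hF.abs.mul_const (x / s))
      (Measurable.aestronglyMeasurable (by fun_prop)) ?_
    filter_upwards [hW0, hGs] with ω h1 h2
    have h3 : s / x ≤ G ω / x := by gcongr
    have h4 : 0 < s / x := by positivity
    rw [norm_div, Real.norm_eq_abs, Real.norm_of_nonneg (by linarith), div_eq_mul_inv]
    gcongr
    rw [← inv_div s x]
    gcongr
    linarith
  refine ⟨hint, ?_⟩
  have hjoint := (indepFun_iff_map_prod_eq_prod_map_map hFG.aemeasurable hW.aemeasurable).1 h.symm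
  have hfm : Measurable fun p : (ℝ × ℝ) × ℝ => p.1.1 / (p.2 + p.1.2 / x) := by fun_prop
  have h1 : ∫ ω, F ω / (W ω + G ω / x) ∂μ =
      ∫ p : (ℝ × ℝ) × ℝ, p.1.1 / (p.2 + p.1.2 / x) ∂(μ.map fun ω => ((F ω, G ω), W ω)) := by
    rw [integral_map (hFG.prodMk hW).aemeasurable hfm.aestronglyMeasurable]
  have h2 : Integrable (fun p : (ℝ × ℝ) × ℝ => p.1.1 / (p.2 + p.1.2 / x))
      (μ.map fun ω => ((F ω, G ω), W ω)) := by
    rw [integrable_map_measure hfm.aestronglyMeasurable (hFG.prodMk hW).aemeasurable]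
    exact hint
  rw [hjoint, hWl] at h1 h2
  have hm := measurable_shiftedInvMean hw
  rw [h1, integral_prod _ h2, ← integral_map (φ := fun ω => (F ω, G ω))
    (f := fun q : ℝ × ℝ => q.1 * shiftedInvMean w (q.2 / x)) hFG.aemeasurable
    (Measurable.aestronglyMeasurable (by fun_prop))]
  refine integral_congr_ae (Eventually.of_forall fun q => ?_)
  simp only [shiftedInvMean]
  rw [← integral_const_mul]
  refine integral_congr_ae (Eventually.of_forall fun y => ?_)
  simp only
  ring

end

/-! ### Outage of a hop in the presence of a jammer -/

/-- The total gains of a jammed hop: legitimate link `V`, wiretap link `U`, jamming link `W`, and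
the links `P`, `Q` from the transmitter and the jammer to the primary receiver. -/
structure JammedHop {Ω : Type*} [MeasurableSpace Ω] (μ : Measure Ω) (V U P W Q : Ω → ℝ)
    (a r b l m k c w n j : ℝ) : Prop where
  r_pos : 0 < r
  b_pos : 0 < b
  l_pos : 0 < l
  m_pos : 0 < m
  k_pos : 0 < k
  w_pos : 0 < w
  n_pos : 0 < n
  j_pos : 0 < j
  measV : Measurable V
  measU : Measurable U
  measP : Measurable P
  measW : Measurable W
  measQ : Measurable Q
  lawV : μ.map V = gammaMeasure a r
  lawU : μ.map U = gammaMeasure b l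
  lawP : μ.map P = gammaMeasure m k
  lawW : μ.map W = gammaMeasure c w
  lawQ : μ.map Q = gammaMeasure n j
  indepV : IndepFun V (fun ω => (U ω, P ω, W ω, Q ω)) μ
  indepW : IndepFun W (fun ω => (V ω, U ω, P ω, Q ω)) μ
  indepQ : IndepFun Q (fun ω => (V ω, U ω)) μ

namespace JammedHop

variable {Ω : Type*} [MeasurableSpace Ω] {μ : Measure Ω}
  {V U P W Q : Ω → ℝ} {a r b l m k c w n j s t γ κ : ℝ}

lemma integrableU (H : JammedHop μ V U P W Q a r b l m k c w n j) : Integrable U μ :=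
  integrable_comp_of_map_eq H.measU H.lawU (integrable_id_gammaMeasure H.b_pos H.l_pos)

lemma integral_maxP (H : JammedHop μ V U P W Q a r b l m k c w n j) (s : ℝ) :
    ∫ ω, max s (P ω) ∂μ = ∫ x, max s x ∂gammaMeasure m k :=
  integral_comp_of_map_eq H.measP H.lawP (f := fun p => max s p) (by fun_prop)

lemma integral_maxQ (H : JammedHop μ V U P W Q a r b l m k c w n j) (t : ℝ) :
    ∫ ω, max t (Q ω) ∂μ = ∫ x, max t x ∂gammaMeasure n j :=
  integral_comp_of_map_eq H.measQ H.lawQ (f := fun p => max t p) (by fun_prop)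

lemma integralU (H : JammedHop μ V U P W Q a r b l m k c w n j) : ∫ ω, U ω ∂μ = b / l := by
  rw [integral_comp_of_map_eq H.measU H.lawU (f := fun u => u) (by fun_prop),
    integral_id_gammaMeasure H.b_pos H.l_pos]

lemma indep_U_maxQ (H : JammedHop μ V U P W Q a r b l m k c w n j) (t : ℝ) :
    IndepFun U (fun ω => max t (Q ω)) μ :=
  (H.indepQ.comp (φ := fun q => max t q) (ψ := fun p : ℝ × ℝ => p.2) (by fun_prop)
    (by fun_prop)).symm

lemma ae_pos (H : JammedHop μ V U P W Q a r b l m k c w n j) :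
    ∀ᵐ ω ∂μ, 0 < V ω ∧ 0 < U ω ∧ 0 < W ω :=
  (ae_pos_of_map_eq H.measV H.lawV).and
    ((ae_pos_of_map_eq H.measU H.lawU).and (ae_pos_of_map_eq H.measW H.lawW))

lemma integral_U_mul_maxQ (H : JammedHop μ V U P W Q a r b l m k c w n j) (t : ℝ) :
    ∫ ω, U ω * max t (Q ω) ∂μ = b / l * ∫ x, max t x ∂gammaMeasure n j := by
  have hQ := H.measQ
  rw [(H.indep_U_maxQ t).integral_fun_mul_eq_mul_integral H.measU.aestronglyMeasurable
    (Measurable.aestronglyMeasurable (by fun_prop)), H.integralU, H.integral_maxQ]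

variable [IsProbabilityMeasure μ]

lemma integrable_maxP (H : JammedHop μ V U P W Q a r b l m k c w n j) (s : ℝ) :
    Integrable (fun ω => max s (P ω)) μ :=
  integrable_max_const
    (integrable_comp_of_map_eq H.measP H.lawP (integrable_id_gammaMeasure H.m_pos H.k_pos)) s

lemma integrable_maxQ (H : JammedHop μ V U P W Q a r b l m k c w n j) (t : ℝ) :
    Integrable (fun ω => max t (Q ω)) μ :=
  integrable_max_const
    (integrable_comp_of_map_eq H.measQ H.lawQ (integrable_id_gammaMeasure H.n_pos H.j_pos)) t

lemma integrable_U_mul_maxQ (H : JammedHop μ V U P W Q a r b l m k c w n j) (t : ℝ) :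
    Integrable (fun ω => U ω * max t (Q ω)) μ :=
  (H.indep_U_maxQ t).integrable_mul H.integrableU (H.integrable_maxQ t)

/-- The mean of 1/V is finite because the shape of V exceeds 1, and U is independent of V. -/
lemma integrable_ratio_excess (H : JammedHop μ V U P W Q a r b l m k c w n j) (ha : 1 < a)
    (γ : ℝ) : Integrable (fun ω => max 0 (γ * (U ω / V ω) - 1)) μ := by
  have hUV : IndepFun U (fun ω => (V ω)⁻¹) μ :=
    (H.indepV.comp (φ := fun y => y⁻¹) (ψ := fun p : ℝ × ℝ × ℝ × ℝ => p.1) (by fun_prop)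
      (by fun_prop)).symm
  have hVi : Integrable (fun ω => (V ω)⁻¹) μ :=
    integrable_comp_of_map_eq H.measV H.lawV (integrable_inv_gammaMeasure ha H.r_pos)
  have hUVi : Integrable (fun ω => U ω / V ω) μ := hUV.integrable_mul H.integrableU hVi
  exact (integrable_const 0).sup ((hUVi.const_mul γ).sub (integrable_const 1))

/-- If the shape of the jamming link exceeds `1`, the reciprocal of its gain has a finite mean. -/
lemma tendsto_outage_of_one_lt (H : JammedHop μ V U P W Q a r b l m k c w n j)
    (ha : a = 1 ∨ 2 ≤ a) (hc : 1 < c) (hs : 0 < s) (ht : 0 < t) (hγ : 0 < γ) (hκ : 0 ≤ κ) :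
    Tendsto (fun x => x * μ.real {ω | V ω < (κ * max s (P ω) +
        γ * (U ω * max t (Q ω)) / (W ω + max t (Q ω) / x)) / x}) atTop
      (𝓝 (gammaDensity a r 0 * (κ * (∫ x, max s x ∂gammaMeasure m k) +
        γ * (b / l * (∫ x, max t x ∂gammaMeasure n j) *
          (w * Real.Gamma (c - 1) / Real.Gamma c))))) := by
  have ha1 : 1 ≤ a := by rcases ha with rfl | ha <;> linarith
  have := H.measU; have := H.measP; have := H.measW; have := H.measQ
  have hI : IndepFun (fun ω => U ω * max t (Q ω)) (fun ω => (W ω)⁻¹) μ :=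
    (H.indepW.comp (φ := fun y => y⁻¹)
      (ψ := fun p : ℝ × ℝ × ℝ × ℝ => p.2.1 * max t p.2.2.2) (by fun_prop) (by fun_prop)).symm
  have hWi : Integrable (fun ω => (W ω)⁻¹) μ :=
    integrable_comp_of_map_eq H.measW H.lawW (integrable_inv_gammaMeasure hc H.w_pos)
  have hUZW : Integrable (fun ω => U ω * max t (Q ω) * (W ω)⁻¹) μ :=
    hI.integrable_mul (H.integrable_U_mul_maxQ t) hWi
  have hK : Integrable (fun ω => κ * max s (P ω) + γ * (U ω * max t (Q ω) * (W ω)⁻¹)) μ :=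
    ((H.integrable_maxP s).const_mul κ).add (hUZW.const_mul γ)
  -- Dropping the shift max(t, Q)/x from the denominator gives a majorant free of x. It is
  -- integrable since 1/W has a finite mean for c > 1.
  have hD : ∀ x, 0 < x → ∀ᵐ ω ∂μ, 0 ≤ κ * max s (P ω) +
      γ * (U ω * max t (Q ω)) / (W ω + max t (Q ω) / x) ∧
      κ * max s (P ω) + γ * (U ω * max t (Q ω)) / (W ω + max t (Q ω) / x) ≤
      κ * max s (P ω) + γ * (U ω * max t (Q ω) * (W ω)⁻¹) := fun x hx => by
    filter_upwards [H.ae_pos] with ω hω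
    obtain ⟨-, hU, hW⟩ := hω
    have hY : 0 < max s (P ω) := lt_max_of_lt_left hs
    have hZ : 0 < max t (Q ω) := lt_max_of_lt_left ht
    refine ⟨by positivity, ?_⟩
    rw [show γ * (U ω * max t (Q ω) * (W ω)⁻¹) = γ * (U ω * max t (Q ω)) / W ω by ring]
    gcongr
    exact le_add_of_nonneg_right (by positivity)
  -- The base point is 0 and the whole threshold is the increment, so the density of V enters at 0.
  have h := tendsto_integral_gammaHead_sub (μ := μ) ha H.r_pos (B := fun (_ : ℝ) (_ : Ω) => (0 : ℝ))
    (D := fun x ω => κ * max s (P ω) + γ * (U ω * max t (Q ω)) / (W ω + max t (Q ω) / x))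
    (B₀ := fun _ => 0) (D₀ := fun ω => κ * max s (P ω) + γ * (U ω * max t (Q ω) * (W ω)⁻¹))
    (fun _ => by fun_prop) (fun _ => by fun_prop)
    (fun x hx => Eventually.of_forall fun ω => le_rfl) hD hK
    (Eventually.of_forall fun _ => tendsto_const_nhds) (by
      filter_upwards [H.ae_pos] with ω hω
      have h1 : Tendsto (fun x => W ω + max t (Q ω) / x) atTop (𝓝 (W ω + 0)) :=
        tendsto_const_nhds.add (tendsto_const_nhds.div_atTop tendsto_id)
      rw [add_zero] at h1
      rw [show γ * (U ω * max t (Q ω) * (W ω)⁻¹) = γ * (U ω * max t (Q ω)) / W ω by ring]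
      exact tendsto_const_nhds.add (tendsto_const_nhds.div h1 hω.2.2.ne'))
  rw [integral_const_mul, integral_add ((H.integrable_maxP s).const_mul κ) (hUZW.const_mul γ),
    integral_const_mul, integral_const_mul, hI.integral_fun_mul_eq_mul_integral
      (Measurable.aestronglyMeasurable (by fun_prop))
      (Measurable.aestronglyMeasurable (by fun_prop)),
    H.integral_U_mul_maxQ, H.integral_maxP, integral_comp_of_map_eq H.measW H.lawW
      (f := fun y => y⁻¹) (by fun_prop), integral_inv_gammaMeasure hc H.w_pos] at h
  refine h.congr' ?_
  filter_upwards [eventually_gt_atTop 0] with x hx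
  rw [measureReal_lt_eq_integral_gammaHead ha1 H.r_pos H.measV H.lawV (by fun_prop)
    ((hD x hx).mono fun ω hω => div_nonneg hω.1 hx.le)
    (H.indepV.comp (φ := id) (ψ := fun p : ℝ × ℝ × ℝ × ℝ => (κ * max s p.2.1 +
        γ * (p.1 * max t p.2.2.2) / (p.2.2.1 + max t p.2.2.2 / x)) / x) measurable_id
      (by fun_prop))]
  simp [gammaHead_zero]

/-- If the shape of the legitimate link exceeds `1` and the jamming gain is exponential, outage is
caused by a small jamming gain. -/
lemma tendsto_outage_of_exponential_jammer (H : JammedHop μ V U P W Q a r b l m k 1 w n j)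
    (ha : 2 ≤ a) (hs : 0 < s) (ht : 0 < t) (hγ : 0 < γ) (hκ : 0 ≤ κ) :
    Tendsto (fun x => x * μ.real {ω | V ω < (κ * max s (P ω) +
        γ * (U ω * max t (Q ω)) / (W ω + max t (Q ω) / x)) / x}) atTop
      (𝓝 (w * ((∫ x, max t x ∂gammaMeasure n j) * ∫ ω, max 0 (γ * (U ω / V ω) - 1) ∂μ))) := by
  have ha1 : 1 ≤ a := by linarith
  have := H.measU; have := H.measP; have := H.measW; have := H.measQ; have := H.measV
  have hB : ∀ x, 0 < x → ∀ᵐ ω ∂μ,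
      0 ≤ γ * (U ω * max t (Q ω)) / (W ω + max t (Q ω) / x) / x := fun x hx => by
    filter_upwards [H.ae_pos] with ω hω
    obtain ⟨-, hU, hW⟩ := hω
    have hZ : 0 < max t (Q ω) := lt_max_of_lt_left ht
    positivity
  have hY : ∀ ω, 0 ≤ κ * max s (P ω) := fun ω => mul_nonneg hκ (le_max_of_le_left hs.le)
  -- The jamming term is taken as the base point, which tends to 0. Since f_V(0) = 0, adding κ
  -- max(s, P)/x to the threshold costs only o(1/x).
  have h1 := tendsto_integral_gammaHead_sub (μ := μ) (Or.inr ha) H.r_pos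
    (B := fun x ω => γ * (U ω * max t (Q ω)) / (W ω + max t (Q ω) / x) / x)
    (D := fun _ ω => κ * max s (P ω)) (B₀ := fun _ => 0) (D₀ := fun ω => κ * max s (P ω))
    (K := fun ω => κ * max s (P ω)) (fun _ => by fun_prop) (fun _ => by fun_prop) hB
    (fun x hx => Eventually.of_forall fun ω => ⟨hY ω, le_rfl⟩)
    ((H.integrable_maxP s).const_mul κ) (by
      filter_upwards [H.ae_pos] with ω hω
      have h1 : Tendsto (fun x => W ω + max t (Q ω) / x) atTop (𝓝 (W ω + 0)) :=
        tendsto_const_nhds.add (tendsto_const_nhds.div_atTop tendsto_id)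
      rw [add_zero] at h1
      exact (tendsto_const_nhds.div h1 hω.2.2.ne').div_atTop tendsto_id)
    (Eventually.of_forall fun _ => tendsto_const_nhds)
  simp only [gammaDensity_zero r (show 1 < a by linarith), zero_mul, integral_zero] at h1
  have hE := H.integrable_ratio_excess (show 1 < a by linarith) γ
  have hQI : IndepFun (fun ω => max t (Q ω)) (fun ω => max 0 (γ * (U ω / V ω) - 1)) μ :=
    H.indepQ.comp (φ := fun q => max t q) (ψ := fun p : ℝ × ℝ => max 0 (γ * (p.2 / p.1) - 1))
      (by fun_prop) (by fun_prop)
  have hE0 : ∀ ω, 0 ≤ max t (Q ω) * max 0 (γ * (U ω / V ω) - 1) := fun ω =>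
    mul_nonneg (le_max_of_le_left ht.le) (le_max_left _ _)
  -- Now the distribution function of W, not of V, is expanded at 0.
  have h2 := tendsto_integral_gammaHead_sub (μ := μ) (a := 1) (Or.inl rfl) H.w_pos
    (B := fun _ _ => 0) (D := fun _ ω => max t (Q ω) * max 0 (γ * (U ω / V ω) - 1))
    (B₀ := fun _ => 0) (D₀ := fun ω => max t (Q ω) * max 0 (γ * (U ω / V ω) - 1))
    (K := fun ω => max t (Q ω) * max 0 (γ * (U ω / V ω) - 1))
    (fun _ => by fun_prop) (fun _ => by fun_prop)
    (fun x hx => Eventually.of_forall fun ω => le_rfl)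
    (fun x hx => Eventually.of_forall fun ω => ⟨hE0 ω, le_rfl⟩)
    (hQI.integrable_mul (H.integrable_maxQ t) hE)
    (Eventually.of_forall fun _ => tendsto_const_nhds)
    (Eventually.of_forall fun _ => tendsto_const_nhds)
  rw [integral_const_mul, hQI.integral_fun_mul_eq_mul_integral
    (Measurable.aestronglyMeasurable (by fun_prop))
    (Measurable.aestronglyMeasurable (by fun_prop)), H.integral_maxQ] at h2
  have h3 := h1.add h2
  simp only [gammaDensity_one, mul_zero, neg_zero, Real.exp_zero, mul_one, zero_add] at h3
  refine h3.congr' ?_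
  filter_upwards [eventually_gt_atTop 0] with x hx
  have hT : Measurable fun ω => γ * (U ω * max t (Q ω)) / (W ω + max t (Q ω) / x) / x := by
    fun_prop
  have hT2 : Measurable fun ω => (κ * max s (P ω) +
        γ * (U ω * max t (Q ω)) / (W ω + max t (Q ω) / x)) / x := by
    fun_prop
  have hT20 : ∀ᵐ ω ∂μ, 0 ≤ (κ * max s (P ω) +
      γ * (U ω * max t (Q ω)) / (W ω + max t (Q ω) / x)) / x := (hB x hx).mono fun ω hω => by
    rw [add_div]
    exact add_nonneg (div_nonneg (hY ω) hx.le) hω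
  have e1 := measureReal_lt_eq_integral_gammaHead ha1 H.r_pos H.measV H.lawV hT2 hT20
    (H.indepV.comp (φ := id) (ψ := fun p : ℝ × ℝ × ℝ × ℝ => (κ * max s p.2.1 +
        γ * (p.1 * max t p.2.2.2) / (p.2.2.1 + max t p.2.2.2 / x)) / x) measurable_id
      (by fun_prop))
  have e2 := measureReal_lt_eq_integral_gammaHead ha1 H.r_pos H.measV H.lawV hT (hB x hx)
    (H.indepV.comp (φ := id) (ψ := fun p : ℝ × ℝ × ℝ × ℝ =>
        γ * (p.1 * max t p.2.2.2) / (p.2.2.1 + max t p.2.2.2 / x) / x) measurable_id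
      (by fun_prop))
  have e3 := measureReal_lt_eq_integral_gammaHead le_rfl H.w_pos H.measW H.lawW
    (T := fun ω => max t (Q ω) * max 0 (γ * (U ω / V ω) - 1) / x) (by fun_prop)
    (Eventually.of_forall fun ω => div_nonneg (hE0 ω) hx.le)
    (H.indepW.comp (φ := id) (ψ := fun p : ℝ × ℝ × ℝ × ℝ =>
        max t p.2.2.2 * max 0 (γ * (p.2.1 / p.1) - 1) / x) measurable_id (by fun_prop))
  -- The same event, solved for W instead of V.
  have e4 : μ.real {ω | V ω < γ * (U ω * max t (Q ω)) / (W ω + max t (Q ω) / x) / x} =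
      μ.real {ω | W ω < max t (Q ω) * max 0 (γ * (U ω / V ω) - 1) / x} := by
    refine measureReal_congr ?_
    filter_upwards [H.ae_pos] with ω hω
    obtain ⟨hV, hU, hW⟩ := hω
    have hZ : 0 < max t (Q ω) := lt_max_of_lt_left ht
    refine propext ?_
    change V ω < γ * (U ω * max t (Q ω)) / (W ω + max t (Q ω) / x) / x ↔
      W ω < max t (Q ω) * max 0 (γ * (U ω / V ω) - 1) / x
    rw [lt_div_iff₀ hx, lt_div_iff₀ (by positivity), lt_div_iff₀ hx, mul_max_of_nonneg _ _ hZ.le,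
      lt_max_iff, mul_zero, or_iff_right (not_lt.2 (by positivity))]
    have e5 : V ω * x * (W ω + max t (Q ω) / x) = V ω * (W ω * x + max t (Q ω)) := by
      field_simp
    have e6 : γ * (U ω * max t (Q ω)) =
        V ω * (max t (Q ω) * (γ * (U ω / V ω) - 1) + max t (Q ω)) := by
      field_simp
      ring
    rw [e5, e6, mul_lt_mul_iff_right₀ hV, add_lt_add_iff_right]
  have e7 : ∀ ω, γ * (U ω * max t (Q ω)) / (W ω + max t (Q ω) / x) / x + κ * max s (P ω) / x =
      (κ * max s (P ω) + γ * (U ω * max t (Q ω)) / (W ω + max t (Q ω) / x)) / x := fun ω => by ring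
  simp only [e7, gammaHead_zero, sub_zero]
  rw [integral_sub (integrable_gammaHead_comp ha1 H.r_pos hT2 hT20)
    (integrable_gammaHead_comp ha1 H.r_pos hT (hB x hx)), ← e1, ← e2, e4, ← e3]
  ring

/-- If the legitimate and the jamming gain are exponential, the outage probability is of the order
of `log x / x`. -/
lemma tendsto_outage_of_exponential (H : JammedHop μ V U P W Q 1 r b l m k 1 w n j)
    (hs : 0 < s) (ht : 0 < t) (hγ : 0 < γ) (hκ : 0 ≤ κ) :
    Tendsto (fun x => x / Real.log x * μ.real {ω | V ω < (κ * max s (P ω) +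
        γ * (U ω * max t (Q ω)) / (W ω + max t (Q ω) / x)) / x}) atTop
      (𝓝 (w * (r * γ * (b / l * ∫ x, max t x ∂gammaMeasure n j)))) := by
  have := H.measU; have := H.measP; have := H.measW; have := H.measQ; have := H.measV
  have hr := H.r_pos
  have hF : Integrable (fun ω => r * γ * (U ω * max t (Q ω))) μ :=
    (H.integrable_U_mul_maxQ t).const_mul _
  have hFm : Measurable fun ω => r * γ * (U ω * max t (Q ω)) := by fun_prop
  have hG₁m : Measurable fun ω => max t (Q ω) := by fun_prop
  have hG₁ : ∀ᵐ ω ∂μ, t ≤ max t (Q ω) := Eventually.of_forall fun ω => le_max_left _ _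
  -- This shift comes from the lower bound 1 - e^(-y) ≥ y/(1 + y), where y is r/x times the jamming
  -- term; the bound has again the form F/(W + G/x).
  have hG₂m : Measurable fun ω => max t (Q ω) * (1 + r * γ * U ω) := by fun_prop
  have hG₂ : ∀ᵐ ω ∂μ, t ≤ max t (Q ω) * (1 + r * γ * U ω) := by
    filter_upwards [H.ae_pos] with ω hω
    have h1 : 0 ≤ r * γ * U ω := mul_nonneg (mul_nonneg hr.le hγ.le) hω.2.1.le
    calc t = t * 1 := (mul_one t).symm
      _ ≤ max t (Q ω) * (1 + r * γ * U ω) := by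
          gcongr
          · exact le_max_left _ _
          · linarith
  have hlim : ∫ ω, r * γ * (U ω * max t (Q ω)) ∂μ =
      r * γ * (b / l * ∫ x, max t x ∂gammaMeasure n j) := by
    rw [integral_const_mul, H.integral_U_mul_maxQ]
  have hlow := tendsto_integral_mul_shiftedInvMean H.w_pos ht hF hG₂m hG₂
  have hup := tendsto_integral_mul_shiftedInvMean H.w_pos ht hF hG₁m hG₁
  -- The noise term of the threshold contributes a bounded amount, which is negligible against log
  -- x.
  have hlog : Tendsto (fun x => r * (κ * ∫ ω, max s (P ω) ∂μ) / Real.log x) atTop (𝓝 0) :=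
    tendsto_const_nhds.div_atTop Real.tendsto_log_atTop
  have hup2 := hlog.add hup
  rw [zero_add] at hup2
  rw [hlim] at hlow hup2
  -- The exponential distribution function lies between y/(1 + y) and y. Both bounds have the same
  -- leading term, because the limit of `shiftedInvMean` over log x does not depend on the shift.
  have hmain : ∀ᶠ x : ℝ in atTop,
      (∫ ω, r * γ * (U ω * max t (Q ω)) *
          shiftedInvMean w (max t (Q ω) * (1 + r * γ * U ω) / x) ∂μ) ≤
        x * μ.real {ω | V ω < (κ * max s (P ω) +
          γ * (U ω * max t (Q ω)) / (W ω + max t (Q ω) / x)) / x} ∧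
      x * μ.real {ω | V ω < (κ * max s (P ω) +
          γ * (U ω * max t (Q ω)) / (W ω + max t (Q ω) / x)) / x} ≤
        r * (κ * ∫ ω, max s (P ω) ∂μ) +
          ∫ ω, r * γ * (U ω * max t (Q ω)) * shiftedInvMean w (max t (Q ω) / x) ∂μ := by
    filter_upwards [eventually_gt_atTop 0] with x hx
    obtain ⟨i1, e1⟩ := integral_div_shifted_eq H.w_pos ht hx H.measW H.lawW hFm hF hG₁m hG₁
      (H.indepW.comp (φ := id) (ψ := fun p : ℝ × ℝ × ℝ × ℝ =>
        (r * γ * (p.2.1 * max t p.2.2.2), max t p.2.2.2)) measurable_id (by fun_prop))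
    obtain ⟨i2, e2⟩ := integral_div_shifted_eq H.w_pos ht hx H.measW H.lawW hFm hF hG₂m hG₂
      (H.indepW.comp (φ := id) (ψ := fun p : ℝ × ℝ × ℝ × ℝ =>
        (r * γ * (p.2.1 * max t p.2.2.2), max t p.2.2.2 * (1 + r * γ * p.2.1)))
        measurable_id (by fun_prop))
    have hTm : Measurable fun ω => (κ * max s (P ω) +
        γ * (U ω * max t (Q ω)) / (W ω + max t (Q ω) / x)) / x := by fun_prop
    have hY : ∀ ω, 0 ≤ κ * max s (P ω) := fun ω => mul_nonneg hκ (le_max_of_le_left hs.le)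
    have hX : ∀ᵐ ω ∂μ, 0 ≤ γ * (U ω * max t (Q ω)) / (W ω + max t (Q ω) / x) := by
      filter_upwards [H.ae_pos] with ω hω
      obtain ⟨-, hU, hW⟩ := hω
      have hZ : 0 < max t (Q ω) := lt_max_of_lt_left ht
      positivity
    have hT0 : ∀ᵐ ω ∂μ, 0 ≤ (κ * max s (P ω) +
        γ * (U ω * max t (Q ω)) / (W ω + max t (Q ω) / x)) / x :=
      hX.mono fun ω hω => div_nonneg (add_nonneg (hY ω) hω) hx.le
    have e3 := measureReal_lt_eq_integral_gammaHead le_rfl hr H.measV H.lawV hTm hT0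
      (H.indepV.comp (φ := id) (ψ := fun p : ℝ × ℝ × ℝ × ℝ => (κ * max s p.2.1 +
        γ * (p.1 * max t p.2.2.2) / (p.2.2.1 + max t p.2.2.2 / x)) / x) measurable_id
        (by fun_prop))
    have i3 := integrable_gammaHead_comp le_rfl hr hTm hT0
    have iP : Integrable (fun ω => r * (κ * max s (P ω))) μ :=
      ((H.integrable_maxP s).const_mul κ).const_mul r
    rw [e3, ← integral_const_mul]
    constructor
    · rw [← e2]
      refine integral_mono_ae i2 (i3.const_mul x) ?_
      filter_upwards [H.ae_pos, hX] with ω hω hXω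
      obtain ⟨-, hU, hW⟩ := hω
      have hZ : 0 < max t (Q ω) := lt_max_of_lt_left ht
      simp only [gammaHead_one]
      set X := γ * (U ω * max t (Q ω)) / (W ω + max t (Q ω) / x) with hXdef
      have h1 : Real.exp (-(r * ((κ * max s (P ω) + X) / x))) ≤ 1 / (1 + r * (X / x)) := by
        have h2 : r * (X / x) ≤ r * ((κ * max s (P ω) + X) / x) := by
          gcongr
          linarith [hY ω]
        have h3 : 0 ≤ r * (X / x) := by positivity
        rw [Real.exp_neg, ← one_div]
        gcongr
        linarith [Real.add_one_le_exp (r * ((κ * max s (P ω) + X) / x))]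
      have h4 : r * γ * (U ω * max t (Q ω)) / (W ω + max t (Q ω) * (1 + r * γ * U ω) / x) =
          x * (1 - 1 / (1 + r * (X / x))) := by
        rw [hXdef]
        have : 0 < W ω + max t (Q ω) * (1 + r * γ * U ω) / x := by positivity
        have h5 : 0 < W ω + max t (Q ω) / x := by positivity
        have h6 : 1 + r * (γ * (U ω * max t (Q ω)) / (W ω + max t (Q ω) / x) / x) =
            (W ω + max t (Q ω) * (1 + r * γ * U ω) / x) / (W ω + max t (Q ω) / x) := by
          field_simp
          ring
        rw [h6, one_div_div, one_sub_div this.ne', mul_div_assoc']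
        congr 1
        field_simp
        ring
      rw [h4]
      gcongr
    · rw [← integral_const_mul κ, ← integral_const_mul r, ← e1, ← integral_add iP i1]
      refine integral_mono_ae (i3.const_mul x) (iP.add i1) ?_
      filter_upwards with ω
      simp only [gammaHead_one]
      have h1 := Real.add_one_le_exp (-(r * ((κ * max s (P ω) +
        γ * (U ω * max t (Q ω)) / (W ω + max t (Q ω) / x)) / x)))
      calc _ ≤ x * (r * ((κ * max s (P ω) +
            γ * (U ω * max t (Q ω)) / (W ω + max t (Q ω) / x)) / x)) := by
            gcongr
            linarith
        _ = _ := by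
            rw [mul_assoc r γ, mul_div_assoc r (γ * _)]
            field_simp
  refine tendsto_of_tendsto_of_tendsto_of_le_of_le' hlow hup2 ?_ ?_
  · filter_upwards [hmain, eventually_gt_atTop 1] with x hx hx1
    have hl := Real.log_pos hx1
    rw [div_mul_eq_mul_div]
    gcongr
    exact hx.1
  · filter_upwards [hmain, eventually_gt_atTop 1] with x hx hx1
    have hl := Real.log_pos hx1
    rw [div_mul_eq_mul_div, ← add_div]
    gcongr
    exact hx.2

end JammedHop

/-! ### The mean excess of a ratio of Gamma variables of integer shapes -/

lemma gammaDensity_natCast_add_one (p : ℕ) (l x : ℝ) :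
    gammaDensity (p + 1) l x =
      l ^ (p + 1) / Real.Gamma (p + 1) * x ^ p * Real.exp (-(l * x)) := by
  rw [gammaDensity, add_sub_cancel_right, Real.rpow_natCast,
    show ((p : ℝ) + 1) = ((p + 1 : ℕ) : ℝ) by push_cast; ring, Real.rpow_natCast]

lemma integral_pow_mul_exp_neg_mul (p : ℕ) {c : ℝ} (hc : 0 < c) :
    ∫ x in Set.Ioi 0, x ^ p * Real.exp (-(c * x)) = Real.Gamma (p + 1) / c ^ (p + 1) := by
  have h := Real.integral_rpow_mul_exp_neg_mul_Ioi (show (0 : ℝ) < (p + 1 : ℕ) by positivity) hc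
  rw [Real.rpow_natCast] at h
  have h2 : ((p + 1 : ℕ) : ℝ) - 1 = p := by push_cast; ring
  simp only [h2, Real.rpow_natCast] at h
  rw [h]
  push_cast
  rw [one_div, inv_pow]
  ring

lemma integrableOn_pow_mul_exp_neg_mul (p : ℕ) {c : ℝ} (hc : 0 < c) :
    IntegrableOn (fun x => x ^ p * Real.exp (-(c * x))) (Set.Ioi 0) := by
  have h := integrableOn_rpow_mul_exp_neg_mul (show (0 : ℝ) < (p + 1 : ℕ) by positivity) hc
  have h2 : ((p + 1 : ℕ) : ℝ) - 1 = p := by push_cast; ring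
  simpa only [h2, Real.rpow_natCast] using h

lemma integral_Ioi_eq_shift (f : ℝ → ℝ) (v : ℝ) :
    ∫ t in Set.Ioi v, f t = ∫ s in Set.Ioi 0, f (s + v) := by
  rw [← (measurePreserving_add_right volume v).setIntegral_preimage_emb
    (measurableEmbedding_addRight v) f (Set.Ioi v)]
  congr 2
  ext s
  simp

/-- The mean excess of a scaled Gamma variable of integer shape over a level. -/
lemma integral_excess_gammaMeasure (p : ℕ) {l γ v : ℝ} (hl : 0 < l) (hγ : 0 < γ) (hv : 0 < v) :
    ∫ u, max 0 (γ * (u / v) - 1) ∂gammaMeasure (p + 1) l =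
      ∑ h ∈ Finset.range (p + 1), l ^ (p + 1) / (Real.Gamma (p + 1) * γ ^ (p + 1)) *
        p.choose h * (Real.Gamma (h + 2) * (γ / l) ^ (h + 2)) * (v ^ (p - h) / v) *
          Real.exp (-(l / γ * v)) := by
  have hp : (0 : ℝ) < p + 1 := by positivity
  rw [integral_gammaMeasure hp hl]
  have hsub : Set.Ioi (v / γ) ⊆ Set.Ioi 0 := Set.Ioi_subset_Ioi (by positivity)
  rw [setIntegral_eq_of_subset_of_forall_sdiff_eq_zero measurableSet_Ioi hsub fun u hu => by
    have h1 : u ≤ v / γ := not_lt.1 hu.2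
    have h2 : γ * (u / v) ≤ 1 := by
      rw [← mul_div_assoc, div_le_one hv, mul_comm]
      exact (le_div_iff₀ hγ).1 h1
    rw [max_eq_left (by linarith), smul_zero]]
  -- Only u > v/γ counts. The substitution u = (s + v)/γ turns the excess into s/v, and the density
  -- then expands by the binomial formula for (s + v)^p.
  have e1 : v / γ = γ⁻¹ * v := by ring
  have e2 := integral_comp_mul_left_Ioi (fun u => gammaDensity (p + 1) l u • max 0 (γ * (u / v) - 1))
    v (inv_pos.2 hγ)
  rw [inv_inv, ← e1, smul_eq_mul] at e2
  rw [← mul_right_inj' hγ.ne', ← e2, integral_Ioi_eq_shift]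
  have e3 : ∀ s ∈ Set.Ioi (0 : ℝ), gammaDensity (p + 1) l (γ⁻¹ * (s + v)) •
      max 0 (γ * (γ⁻¹ * (s + v) / v) - 1) =
      ∑ h ∈ Finset.range (p + 1), l ^ (p + 1) / (Real.Gamma (p + 1) * γ ^ p) *
        p.choose h * (v ^ (p - h) / v) * Real.exp (-(l / γ * v)) *
          (s ^ (h + 1) * Real.exp (-(l / γ * s))) := fun s hs => by
    have hs0 : 0 < s := hs
    have h1 : γ * (γ⁻¹ * (s + v) / v) - 1 = s / v := by field_simp; ring
    have h2 : Real.exp (-(l * (γ⁻¹ * (s + v)))) =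
        Real.exp (-(l / γ * v)) * Real.exp (-(l / γ * s)) := by
      rw [← Real.exp_add]; congr 1; field_simp; ring
    rw [h1, max_eq_right (by positivity), smul_eq_mul, gammaDensity_natCast_add_one, h2, mul_pow,
      add_pow, Finset.mul_sum, Finset.mul_sum, Finset.sum_mul, Finset.sum_mul]
    refine Finset.sum_congr rfl fun h _ => ?_
    rw [inv_pow, pow_succ s h]
    field_simp
  rw [setIntegral_congr_fun measurableSet_Ioi e3, integral_finsetSum _ fun h _ =>
    (integrableOn_pow_mul_exp_neg_mul (h + 1) (div_pos hl hγ)).const_mul _, Finset.mul_sum]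
  refine Finset.sum_congr rfl fun h _ => ?_
  rw [integral_const_mul, integral_pow_mul_exp_neg_mul (h + 1) (div_pos hl hγ),
    show (((h + 1 : ℕ) : ℝ) + 1) = h + 2 by push_cast; ring]
  have := (Real.Gamma_pos_of_pos hp).ne'
  rw [div_pow, div_pow]
  field_simp
  ring

/-- The mean excess of U over V/γ is averaged over V. The two exponentials combine to the rate r +
l/γ = (γr + l)/γ, the origin of ϖ. The shape n + 2 of V absorbs the factor 1/v, so all exponents
stay natural numbers. -/
lemma integral_ratio_excess {Ω : Type*} [MeasurableSpace Ω] {μ : Measure Ω}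
    [IsProbabilityMeasure μ] {V U : Ω → ℝ} (n p : ℕ) {r l γ : ℝ} (hr : 0 < r) (hl : 0 < l)
    (hγ : 0 < γ) (hV : Measurable V) (hU : Measurable U)
    (hVl : μ.map V = gammaMeasure (n + 2) r) (hUl : μ.map U = gammaMeasure (p + 1) l)
    (hVU : IndepFun V U μ) (hint : Integrable (fun ω => max 0 (γ * (U ω / V ω) - 1)) μ) :
    ∫ ω, max 0 (γ * (U ω / V ω) - 1) ∂μ =
      γ ^ (n + 2) * (r ^ (n + 2) / (Real.Gamma (n + 2) * Real.Gamma (p + 1))) / l *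
        ∑ h ∈ Finset.range (p + 1), p.choose h * l ^ (p - h) *
          Real.Gamma ((n + (p - h) : ℕ) + 1) * Real.Gamma (h + 2) /
            (γ * r + l) ^ (n + (p - h) + 1) := by
  have hp : (0 : ℝ) < p + 1 := by positivity
  have hn : (0 : ℝ) < n + 2 := by positivity
  have := isProbabilityMeasure_gammaMeasure hp hl
  have := isProbabilityMeasure_gammaMeasure hn hr
  have hVUm : Measurable fun ω => (V ω, U ω) := hV.prodMk hU
  have hjoint := (indepFun_iff_map_prod_eq_prod_map_map hV.aemeasurable hU.aemeasurable).1 hVU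
  have hfm : Measurable fun q : ℝ × ℝ => max 0 (γ * (q.2 / q.1) - 1) := by fun_prop
  have h1 : ∫ ω, max 0 (γ * (U ω / V ω) - 1) ∂μ =
      ∫ q : ℝ × ℝ, max 0 (γ * (q.2 / q.1) - 1) ∂(μ.map fun ω => (V ω, U ω)) := by
    rw [integral_map hVUm.aemeasurable hfm.aestronglyMeasurable]
  have h2 : Integrable (fun q : ℝ × ℝ => max 0 (γ * (q.2 / q.1) - 1))
      (μ.map fun ω => (V ω, U ω)) := by
    rw [integrable_map_measure hfm.aestronglyMeasurable hVUm.aemeasurable]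
    exact hint
  rw [hjoint, hVl, hUl] at h1 h2
  rw [h1, integral_prod _ h2, integral_gammaMeasure hn hr]
  have hc : 0 < r + l / γ := by positivity
  have e1 : ∀ v ∈ Set.Ioi (0 : ℝ), gammaDensity (n + 2) r v •
      ∫ u, max 0 (γ * (u / v) - 1) ∂gammaMeasure (p + 1) l =
      ∑ h ∈ Finset.range (p + 1), r ^ (n + 2) / Real.Gamma (n + 2) *
        (l ^ (p + 1) / (Real.Gamma (p + 1) * γ ^ (p + 1)) *
        p.choose h * (Real.Gamma (h + 2) * (γ / l) ^ (h + 2))) *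
          (v ^ (n + (p - h)) * Real.exp (-((r + l / γ) * v))) := fun v hv => by
    have hv0 : 0 < v := hv
    have hd := gammaDensity_natCast_add_one (n + 1) r v
    rw [show (((n + 1 : ℕ) : ℝ) + 1) = n + 2 by push_cast; ring] at hd
    have h2 : Real.exp (-((r + l / γ) * v)) =
        Real.exp (-(r * v)) * Real.exp (-(l / γ * v)) := by
      rw [← Real.exp_add]; congr 1; ring
    rw [integral_excess_gammaMeasure p hl hγ hv0, smul_eq_mul, hd, h2, Finset.mul_sum]
    refine Finset.sum_congr rfl fun h _ => ?_
    rw [pow_add v n (p - h), pow_succ v n]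
    field_simp
  rw [setIntegral_congr_fun measurableSet_Ioi e1, integral_finsetSum _ fun h _ =>
    (integrableOn_pow_mul_exp_neg_mul _ hc).const_mul _, Finset.mul_sum]
  refine Finset.sum_congr rfl fun h hh => ?_
  obtain ⟨q, rfl⟩ := Nat.exists_eq_add_of_le (Nat.lt_succ_iff.1 (Finset.mem_range.1 hh))
  rw [integral_const_mul, integral_pow_mul_exp_neg_mul _ hc, Nat.add_sub_cancel_left]
  have h3 : r + l / γ = (γ * r + l) / γ := by field_simp
  have := (Real.Gamma_pos_of_pos hp).ne'
  have := (Real.Gamma_pos_of_pos hn).ne'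
  have : γ * r + l ≠ 0 := by positivity
  rw [h3, div_pow, div_pow]
  field_simp
  ring

/-! ### First order expansions -/

/-- `f = a + b e + o(e)` at infinity. -/
def HasExpansion (f : ℝ → ℝ) (a b : ℝ) (e : ℝ → ℝ) : Prop :=
  (fun x => f x - (a + e x * b)) =o[atTop] e

namespace HasExpansion

variable {f g e : ℝ → ℝ} {a b a' b' : ℝ}

lemma of_tendsto (he : ∀ᶠ x in atTop, e x ≠ 0)
    (h : Tendsto (fun x => (f x - a) / e x) atTop (𝓝 b)) : HasExpansion f a b e := by
  rw [HasExpansion, isLittleO_iff_tendsto' (he.mono fun x hx h0 => absurd h0 hx)]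
  have h2 := h.sub_const b
  rw [sub_self] at h2
  refine h2.congr' (he.mono fun x hx => ?_)
  field_simp
  ring

lemma isBigO_sub (h : HasExpansion f a b e) : (fun x => f x - a) =O[atTop] e := by
  have h2 : (fun x => e x * b) =O[atTop] e := by
    simpa [mul_comm] using (isBigO_refl e atTop).const_mul_left b
  refine (h.isBigO.add h2).congr_left fun x => ?_
  ring

/-- Both deviations from the constants are O(e), and their product is o(e) because e tends to 0. -/
lemma mul (he : Tendsto e atTop (𝓝 0)) (hf : HasExpansion f a b e) (hg : HasExpansion g a' b' e) :
    HasExpansion (fun x => f x * g x) (a * a') (a * b' + a' * b) e := by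
  have hee : (fun x => e x * e x) =o[atTop] e := by
    simpa using ((isLittleO_one_iff ℝ).2 he).mul_isBigO (isBigO_refl e atTop)
  have h1 : (fun x => (f x - a) * (g x - a')) =o[atTop] e :=
    (hf.isBigO_sub.mul hg.isBigO_sub).trans_isLittleO hee
  refine ((h1.add (hf.const_mul_left a')).add (hg.const_mul_left a)).congr_left fun x => ?_
  ring

lemma prod {ι : Type*} [DecidableEq ι] {f : ι → ℝ → ℝ} {a b : ι → ℝ} (he : Tendsto e atTop (𝓝 0))
    (s : Finset ι) (h : ∀ k ∈ s, HasExpansion (f k) (a k) (b k) e) :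
    HasExpansion (fun x => ∏ k ∈ s, f k x) (∏ k ∈ s, a k)
      (∑ k ∈ s, (∏ j ∈ s.erase k, a j) * b k) e := by
  induction s using Finset.induction_on with
  | empty => simp [HasExpansion]
  | insert i s hi ih =>
    have h1 := (h i (Finset.mem_insert_self i s)).mul he
      (ih fun k hk => h k (Finset.mem_insert_of_mem hk))
    simp only [Finset.prod_insert hi, Finset.sum_insert hi, Finset.erase_insert hi]
    have h2 : ∑ k ∈ s, (∏ j ∈ (insert i s).erase k, a j) * b k =
        a i * ∑ k ∈ s, (∏ j ∈ s.erase k, a j) * b k := by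
      rw [Finset.mul_sum]
      refine Finset.sum_congr rfl fun k hk => ?_
      have hik : i ≠ k := fun h => hi (h ▸ hk)
      rw [Finset.erase_insert_of_ne hik, Finset.prod_insert fun h => hi (Finset.mem_of_mem_erase h),
        mul_assoc]
    rw [h2, add_comm]
    exact h1

end HasExpansion

namespace Network

open Channel

variable {N M : ℕ} (S : Network N M)

/-! ### The laws of the total gains -/

section Gains

variable {Ω : Type*} [MeasurableSpace Ω] {μ : Measure Ω} {g : S.Branch → Ω → ℝ}

lemma measurable_gain (hg : S.IsNakagami μ g) (q : Channel N M) : Measurable (S.gain g q) := by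
  have := hg.measurable
  unfold gain
  fun_prop

lemma map_gain [IsProbabilityMeasure μ] (hg : S.IsNakagami μ g) (q : Channel N M) :
    μ.map (S.gain g q) = gammaMeasure (S.shape q) (S.lam q) :=
  map_sum_eq_gammaMeasure (S.antennas_pos q) (X := fun u => g ⟨q, u⟩) (S.m_pos q) (S.lam_pos q)
    (fun u => hg.measurable _) (fun u => hg.law ⟨q, u⟩)
    (hg.indep.precomp (g := fun u => (⟨q, u⟩ : S.Branch)) fun u v h => by simpa using h)

lemma shape_SP (i : Fin N) : S.shape (SP i) = S.m (SP i) := by simp [shape, antennas]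

lemma shape_RP : S.shape RP = S.m RP := by simp [shape, antennas]

/-- Disjoint sets of channels have disjoint sets of branches, and the branch gains are independent.
-/
lemma indepFun_gain (hg : S.IsNakagami μ g) {A B : Finset (Channel N M)} (h : Disjoint A B) :
    IndepFun (fun ω (q : A) => S.gain g q ω) (fun ω (q : B) => S.gain g q ω) μ := by
  have hd : Disjoint (A.sigma fun q => (Finset.univ : Finset (Fin (S.antennas q))))
      (B.sigma fun q => (Finset.univ : Finset (Fin (S.antennas q)))) := by
    rw [Finset.disjoint_left] at h ⊢
    intro b hb hb'
    exact h (Finset.mem_sigma.1 hb).1 (Finset.mem_sigma.1 hb').1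
  have hi := hg.indep.indepFun_finset _ _ hd hg.measurable
  exact hi.comp
    (φ := fun y (q : A) => ∑ u, y ⟨⟨q, u⟩, Finset.mem_sigma.2 ⟨q.2, Finset.mem_univ u⟩⟩)
    (ψ := fun y (q : B) => ∑ u, y ⟨⟨q, u⟩, Finset.mem_sigma.2 ⟨q.2, Finset.mem_univ u⟩⟩)
    (by fun_prop) (by fun_prop)

lemma indepFun_comp_gain (hg : S.IsNakagami μ g) (A B : Finset (Channel N M)) (h : Disjoint A B)
    {β β' : Type*} [MeasurableSpace β] [MeasurableSpace β'] (φ : (A → ℝ) → β) (ψ : (B → ℝ) → β')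
    (hφ : Measurable φ) (hψ : Measurable ψ) :
    IndepFun (fun ω => φ fun q => S.gain g q ω) (fun ω => ψ fun q => S.gain g q ω) μ :=
  (S.indepFun_gain hg h).comp hφ hψ

lemma ae_gain_pos [IsProbabilityMeasure μ] (hg : S.IsNakagami μ g) (q : Channel N M) :
    ∀ᵐ ω ∂μ, 0 < S.gain g q ω :=
  ae_pos_of_map_eq (S.measurable_gain hg q) (S.map_gain hg q)

open Classical in
lemma jammedHop [IsProbabilityMeasure μ] (hg : S.IsNakagami μ g) {i J : Fin N} (hJ : J ≠ i)
    (k : Fin M) :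
    JammedHop μ (S.gain g (SR i)) (S.gain g (SE i k)) (S.gain g (SP i)) (S.gain g (SE J k))
      (S.gain g (SP J)) (S.shape (SR i)) (S.lam (SR i)) (S.shape (SE i k)) (S.lam (SE i k))
      (S.m (SP i)) (S.lam (SP i)) (S.shape (SE J k)) (S.lam (SE J k)) (S.m (SP J))
      (S.lam (SP J)) where
  r_pos := S.lam_pos _
  b_pos := S.shape_pos _
  l_pos := S.lam_pos _
  m_pos := S.m_pos _
  k_pos := S.lam_pos _
  w_pos := S.lam_pos _
  n_pos := S.m_pos _
  j_pos := S.lam_pos _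
  measV := S.measurable_gain hg _
  measU := S.measurable_gain hg _
  measP := S.measurable_gain hg _
  measW := S.measurable_gain hg _
  measQ := S.measurable_gain hg _
  lawV := S.map_gain hg _
  lawU := S.map_gain hg _
  lawP := by rw [← S.shape_SP]; exact S.map_gain hg _
  lawW := S.map_gain hg _
  lawQ := by rw [← S.shape_SP]; exact S.map_gain hg _
  indepV := S.indepFun_comp_gain hg {SR i} {SE i k, SP i, SE J k, SP J} (by simp)
    (fun y => y ⟨SR i, by simp⟩)
    (fun y => (y ⟨SE i k, by simp⟩, y ⟨SP i, by simp⟩, y ⟨SE J k, by simp⟩,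
      y ⟨SP J, by simp⟩)) (by fun_prop) (by fun_prop)
  -- J ≠ i keeps the jamming link distinct from the wiretap link.
  indepW := S.indepFun_comp_gain hg {SE J k} {SR i, SE i k, SP i, SP J} (by simp [hJ])
    (fun y => y ⟨SE J k, by simp⟩)
    (fun y => (y ⟨SR i, by simp⟩, y ⟨SE i k, by simp⟩, y ⟨SP i, by simp⟩,
      y ⟨SP J, by simp⟩)) (by fun_prop) (by fun_prop)
  indepQ := S.indepFun_comp_gain hg {SP J} {SR i, SE i k} (by simp) (fun y => y ⟨SP J, by simp⟩)
    (fun y => (y ⟨SR i, by simp⟩, y ⟨SE i k, by simp⟩)) (by fun_prop) (by fun_prop)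

end Gains

/-! ### The secrecy events -/

lemma le_secrecyCapacity_iff {a b : ℝ} (ha : 0 ≤ a) (hb : 0 ≤ b) :
    S.Rs ≤ secrecyCapacity a b ↔ S.γ * (1 + b) ≤ 1 + a := by
  have hγ := S.one_lt_γ
  unfold secrecyCapacity
  split_ifs with h
  · rw [Real.le_logb_iff_rpow_le one_lt_two (by positivity), le_div_iff₀ (by linarith), γ]
  · refine iff_of_false (not_le.2 S.Rs_pos) fun h2 => ?_
    nlinarith

lemma measurable_secrecyCapacity : Measurable fun p : ℝ × ℝ => secrecyCapacity p.1 p.2 := by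
  unfold secrecyCapacity Real.logb
  exact Measurable.ite (measurableSet_lt measurable_snd measurable_fst) (by fun_prop)
    measurable_const

/-- Positivity of p matters: with p = 0 the convention x / 0 = 0 would make the minimum 0. Gains are
almost surely positive, so the events change only on null sets. -/
lemma min_div_div {x r p : ℝ} (hx : 0 < x) (hr : 0 < r) (hp : 0 < p) :
    min (x / r) (x / p) = x / max r p := by
  rcases le_total r p with h | h
  · rw [max_eq_right h, min_eq_right (by gcongr)]
  · rw [max_eq_left h, min_eq_left (by gcongr)]

lemma le_secrecyCapacity_hop_iff {x y u v : ℝ} (hx : 0 < x) (hy : 0 < y) (hu : 0 < u)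
    (hv : 0 < v) :
    S.Rs ≤ secrecyCapacity (x / y * v) (x / y * u) ↔ (S.γ - 1) * y / x + S.γ * u ≤ v := by
  rw [S.le_secrecyCapacity_iff (by positivity) (by positivity)]
  have h1 : S.γ * (1 + x / y * u) = 1 + x / y * ((S.γ - 1) * y / x + S.γ * u) := by
    field_simp
    ring
  rw [h1, add_le_add_iff_left, mul_le_mul_iff_right₀ (by positivity)]

lemma le_secrecyCapacity_jam_iff {x y z u v w : ℝ} (hx : 0 < x) (hy : 0 < y) (hz : 0 < z)
    (hu : 0 < u) (hv : 0 < v) (hw : 0 < w) :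
    S.Rs ≤ secrecyCapacity (x / y * v) (x / y * u / (x / z * w + 1)) ↔
      ¬ v < ((S.γ - 1) * y + S.γ * (u * z) / (w + z / x)) / x := by
  rw [S.le_secrecyCapacity_iff (by positivity) (by positivity), not_lt]
  have h0 : x / z * w + 1 = x / z * (w + z / x) := by field_simp
  have h2 : w + z / x ≠ 0 := by positivity
  have h1 : S.γ * (1 + x / y * u / (x / z * w + 1)) =
      1 + x / y * (((S.γ - 1) * y + S.γ * (u * z) / (w + z / x)) / x) := by
    rw [h0]
    generalize w + z / x = d at h2
    field_simp
    ring
  rw [h1, add_le_add_iff_left, mul_le_mul_iff_right₀ (by positivity)]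

section Events

variable {Ω : Type*} [MeasurableSpace Ω] {μ : Measure Ω} {g : S.Branch → Ω → ℝ}

-- The two hops involve disjoint sets of channels, hence are independent.
open Classical in
lemma measureReal_min_eq_mul (hg : S.IsNakagami μ g) (i : Fin N) (k : Fin M) (x : ℝ) :
    μ.real {ω | S.Rs ≤ min
      (secrecyCapacity (S.γR g i x ω) (S.γE1 g i k x ω))
      (secrecyCapacity (S.γD g x ω) (S.γE2 g k x ω))} =
    μ.real {ω | S.Rs ≤ secrecyCapacity (S.γR g i x ω) (S.γE1 g i k x ω)} *
      μ.real {ω | S.Rs ≤ secrecyCapacity (S.γD g x ω) (S.γE2 g k x ω)} := by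
  have hm := measurable_secrecyCapacity
  have h := S.indepFun_comp_gain hg {SR i, SE i k, SP i} {RD, RE k, RP} (by simp)
    (fun y => secrecyCapacity
      (min (x / S.σ i) (x / y ⟨SP i, by simp⟩) * y ⟨SR i, by simp⟩)
      (min (x / S.σ i) (x / y ⟨SP i, by simp⟩) * y ⟨SE i k, by simp⟩))
    (fun y => secrecyCapacity
      (min (x / S.δ) (x / y ⟨RP, by simp⟩) * y ⟨RD, by simp⟩)
      (min (x / S.δ) (x / y ⟨RP, by simp⟩) * y ⟨RE k, by simp⟩))
    (hm.comp (f := fun y => (_, _)) (by fun_prop)) (hm.comp (f := fun y => (_, _)) (by fun_prop))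
  have h2 := h.measure_inter_preimage_eq_mul (Set.Ici S.Rs) (Set.Ici S.Rs) measurableSet_Ici
    measurableSet_Ici
  simp only [measureReal_def, ← ENNReal.toReal_mul]
  congr 1
  refine Eq.trans ?_ h2
  congr 1
  ext ω
  exact le_min_iff (α := ℝ)

open Classical in
lemma measureReal_min_jam_eq_mul (hg : S.IsNakagami μ g) (i J : Fin N) (k : Fin M) (x : ℝ) :
    μ.real {ω | S.Rs ≤ min
      (secrecyCapacity (S.γR g i x ω) (S.γE1J g i k J x ω))
      (secrecyCapacity (S.γD g x ω) (S.γE2 g k x ω))} =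
    μ.real {ω | S.Rs ≤ secrecyCapacity (S.γR g i x ω) (S.γE1J g i k J x ω)} *
      μ.real {ω | S.Rs ≤ secrecyCapacity (S.γD g x ω) (S.γE2 g k x ω)} := by
  have hm := measurable_secrecyCapacity
  have h := S.indepFun_comp_gain hg {SR i, SE i k, SP i, SE J k, SP J} {RD, RE k, RP} (by simp)
    (fun y => secrecyCapacity
      (min (x / S.σ i) (x / y ⟨SP i, by simp⟩) * y ⟨SR i, by simp⟩)
      (min (x / S.σ i) (x / y ⟨SP i, by simp⟩) * y ⟨SE i k, by simp⟩ /
        (min (x / S.σ J) (x / y ⟨SP J, by simp⟩) * y ⟨SE J k, by simp⟩ + 1)))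
    (fun y => secrecyCapacity
      (min (x / S.δ) (x / y ⟨RP, by simp⟩) * y ⟨RD, by simp⟩)
      (min (x / S.δ) (x / y ⟨RP, by simp⟩) * y ⟨RE k, by simp⟩))
    (hm.comp (f := fun y => (_, _)) (by fun_prop)) (hm.comp (f := fun y => (_, _)) (by fun_prop))
  have h2 := h.measure_inter_preimage_eq_mul (Set.Ici S.Rs) (Set.Ici S.Rs) measurableSet_Ici
    measurableSet_Ici
  simp only [measureReal_def, ← ENNReal.toReal_mul]
  congr 1
  refine Eq.trans ?_ h2
  congr 1
  ext ω
  exact le_min_iff (α := ℝ)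

variable [IsProbabilityMeasure μ]

open Classical in
lemma hasExpansion_second_hop (hS : S.IntegerShapes) (hg : S.IsNakagami μ g) (k : Fin M) :
    HasExpansion (fun x => μ.real {ω | S.Rs ≤ secrecyCapacity (S.γD g x ω) (S.γE2 g k x ω)})
      (S.A2nd k) (S.A2nd' k) fun x => 1 / x := by
  have hc := S.shape_eq_one_or_two_le hS.2.2
  have hγ := S.one_lt_γ
  refine HasExpansion.of_tendsto ((eventually_gt_atTop 0).mono fun x hx => by positivity) ?_
  have h := tendsto_hop (μ := μ) (V := S.gain g RD) (U := S.gain g (RE k)) (P := S.gain g RP)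
    hc (S.lam_pos RD) (S.m_pos RP) (S.lam_pos RP) (show 0 < S.γ by linarith)
    (show 0 ≤ S.γ - 1 by linarith) S.δ_pos (S.measurable_gain hg _) (S.measurable_gain hg _)
    (S.measurable_gain hg _) (S.map_gain hg _) (S.map_gain hg _)
    (by rw [← S.shape_RP]; exact S.map_gain hg _)
    (S.indepFun_comp_gain hg {RD} {RE k, RP} (by simp) (fun y => y ⟨RD, by simp⟩)
      (fun y => (y ⟨RE k, by simp⟩, y ⟨RP, by simp⟩))
      (by fun_prop) (by fun_prop))
    (S.indepFun_comp_gain hg {RE k} {RP} (by simp) (fun y => y ⟨RE k, by simp⟩)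
      (fun y => y ⟨RP, by simp⟩)
      (by fun_prop) (by fun_prop))
  rw [← S.A_one (RE k) RD (by rcases hc with h | h <;> linarith),
    ← S.A'_eq (RE k) RD RP S.δ_pos hc] at h
  refine h.congr' ?_
  filter_upwards [eventually_gt_atTop 0] with x hx
  have : μ.real {ω | (S.γ - 1) * max S.δ (S.gain g RP ω) / x + S.γ * S.gain g (RE k) ω ≤
      S.gain g RD ω} = μ.real {ω | S.Rs ≤ secrecyCapacity (S.γD g x ω) (S.γE2 g k x ω)} := by
    refine measureReal_congr ?_
    filter_upwards [S.ae_gain_pos hg RD, S.ae_gain_pos hg (RE k), S.ae_gain_pos hg RP]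
      with ω h1 h2 h3
    refine propext (Iff.symm ?_)
    change S.Rs ≤ secrecyCapacity (min (x / S.δ) (x / S.gain g RP ω) * S.gain g RD ω)
      (min (x / S.δ) (x / S.gain g RP ω) * S.gain g (RE k) ω) ↔ _
    rw [min_div_div hx S.δ_pos h3]
    exact S.le_secrecyCapacity_hop_iff hx (lt_max_of_lt_left S.δ_pos) h2 h1
  rw [this, A2nd]
  field_simp

open Classical in
lemma hasExpansion_first_hop (hS : S.IntegerShapes) (hg : S.IsNakagami μ g) (i : Fin N)
    (k : Fin M) :
    HasExpansion (fun x => μ.real {ω | S.Rs ≤ secrecyCapacity (S.γR g i x ω) (S.γE1 g i k x ω)})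
      (S.A1st i k) (S.A1st' i k) fun x => 1 / x := by
  have hc := S.shape_eq_one_or_two_le (hS.1 i)
  have hγ := S.one_lt_γ
  refine HasExpansion.of_tendsto ((eventually_gt_atTop 0).mono fun x hx => by positivity) ?_
  have h := tendsto_hop (μ := μ) (V := S.gain g (SR i)) (U := S.gain g (SE i k))
    (P := S.gain g (SP i))
    hc (S.lam_pos (SR i)) (S.m_pos (SP i)) (S.lam_pos (SP i)) (show 0 < S.γ by linarith)
    (show 0 ≤ S.γ - 1 by linarith) (S.σ_pos i) (S.measurable_gain hg _) (S.measurable_gain hg _)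
    (S.measurable_gain hg _) (S.map_gain hg _) (S.map_gain hg _)
    (by rw [← S.shape_SP]; exact S.map_gain hg _)
    (S.indepFun_comp_gain hg {SR i} {SE i k, SP i} (by simp) (fun y => y ⟨SR i, by simp⟩)
      (fun y => (y ⟨SE i k, by simp⟩, y ⟨SP i, by simp⟩))
      (by fun_prop) (by fun_prop))
    (S.indepFun_comp_gain hg {SE i k} {SP i} (by simp) (fun y => y ⟨SE i k, by simp⟩)
      (fun y => y ⟨SP i, by simp⟩)
      (by fun_prop) (by fun_prop))
  rw [← S.A_one (SE i k) (SR i) (by rcases hc with h | h <;> linarith),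
    ← S.A'_eq (SE i k) (SR i) (SP i) (S.σ_pos i) hc] at h
  refine h.congr' ?_
  filter_upwards [eventually_gt_atTop 0] with x hx
  have : μ.real {ω | (S.γ - 1) * max (S.σ i) (S.gain g (SP i) ω) / x +
      S.γ * S.gain g (SE i k) ω ≤ S.gain g (SR i) ω} =
      μ.real {ω | S.Rs ≤ secrecyCapacity (S.γR g i x ω) (S.γE1 g i k x ω)} := by
    refine measureReal_congr ?_
    filter_upwards [S.ae_gain_pos hg (SR i), S.ae_gain_pos hg (SE i k), S.ae_gain_pos hg (SP i)]
      with ω h1 h2 h3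
    refine propext (Iff.symm ?_)
    change S.Rs ≤ secrecyCapacity (min (x / S.σ i) (x / S.gain g (SP i) ω) * S.gain g (SR i) ω)
      (min (x / S.σ i) (x / S.gain g (SP i) ω) * S.gain g (SE i k) ω) ↔ _
    rw [min_div_div hx (S.σ_pos i) h3]
    exact S.le_secrecyCapacity_hop_iff hx (lt_max_of_lt_left (S.σ_pos i)) h2 h1
  rw [this, A1st]
  field_simp

/-- The outage event of the jammed hop, up to a null set. -/
lemma measureReal_jam_eq_one_sub (hg : S.IsNakagami μ g) (i J : Fin N) (k : Fin M) {x : ℝ}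
    (hx : 0 < x) :
    μ.real {ω | S.Rs ≤ secrecyCapacity (S.γR g i x ω) (S.γE1J g i k J x ω)} =
      1 - μ.real {ω | S.gain g (SR i) ω < ((S.γ - 1) * max (S.σ i) (S.gain g (SP i) ω) +
        S.γ * (S.gain g (SE i k) ω * max (S.σ J) (S.gain g (SP J) ω)) /
          (S.gain g (SE J k) ω + max (S.σ J) (S.gain g (SP J) ω) / x)) / x} := by
  have hm := fun q => S.measurable_gain hg q
  rw [← probReal_compl_eq_one_sub (measurableSet_lt (by fun_prop) (by fun_prop))]
  refine measureReal_congr ?_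
  filter_upwards [S.ae_gain_pos hg (SR i), S.ae_gain_pos hg (SE i k), S.ae_gain_pos hg (SP i),
    S.ae_gain_pos hg (SE J k), S.ae_gain_pos hg (SP J)] with ω h1 h2 h3 h4 h5
  refine propext ?_
  change S.Rs ≤ secrecyCapacity (min (x / S.σ i) (x / S.gain g (SP i) ω) * S.gain g (SR i) ω)
    (min (x / S.σ i) (x / S.gain g (SP i) ω) * S.gain g (SE i k) ω /
      (min (x / S.σ J) (x / S.gain g (SP J) ω) * S.gain g (SE J k) ω + 1)) ↔ ¬ _
  rw [min_div_div hx (S.σ_pos i) h3, min_div_div hx (S.σ_pos J) h5]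
  exact S.le_secrecyCapacity_jam_iff hx (lt_max_of_lt_left (S.σ_pos i))
    (lt_max_of_lt_left (S.σ_pos J)) h2 h1 h4

end Events

end Network

namespace Network

open Channel

variable {N M : ℕ} (S : Network N M)

/-! ### The constants of the jammed hop -/

lemma srcFactor_zero (i : Fin N) : S.srcFactor i 0 = Real.Gamma (S.m (SP i)) := by
  have h := lowerGamma_add_upperGamma (S.m_pos (SP i))
    (mul_pos (S.lam_pos (SP i)) (S.σ_pos i)).le
  simpa [srcFactor, φ] using h

/-- The factors 𝒫 vanish for shapes above 1, so the constants 𝒞 matter only in cases where just the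
powers 0 and 1 of these factors occur; power 1 gives a mean of a maximum. -/
lemma srcFactor_one (i : Fin N) : S.srcFactor i 1 = Real.Gamma (S.m (SP i)) *
    ∫ x, max (S.σ i) x ∂gammaMeasure (S.m (SP i)) (S.lam (SP i)) := by
  have := (Real.Gamma_pos_of_pos (S.m_pos (SP i))).ne'
  rw [integral_max_gammaMeasure (S.m_pos _) (S.lam_pos _) (S.σ_pos i), srcFactor, φ]
  simp only [pow_one, Nat.cast_one]
  field_simp

lemma jamFactor_one (i : Fin N) (k : Fin M) (J : Fin N) :
    S.jamFactor i k J 1 = S.lam (SE J k) / S.lam (SE i k) * (Real.Gamma (S.m (SP J)) *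
      ∫ x, max (S.σ J) x ∂gammaMeasure (S.m (SP J)) (S.lam (SP J))) := by
  have := (S.lam_pos (SP J)).ne'
  have := (S.lam_pos (SE i k)).ne'
  rw [← srcFactor_one, jamFactor, srcFactor, ς]
  simp only [pow_one, Nat.cast_one]
  field_simp

lemma shapeNat_eq {q : Channel N M} {n : ℕ} (h : S.shape q = n) : S.shapeNat q = n := by
  rw [shapeNat, h, Nat.floor_natCast]

lemma P_of_shape_eq_one {q : Channel N M} (h : S.shape q = 1) : S.P q = 1 := by
  simp [P, h]

lemma P_of_one_lt_shape {q : Channel N M} (h : 1 < S.shape q) : S.P q = 0 := by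
  rw [P, Real.sign_of_pos (by linarith), sub_self]

/-- For ℓ = 1 the sum has the single term l = 0, which brings the constant into the form of the
limit in `tendsto_outage_of_one_lt`. -/
lemma C₁_of_shape_eq_one {i J : Fin N} (k : Fin M) (h : S.shape (SR i) = 1) :
    S.C₁ i k J = S.lam (SR i) *
      ((S.γ - 1) * (∫ x, max (S.σ i) x ∂gammaMeasure (S.m (SP i)) (S.lam (SP i))) +
        S.γ * (S.shape (SE i k) / S.lam (SE i k) *
          (∫ x, max (S.σ J) x ∂gammaMeasure (S.m (SP J)) (S.lam (SP J))) *
          (S.lam (SE J k) * Real.Gamma (S.shape (SE J k) - 1) /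
            Real.Gamma (S.shape (SE J k))))) := by
  have hn : S.shapeNat (SR i) = 1 := S.shapeNat_eq (by simpa using h)
  have := (Real.Gamma_pos_of_pos (S.m_pos (SP i))).ne'
  have := (Real.Gamma_pos_of_pos (S.m_pos (SP J))).ne'
  have hb := (S.shape_pos (SE i k)).ne'
  have := (Real.Gamma_pos_of_pos (S.shape_pos (SE i k))).ne'
  have := (Real.Gamma_pos_of_pos (S.shape_pos (SE J k))).ne'
  have := (S.lam_pos (SE i k)).ne'
  simp only [C₁, α, Υ, hn, h, ξ, Finset.sum_range_one, Nat.sub_self, Nat.sub_zero,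
    Nat.choose_self, pow_zero, pow_one, Nat.cast_zero, Nat.cast_one, sub_zero, add_zero, zero_add,
    Real.Gamma_one, srcFactor_one, srcFactor_zero, jamFactor_one, Real.Gamma_add_one hb]
  field_simp

lemma C₂_of_shape_eq_one {i J : Fin N} {k : Fin M} (n p : ℕ) (hc : S.shape (SE J k) = 1)
    (ha : S.shape (SR i) = n + 2) (hb : S.shape (SE i k) = p + 1) :
    S.C₂ i k J = S.lam (SE J k) *
      ((∫ x, max (S.σ J) x ∂gammaMeasure (S.m (SP J)) (S.lam (SP J))) *
        (S.γ ^ (n + 2) * (S.lam (SR i) ^ (n + 2) / (Real.Gamma (n + 2) * Real.Gamma (p + 1))) /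
            S.lam (SE i k) *
          ∑ h ∈ Finset.range (p + 1), p.choose h * S.lam (SE i k) ^ (p - h) *
            Real.Gamma ((n + (p - h) : ℕ) + 1) * Real.Gamma (h + 2) /
              (S.γ * S.lam (SR i) + S.lam (SE i k)) ^ (n + (p - h) + 1))) := by
  have hcn : S.shapeNat (SE J k) = 1 := S.shapeNat_eq (by simpa using hc)
  have han : S.shapeNat (SR i) = n + 2 := S.shapeNat_eq (by simpa using ha)
  have hbn : S.shapeNat (SE i k) = p + 1 := S.shapeNat_eq (by simpa using hb)
  have hsum : ∑ h ∈ Finset.range (p + 1), S.Ωc i k h *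
        Real.Gamma (S.shape (SE i k) + S.shape (SR i) - S.shape (SE J k) - h - 1) *
        Real.Gamma (S.shape (SE J k) + h + 1) /
        S.ϖ i k ^ (S.shape (SE i k) + S.shape (SR i) - S.shape (SE J k) - h - 1) =
      ∑ h ∈ Finset.range (p + 1), p.choose h * S.lam (SE i k) ^ (p - h) *
            Real.Gamma ((n + (p - h) : ℕ) + 1) * Real.Gamma (h + 2) /
              (S.γ * S.lam (SR i) + S.lam (SE i k)) ^ (n + (p - h) + 1) := by
    refine Finset.sum_congr rfl fun h hh => ?_
    -- Writing p = h + q removes the truncated subtractions and makes the real exponent of ϖ a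
    -- natural number.
    obtain ⟨q, rfl⟩ := Nat.exists_eq_add_of_le (Nat.lt_succ_iff.1 (Finset.mem_range.1 hh))
    have h1 : S.shape (SE i k) + S.shape (SR i) - S.shape (SE J k) - h - 1 =
        ((n + q + 1 : ℕ) : ℝ) := by
      rw [ha, hb, hc]
      push_cast
      ring
    rw [h1, Real.rpow_natCast, hc, Ωc, hbn, ϖ, Nat.add_sub_cancel_left,
      show h + q + 1 - h - 1 = q by omega, Nat.add_sub_cancel,
      show (1 : ℝ) + h + 1 = h + 2 by ring, Nat.cast_add_one]
  have := (Real.Gamma_pos_of_pos (S.m_pos (SP J))).ne'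
  rw [C₂, hbn, hsum, α, hcn, han, hc, ha, hb, jamFactor_one, Real.Gamma_one]
  generalize ∑ h ∈ Finset.range (p + 1), (_ : ℝ) = s
  field_simp

lemma C₃_of_shape_eq_one {i J : Fin N} {k : Fin M} (ha : S.shape (SR i) = 1)
    (hc : S.shape (SE J k) = 1) :
    S.C₃ i k J = S.lam (SE J k) * (S.lam (SR i) * S.γ * (S.shape (SE i k) / S.lam (SE i k) *
      ∫ x, max (S.σ J) x ∂gammaMeasure (S.m (SP J)) (S.lam (SP J)))) := by
  have hcn : S.shapeNat (SE J k) = 1 := S.shapeNat_eq (by simpa using hc)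
  have han : S.shapeNat (SR i) = 1 := S.shapeNat_eq (by simpa using ha)
  have := (Real.Gamma_pos_of_pos (S.m_pos (SP J))).ne'
  have hb := (S.shape_pos (SE i k)).ne'
  have := (Real.Gamma_pos_of_pos (S.shape_pos (SE i k))).ne'
  rw [C₃, α, hcn, han, hc, ha, jamFactor_one, Real.Gamma_one, Real.Gamma_add_one hb]
  simp only [sub_self, Real.rpow_zero, zpow_zero, pow_one]
  field_simp

/-! ### Expansion of the jammed hop -/

lemma isLittleO_one_div_log_div :
    (fun x : ℝ => 1 / x) =o[atTop] fun x : ℝ => Real.log x / x := by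
  have h : (fun _ : ℝ => (1 : ℝ)) =o[atTop] Real.log :=
    isLittleO_const_left.2 (Or.inr (tendsto_norm_atTop_atTop.comp Real.tendsto_log_atTop))
  simpa [div_eq_mul_inv] using h.mul_isBigO (isBigO_refl (fun x : ℝ => x⁻¹) atTop)

lemma tendsto_one_div_atTop : Tendsto (fun x : ℝ => 1 / x) atTop (𝓝 0) :=
  tendsto_const_nhds.div_atTop tendsto_id

lemma tendsto_log_div_atTop : Tendsto (fun x : ℝ => Real.log x / x) atTop (𝓝 0) :=
  Real.isLittleO_log_id_atTop.tendsto_div_nhds_zero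
section Jammed

variable {Ω : Type*} [MeasurableSpace Ω] {μ : Measure Ω} {g : S.Branch → Ω → ℝ}

/-- The expansion of `SOP^(i,J)` from expansions of the jammed hop and of the second hop. -/
lemma hasExpansion_sopJ (hg : S.IsNakagami μ g) (i J : Fin N) {e : ℝ → ℝ} {b b' : Fin M → ℝ}
    (he : Tendsto e atTop (𝓝 0))
    (h₁ : ∀ k, HasExpansion
      (fun x => μ.real {ω | S.Rs ≤ secrecyCapacity (S.γR g i x ω) (S.γE1J g i k J x ω)})
      1 (b k) e)
    (h₂ : ∀ k, HasExpansion
      (fun x => μ.real {ω | S.Rs ≤ secrecyCapacity (S.γD g x ω) (S.γE2 g k x ω)})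
      (S.A2nd k) (b' k) e) :
    (fun x => S.sopJ g μ i J x - (1 - ∏ k, S.A2nd k -
      e x * ∑ k, (∏ j ∈ Finset.univ.erase k, S.A2nd j) * (b' k + S.A2nd k * b k))) =o[atTop] e := by
  have h := HasExpansion.prod he Finset.univ fun k _ => (h₁ k).mul he (h₂ k)
  simp only [one_mul] at h
  refine h.neg_left.congr_left fun x => ?_
  rw [sopJ, Finset.prod_congr rfl fun k _ => S.measureReal_min_jam_eq_mul hg i J k x]
  ring

variable [IsProbabilityMeasure μ]

lemma hasExpansion_jam_of_tendsto (hg : S.IsNakagami μ g) (i J : Fin N) (k : Fin M)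
    {f e : ℝ → ℝ} {L : ℝ} (he : ∀ᶠ x in atTop, e x ≠ 0) (hf : ∀ x, f x = (e x)⁻¹)
    (h : Tendsto (fun x => f x *
      μ.real {ω | S.gain g (SR i) ω < ((S.γ - 1) * max (S.σ i) (S.gain g (SP i) ω) +
        S.γ * (S.gain g (SE i k) ω * max (S.σ J) (S.gain g (SP J) ω)) /
          (S.gain g (SE J k) ω + max (S.σ J) (S.gain g (SP J) ω) / x)) / x}) atTop (𝓝 L)) :
    HasExpansion
      (fun x => μ.real {ω | S.Rs ≤ secrecyCapacity (S.γR g i x ω) (S.γE1J g i k J x ω)})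
      1 (-L) e := by
  refine HasExpansion.of_tendsto he (h.neg.congr' ?_)
  filter_upwards [eventually_gt_atTop 0] with x hx
  rw [S.measureReal_jam_eq_one_sub hg i J k hx, hf]
  ring

/-- This covers the first and the fourth regime, and the part of the second where the jamming shape
exceeds 1: the coefficient is nonzero only if the legitimate shape is 1. -/
lemma hasExpansion_jam_of_one_lt (hS : S.IntegerShapes) (hg : S.IsNakagami μ g) {i J : Fin N}
    (hJ : J ≠ i) (k : Fin M) (hc : 1 < S.shape (SE J k)) :
    HasExpansion
      (fun x => μ.real {ω | S.Rs ≤ secrecyCapacity (S.γR g i x ω) (S.γE1J g i k J x ω)})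
      1 (-(S.P (SR i) * S.C₁ i k J)) fun x => 1 / x := by
  have hγ := S.one_lt_γ
  have ha := S.shape_eq_one_or_two_le (hS.1 i)
  have h := (S.jammedHop hg hJ k).tendsto_outage_of_one_lt (κ := S.γ - 1) ha hc (S.σ_pos i)
    (S.σ_pos J) (show 0 < S.γ by linarith) (by linarith)
  refine S.hasExpansion_jam_of_tendsto hg i J k (f := fun x => x)
    ((eventually_gt_atTop 0).mono fun x hx => by positivity) (fun x => by simp) ?_
  convert h using 2
  rcases ha with ha | ha
  · rw [S.P_of_shape_eq_one ha, S.C₁_of_shape_eq_one k ha, ha, gammaDensity_one]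
    simp
  · rw [S.P_of_one_lt_shape (by linarith), gammaDensity_zero _ (by linarith), zero_mul, zero_mul]

lemma hasExpansion_jam_of_lt (hS : S.IntegerShapes) (hg : S.IsNakagami μ g) {i J : Fin N}
    (hJ : J ≠ i) (k : Fin M) (hca : S.shape (SE J k) < S.shape (SR i)) :
    HasExpansion
      (fun x => μ.real {ω | S.Rs ≤ secrecyCapacity (S.γR g i x ω) (S.γE1J g i k J x ω)})
      1 (-(S.P (SE J k) * S.C₂ i k J)) fun x => 1 / x := by
  have hγ := S.one_lt_γ
  rcases S.shape_eq_one_or_two_le (hS.2.1 J k) with hc | hc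
  · have ha : 2 ≤ S.shape (SR i) := by
      rcases S.shape_eq_one_or_two_le (hS.1 i) with h | h
      · linarith
      · exact h
    have H := S.jammedHop hg hJ k
    have hE := H.integrable_ratio_excess (by linarith) S.γ
    have hVU : IndepFun (S.gain g (SR i)) (S.gain g (SE i k)) μ :=
      H.indepV.comp (φ := id) (ψ := fun p : ℝ × ℝ × ℝ × ℝ => p.1) measurable_id (by fun_prop)
    have H' := H
    rw [hc] at H'
    have h := H'.tendsto_outage_of_exponential_jammer (κ := S.γ - 1) ha (S.σ_pos i)
      (S.σ_pos J) (show 0 < S.γ by linarith) (by linarith)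
    refine S.hasExpansion_jam_of_tendsto hg i J k (f := fun x => x)
      ((eventually_gt_atTop 0).mono fun x hx => by positivity) (fun x => by simp) ?_
    obtain ⟨a, han⟩ := hS.1 i
    obtain ⟨b, hbn⟩ := hS.2.1 i k
    have hb := S.shape_pos (SE i k)
    rw [hbn, Nat.cast_pos] at hb
    rw [han, Nat.ofNat_le_cast] at ha
    obtain ⟨n, rfl⟩ := Nat.exists_eq_add_of_le' ha
    obtain ⟨p, rfl⟩ := Nat.exists_eq_add_of_le' hb
    push_cast at han hbn
    rw [integral_ratio_excess n p (S.lam_pos _) (S.lam_pos _) (by linarith) H.measV H.measU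
      (han ▸ H.lawV) (hbn ▸ H.lawU) hVU hE, ← S.C₂_of_shape_eq_one n p hc han hbn] at h
    rwa [S.P_of_shape_eq_one hc, one_mul]
  -- Both shapes exceed 1, so both factors 𝒫 vanish and the 1/x term is 0 in either form.
  · have h := S.hasExpansion_jam_of_one_lt hS hg hJ k (by linarith)
    rwa [S.P_of_one_lt_shape (by linarith), zero_mul] at h ⊢

lemma hasExpansion_jam_of_exponential (hg : S.IsNakagami μ g) {i J : Fin N}
    (hJ : J ≠ i) (k : Fin M) (ha : S.shape (SR i) = 1) (hc : S.shape (SE J k) = 1) :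
    HasExpansion
      (fun x => μ.real {ω | S.Rs ≤ secrecyCapacity (S.γR g i x ω) (S.γE1J g i k J x ω)})
      1 (-S.C₃ i k J) fun x => Real.log x / x := by
  have hγ := S.one_lt_γ
  have H := S.jammedHop hg hJ k
  rw [hc, ha] at H
  have h := H.tendsto_outage_of_exponential (κ := S.γ - 1) (S.σ_pos i)
    (S.σ_pos J) (show 0 < S.γ by linarith) (by linarith)
  rw [← S.C₃_of_shape_eq_one ha hc] at h
  refine S.hasExpansion_jam_of_tendsto hg i J k ?_ (fun x => by simp) h
  filter_upwards [eventually_gt_atTop 1] with x hx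
  exact div_ne_zero (Real.log_pos hx).ne' (by linarith)

/-- On the scale log x / x the 1/x correction of the second hop is invisible. -/
lemma hasExpansion_second_hop_log (hS : S.IntegerShapes) (hg : S.IsNakagami μ g) (k : Fin M) :
    HasExpansion (fun x => μ.real {ω | S.Rs ≤ secrecyCapacity (S.γD g x ω) (S.γE2 g k x ω)})
      (S.A2nd k) 0 fun x => Real.log x / x := by
  have h := (S.hasExpansion_second_hop hS hg k).isBigO_sub.trans_isLittleO
    isLittleO_one_div_log_div
  simpa [HasExpansion] using h

end Jammed

end Network

/-! ### Assembly of the expansions -/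

theorem theorem2 {N M : ℕ} (S : Network N M) (hS : S.IntegerShapes)
    {Ω : Type*} [MeasurableSpace Ω] (μ : Measure Ω) [IsProbabilityMeasure μ]
    (g : S.Branch → Ω → ℝ) (hg : S.IsNakagami μ g) (i : Fin N) :
    -- absence of a jammer
    ((fun x : ℝ => S.sop g μ i x -
        (1 - ∏ k, S.A2nd k * S.A1st i k
          - 1 / x * ∑ k, (∏ j ∈ Finset.univ.erase k, S.A2nd j * S.A1st i j) *
              (S.A2nd k * S.A1st' i k + S.A1st i k * S.A2nd' k)))
      =o[atTop] fun x : ℝ => 1 / x) ∧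
    -- presence of the jammer `S_J`
    (∀ J : Fin N, J ≠ i →
      ((∀ k, S.shape (Channel.SR i) < S.shape (Channel.SE J k)) →
        (fun x : ℝ => S.sopJ g μ i J x -
          (1 - ∏ k, S.A2nd k
            - 1 / x * ∑ k, (∏ j ∈ Finset.univ.erase k, S.A2nd j) *
                (S.A2nd' k - S.A2nd k * S.P (Channel.SR i) * S.C₁ i k J)))
        =o[atTop] fun x : ℝ => 1 / x) ∧
      ((∀ k, S.shape (Channel.SE J k) < S.shape (Channel.SR i)) →
        (fun x : ℝ => S.sopJ g μ i J x -
          (1 - ∏ k, S.A2nd k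
            - 1 / x * ∑ k, (∏ j ∈ Finset.univ.erase k, S.A2nd j) *
                (S.A2nd' k - S.A2nd k * S.P (Channel.SE J k) * S.C₂ i k J)))
        =o[atTop] fun x : ℝ => 1 / x) ∧
      ((∀ k, S.shape (Channel.SR i) = S.shape (Channel.SE J k) ∧
          S.shape (Channel.SE J k) = 1) →
        (fun x : ℝ => S.sopJ g μ i J x -
          (1 - ∏ k, S.A2nd k
            + Real.log x / x * ∑ k, (∏ j ∈ Finset.univ.erase k, S.A2nd j) *
                (S.A2nd k * S.C₃ i k J)))
        =o[atTop] fun x : ℝ => Real.log x / x) ∧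
      ((∀ k, S.shape (Channel.SR i) = S.shape (Channel.SE J k) ∧
          1 < S.shape (Channel.SE J k)) →
        (fun x : ℝ => S.sopJ g μ i J x -
          (1 - ∏ k, S.A2nd k
            - 1 / x * ∑ k, (∏ j ∈ Finset.univ.erase k, S.A2nd j) * S.A2nd' k))
        =o[atTop] fun x : ℝ => 1 / x)) := by
  refine ⟨?_, fun J hJ => ⟨fun h => ?_, fun h => ?_, fun h => ?_, fun h => ?_⟩⟩
  · have he := Network.tendsto_one_div_atTop
    have h := HasExpansion.prod he Finset.univ fun k _ =>
      (S.hasExpansion_second_hop hS hg k).mul he (S.hasExpansion_first_hop hS hg i k)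
    refine h.neg_left.congr_left fun x => ?_
    rw [Network.sop, Finset.prod_congr rfl fun k _ => S.measureReal_min_eq_mul hg i k x,
      Finset.prod_congr rfl fun k _ => mul_comm (μ.real _) (μ.real _)]
    ring
  -- Integer shapes are at least 1, so a strictly larger jamming shape exceeds 1.
  · have hc : ∀ k, 1 < S.shape (Channel.SE J k) := fun k => by
      rcases S.shape_eq_one_or_two_le (hS.1 i) with ha | ha <;> linarith [h k]
    refine (S.hasExpansion_sopJ hg i J Network.tendsto_one_div_atTop
      (fun k => S.hasExpansion_jam_of_one_lt hS hg hJ k (hc k))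
      (S.hasExpansion_second_hop hS hg)).congr_left fun x => ?_
    simp only [mul_neg, ← sub_eq_add_neg, mul_assoc]
  · refine (S.hasExpansion_sopJ hg i J Network.tendsto_one_div_atTop
      (fun k => S.hasExpansion_jam_of_lt hS hg hJ k (h k))
      (S.hasExpansion_second_hop hS hg)).congr_left fun x => ?_
    simp only [mul_neg, ← sub_eq_add_neg, mul_assoc]
  · refine (S.hasExpansion_sopJ hg i J Network.tendsto_log_div_atTop
      (fun k => S.hasExpansion_jam_of_exponential hg hJ k ((h k).1.trans (h k).2) (h k).2)
      (S.hasExpansion_second_hop_log hS hg)).congr_left fun x => ?_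
    simp only [mul_neg, zero_add, Finset.sum_neg_distrib, sub_neg_eq_add]
  · refine (S.hasExpansion_sopJ hg i J Network.tendsto_one_div_atTop
      (fun k => S.hasExpansion_jam_of_one_lt hS hg hJ k (h k).2)
      (S.hasExpansion_second_hop hS hg)).congr_left fun x => ?_
    -- The legitimate shape also exceeds 1, so the first hop contributes nothing at order 1/x.
    have hP : ∀ k, S.P (Channel.SR i) * S.C₁ i k J = 0 := fun k => by
      rw [S.P_of_one_lt_shape ((h k).2.trans_eq (h k).1.symm), zero_mul]
    simp only [hP, neg_zero, mul_zero, add_zero]
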